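/- Let $\mathbb{F}$ be a field of characteristic different from $2$. Algebras are commutative, not necessarily associative or unital, $\mathbb{F}$-algebras. For $\eta\in\mathbb{F}\setminus\{0,1\}$ and $\Phi\subseteq\{0,1\}$ let $\mathcal{F}_\Phi(\eta)$ be the fusion rule on $\{0,1,\eta\}$ with $0\star0=\{0\}$, $1\star1=\{1\}$, $0\star1=1\star0=\Phi$, $0\star\eta=\eta\star0=1\star\eta=\eta\star1=\{\eta\}$, $\eta\star\eta=\{0,1\}$. An $\mathcal{F}_\Phi(\eta)$-axis of an algebra $M$ is an idempotent $a$ such that $M=M_0\oplus M_1\oplus M_\eta$, where $M_s$ is the $s$-eigenspace of multiplication by $a$, and $M_sM_t\subseteq\bigoplus_{i\in s\star t}M_i$ for all $s,t$. A 2-generated $\mathcal{F}_\Phi(\eta)$-axial algebra is an algebra $M$ with two $\mathcal{F}_\Phi(\eta)$-axes $a_0,a_1$ that generate $M$ as an algebra. Isomorphisms of such algebras are algebra isomorphisms that map the set of the two generating axes onto the set of the two generating axes. Explicit algebras, each with its generating axes ($\oplus$ is the direct sum of algebras): - $1A=\mathbb{F}a$ with $aa=a$ (axis $a$; the pair $\{a,0\}$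 is also admitted as the set of generating axes of $1A$); - $\widehat{1A}=\mathbb{F}a\oplus\mathbb{F}b$, with $a,b$ orthogonal idempotents (axes $a$, $a+b$); - $2A=\mathbb{F}s_0\oplus\mathbb{F}s_1$, with $s_0,s_1$ orthogonal idempotents (axes $s_0,s_1$); - $\widehat{2A}=1A\oplus2A$ (axes $a+s_0$, $a+s_1$); - $3C(\eta)$ with basis $a_0,a_1,a_{-1}$, $a_ia_i=a_i$, $a_ia_j=\frac{\eta}{2}(a_i+a_j-a_k)$ for $\{i,j,k\}=\{0,1,-1\}$ (axes $a_0,a_1$); - $\widehat{3C}(\eta)$ with basis $\hat q,\hat a_0,\hat a_1,\hat a_{-1}$, $\hat qx=(\eta+1)x$ for all $x$, $\hat a_i\hat a_i=\hat a_i$, $\hat a_i\hat a_j=-\frac12\hat q+\frac{\eta+1}{2}(\hat a_i+\hat a_j)+\frac{1-\eta}{2}\hat a_k$ for $\{i,j,k\}=\{0,1,-1\}$ (axes $\hat a_0,\hat a_1$); - $3C(\eta)\oplus1A$ (axes $a_0$, $a_1+s$, where $s$ is the axis of $1A$); - $3C(\eta)\oplus2A$ (axes $a_0+s_0$, $a_1+s_1$);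 - $\widehat{3C}(\eta)\oplus1A$ (axes $\hat a_0$, $\hat a_1+s$); - $\widehat4(\eta)=\widehat{3C}(\eta)\oplus2A$ (axes $\hat a_0+s_0$, $\hat a_1+s_1$). For $\eta=-1$ there are six further algebras, with the images of the generating axes as generating axes: the quotients of $3C(-1)$, $3C(-1)\oplus1A$ and $3C(-1)\oplus2A$ by the ideal $\mathbb{F}(a_0+a_1+a_{-1})$, and the quotients of $\widehat{3C}(-1)$, $\widehat{3C}(-1)\oplus1A$ and $\widehat4(-1)$ by the ideal $\mathbb{F}\hat q$. **Theorem.** Let $\Phi\subseteq\{0,1\}$, $\Phi\neq\{0,1\}$, and let $(M,\{a_0,a_1\})$ be a 2-generated $\mathcal{F}_\Phi(\eta)$-axial algebra with $M\neq0$ and $\eta\neq0,1,\frac12$. If $\eta\neq-1$, then $M$ is isomorphic to one of the ten algebras listed first. If $\eta=-1$ (so that $\mathbb{F}$ does not have characteristic $3$), then $M$ is isomorphic to one of the sixteen algebras listed. Moreover, $M\cong\widehat4(\eta)/R$ by an isomorphism that sends $a_0,a_1$, in this order, to the images of $\hat a_0+s_0,\hat a_1+s_1$, where $R$ is one of the ideals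 given here for the algebra in question. Put $r=\hat q-(\hat a_0+\hat a_1+\hat a_{-1})$, $D=\mathrm{Span}\{\hat a_0-\hat a_{-1},\hat a_1-\hat a_0,\hat q-(\eta+1)\hat a_0\}$ and $E=\mathrm{Span}\{\hat a_0,\hat a_1,\hat a_{-1},\hat q-(\eta+1)\hat a_0\}$, and let $j$ be $0$ or $1$. The ideals are: for $1A$, $E+\mathbb{F}s_j$ or $D+\mathbb{F}s_0+\mathbb{F}s_1$; for $\widehat{1A}$, $D+\mathbb{F}s_j$; for $2A$, $E$; for $\widehat{2A}$, $D$; for $3C(\eta)$, $\mathrm{Span}\{s_0,s_1,r\}$; for $\widehat{3C}(\eta)$, $\mathrm{Span}\{s_0,s_1\}$; for $3C(\eta)\oplus1A$, $\mathrm{Span}\{s_j,r\}$; for $3C(\eta)\oplus2A$, $\mathbb{F}r$; for $\widehat{3C}(\eta)\oplus1A$, $\mathbb{F}s_j$; for $\widehat4(\eta)$, $0$. For the six further algebras one adds $\mathbb{F}\hat q$ to the ideal of the algebra with $\eta=-1$ of which it is a quotient. -/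

import Mathlib

universe u v w

/-! Fusion rules, axes and axial algebras.

A commutative nonassociative algebra over a field `F` is a `NonUnitalNonAssocCommRing` with a
compatible `F`-module structure. -/

/-- A fusion rule on a set `S`: a map from `S × S` to the subsets of `S`. -/
structure FusionRule (S : Type u) where
  star : S → S → Set S

/-- The eigenspace of the multiplication by `a` for the eigenvalue `c`. -/
def eigSpace {F : Type u} [Field F] {M : Type v} [NonUnitalNonAssocCommRing M] [Module F M]
    [IsScalarTower F M M] [SMulCommClass F M M] (a : M) (c : F) : Submodule F M :=
  Module.End.eigenspace (LinearMap.mulLeft F a) c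

/-- For a fusion rule on `S` and an injection `ev : S → F` (which regards `S` as a subset of `F`):
`a` is an idempotent, the algebra is the direct sum of the eigenspaces of `a` for the elements of
`S`, and these eigenspaces obey the fusion rule. -/
structure IsAxis {F : Type u} [Field F] {S : Type w} (R : FusionRule S) (ev : S → F)
    {M : Type v} [NonUnitalNonAssocCommRing M] [Module F M]
    [IsScalarTower F M M] [SMulCommClass F M M] (a : M) : Prop where
  idem : a * a = a
  indep : iSupIndep fun s : S => eigSpace a (ev s)
  span : ⨆ s : S, eigSpace a (ev s) = ⊤
  fusion : ∀ s t : S, ∀ x ∈ eigSpace a (ev s), ∀ y ∈ eigSpace a (ev t),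
    x * y ∈ ⨆ i ∈ R.star s t, eigSpace a (ev i)

/-- `(M, A)` is an axial algebra: `A` is a set of axes that generates `M` as an algebra. -/
structure IsAxialAlgebra {F : Type u} [Field F] {S : Type w} (R : FusionRule S) (ev : S → F)
    {M : Type v} [NonUnitalNonAssocCommRing M] [Module F M]
    [IsScalarTower F M M] [SMulCommClass F M M] (A : Set M) : Prop where
  axis : ∀ a ∈ A, IsAxis R ev a
  generates : NonUnitalAlgebra.adjoin F A = ⊤

/-- The labels of the three eigenvalues `0`, `1`, `η`. -/
inductive JordanLabel where
  | zero
  | one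
  | eta

/-- The eigenvalue that belongs to a label. -/
def JordanLabel.ev {F : Type u} [Field F] (η : F) : JordanLabel → F
  | .zero => 0
  | .one => 1
  | .eta => η

/-- The fusion rule `F_Φ(η)`: the Jordan type rule with `0 ⋆ 1 = 1 ⋆ 0 = Φ`. -/
def jordanRule (Φ : Set JordanLabel) : FusionRule JordanLabel where
  star
    | .zero, .zero => {.zero}
    | .zero, .one => Φ
    | .zero, .eta => {.eta}
    | .one, .zero => Φ
    | .one, .one => {.one}
    | .one, .eta => {.eta}
    | .eta, .zero => {.eta}
    | .eta, .one => {.eta}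
    | .eta, .eta => {.zero, .one}

/-- `(M, A)` is an `F_Φ(η)`-axial algebra. -/
def IsJordanAxialAlgebra {F : Type u} [Field F] (Φ : Set JordanLabel) (η : F)
    {M : Type v} [NonUnitalNonAssocCommRing M] [Module F M]
    [IsScalarTower F M M] [SMulCommClass F M M] (A : Set M) : Prop :=
  IsAxialAlgebra (jordanRule Φ) (JordanLabel.ev η) A

/-- Isomorphism of algebras with distinguished sets of elements: an isomorphism of algebras that
maps one set onto the other. -/
def AxialIso (F : Type u) [Field F] {M : Type v} [NonUnitalNonAssocCommRing M] [Module F M]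
    {N : Type w} [NonUnitalNonAssocCommRing N] [Module F N] (A : Set M) (B : Set N) : Prop :=
  ∃ φ : M →ₙₐ[F] N, Function.Bijective φ ∧ φ '' A = B

/-- The direct sum of two commutative nonassociative algebras. -/
instance prodNonUnitalNonAssocCommRing {M : Type v} {N : Type w} [NonUnitalNonAssocCommRing M]
    [NonUnitalNonAssocCommRing N] : NonUnitalNonAssocCommRing (M × N) where
  mul_comm x y := Prod.ext (mul_comm x.1 y.1) (mul_comm x.2 y.2)

/-! Algebras given by a multiplication table of a basis. -/

/-- A commutative multiplication table on a basis indexed by `ι`. -/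
structure MulTable (ι : Type) (F : Type u) where
  prod : ι → ι → (ι → F)
  comm : ∀ i j, prod i j = prod j i

/-- The algebra with basis indexed by `ι` and multiplication table `T`. -/
def MulTable.Alg {ι : Type} {F : Type u} (_T : MulTable ι F) : Type u := ι → F

namespace MulTable

variable {ι : Type} [Fintype ι] {F : Type u} [Field F] (T : MulTable ι F)

instance : AddCommGroup T.Alg := inferInstanceAs (AddCommGroup (ι → F))

instance : Module F T.Alg := inferInstanceAs (Module F (ι → F))

instance : Mul T.Alg where
  mul x y := ((∑ i, ∑ j, (x i * y j) • T.prod i j : ι → F))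

theorem mul_def (x y : T.Alg) :
    x * y = ((∑ i, ∑ j, (x i * y j) • T.prod i j : ι → F)) := rfl

theorem mul_comm' (x y : T.Alg) : x * y = y * x := by
  rw [mul_def, mul_def, Finset.sum_comm]
  refine Finset.sum_congr rfl fun i _ => Finset.sum_congr rfl fun j _ => ?_
  rw [T.comm j i, mul_comm (x j)]

theorem mul_add' (x y z : T.Alg) : x * (y + z) = x * y + x * z := by
  rw [mul_def, mul_def, mul_def]
  have h : ∀ j, (y + z : T.Alg) j = y j + z j := fun _ => rfl
  change _ = ((∑ i, ∑ j, (x i * y j) • T.prod i j) + (∑ i, ∑ j, (x i * z j) • T.prod i j) : ι → F)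
  simp only [h, mul_add, add_smul, Finset.sum_add_distrib]

theorem mul_smul' (c : F) (x y : T.Alg) : x * (c • y) = c • (x * y) := by
  rw [mul_def, mul_def]
  have h : ∀ j, (c • y : T.Alg) j = c * y j := fun _ => rfl
  change _ = (c • (∑ i, ∑ j, (x i * y j) • T.prod i j) : ι → F)
  simp only [h, Finset.smul_sum, smul_smul, mul_left_comm]

theorem zero_mul' (x : T.Alg) : 0 * x = 0 := by
  have h := T.mul_smul' 0 x 0
  rw [zero_smul, zero_smul] at h
  rw [mul_comm', h]

instance : NonUnitalNonAssocCommRing T.Alg where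
  left_distrib := T.mul_add'
  right_distrib x y z := by
    rw [T.mul_comm' (x + y), T.mul_add', T.mul_comm' z x, T.mul_comm' z y]
  zero_mul := T.zero_mul'
  mul_zero x := by rw [T.mul_comm', T.zero_mul']
  mul_comm := T.mul_comm'

instance : SMulCommClass F T.Alg T.Alg where
  smul_comm c x y := (T.mul_smul' c x y).symm

instance : IsScalarTower F T.Alg T.Alg where
  smul_assoc c x y := by
    change (c • x) * y = c • (x * y)
    rw [T.mul_comm' (c • x), T.mul_smul', T.mul_comm' y]

/-- The basis vectors. -/
def basis [DecidableEq ι] (i : ι) : T.Alg := (Pi.single i 1 : ι → F)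

end MulTable

/-! Quotients by ideals. -/

/-- An ideal of a commutative nonassociative algebra. -/
structure AlgIdeal (F : Type u) [Field F] (A : Type v) [NonUnitalNonAssocCommRing A]
    [Module F A] where
  carrier : Submodule F A
  mul_mem : ∀ a : A, ∀ x ∈ carrier, a * x ∈ carrier

/-- The quotient algebra. -/
def AlgIdeal.Quot {F : Type u} [Field F] {A : Type v} [NonUnitalNonAssocCommRing A]
    [Module F A] (I : AlgIdeal F A) : Type v := A ⧸ I.carrier

namespace AlgIdeal

variable {F : Type u} [Field F] {A : Type v} [NonUnitalNonAssocCommRing A] [Module F A]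

instance (I : AlgIdeal F A) : AddCommGroup I.Quot := inferInstanceAs (AddCommGroup (A ⧸ I.carrier))

instance (I : AlgIdeal F A) : Module F I.Quot := inferInstanceAs (Module F (A ⧸ I.carrier))

/-- The class of an element in the quotient algebra. -/
def proj (I : AlgIdeal F A) (x : A) : I.Quot := Submodule.Quotient.mk (p := I.carrier) x

theorem proj_surjective (I : AlgIdeal F A) : Function.Surjective I.proj :=
  Submodule.Quotient.mk_surjective I.carrier

theorem proj_eq_iff (I : AlgIdeal F A) (x y : A) : I.proj x = I.proj y ↔ x - y ∈ I.carrier :=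
  Submodule.Quotient.eq I.carrier

theorem mul_congr (I : AlgIdeal F A) (x x' y y' : A) (hx : I.proj x = I.proj x')
    (hy : I.proj y = I.proj y') : I.proj (x * y) = I.proj (x' * y') := by
  rw [proj_eq_iff] at *
  have h : x * y - x' * y' = y * (x - x') + x' * (y - y') := by
    rw [mul_sub, mul_sub, mul_comm y x, mul_comm y x']; abel
  rw [h]
  exact I.carrier.add_mem (I.mul_mem _ _ hx) (I.mul_mem _ _ hy)

instance (I : AlgIdeal F A) : Mul I.Quot where
  mul := Quotient.map₂ (· * ·) (by
    intro x x' hx y y' hy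
    exact Quotient.exact (I.mul_congr x x' y y' (Quotient.sound hx) (Quotient.sound hy)))

theorem proj_mul (I : AlgIdeal F A) (x y : A) : I.proj (x * y) = I.proj x * I.proj y := rfl

theorem proj_add (I : AlgIdeal F A) (x y : A) : I.proj (x + y) = I.proj x + I.proj y := rfl

theorem proj_smul (I : AlgIdeal F A) (c : F) (x : A) : I.proj (c • x) = c • I.proj x := rfl

theorem proj_zero (I : AlgIdeal F A) : I.proj 0 = 0 := rfl

instance (I : AlgIdeal F A) : NonUnitalNonAssocCommRing I.Quot where
  left_distrib a b c := by
    obtain ⟨x, rfl⟩ := I.proj_surjective a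
    obtain ⟨y, rfl⟩ := I.proj_surjective b
    obtain ⟨z, rfl⟩ := I.proj_surjective c
    rw [← proj_add, ← proj_mul, ← proj_mul, ← proj_mul, ← proj_add, mul_add]
  right_distrib a b c := by
    obtain ⟨x, rfl⟩ := I.proj_surjective a
    obtain ⟨y, rfl⟩ := I.proj_surjective b
    obtain ⟨z, rfl⟩ := I.proj_surjective c
    rw [← proj_add, ← proj_mul, ← proj_mul, ← proj_mul, ← proj_add, add_mul]
  zero_mul a := by
    obtain ⟨x, rfl⟩ := I.proj_surjective a
    rw [← proj_zero, ← proj_mul, zero_mul]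
  mul_zero a := by
    obtain ⟨x, rfl⟩ := I.proj_surjective a
    rw [← proj_zero, ← proj_mul, mul_zero]
  mul_comm a b := by
    obtain ⟨x, rfl⟩ := I.proj_surjective a
    obtain ⟨y, rfl⟩ := I.proj_surjective b
    rw [← proj_mul, ← proj_mul, mul_comm]

instance [SMulCommClass F A A] (I : AlgIdeal F A) : SMulCommClass F I.Quot I.Quot where
  smul_comm c a b := by
    obtain ⟨x, rfl⟩ := I.proj_surjective a
    obtain ⟨y, rfl⟩ := I.proj_surjective b
    change c • (I.proj x * I.proj y) = I.proj x * (c • I.proj y)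
    rw [← proj_mul, ← proj_smul, ← proj_smul, ← proj_mul, mul_smul_comm]

instance [IsScalarTower F A A] (I : AlgIdeal F A) : IsScalarTower F I.Quot I.Quot where
  smul_assoc c a b := by
    obtain ⟨x, rfl⟩ := I.proj_surjective a
    obtain ⟨y, rfl⟩ := I.proj_surjective b
    change (c • I.proj x) * I.proj y = c • (I.proj x * I.proj y)
    rw [← proj_mul, ← proj_smul, ← proj_smul, ← proj_mul, smul_mul_assoc]

/-- The line spanned by an element that annihilates the whole algebra, as an ideal. -/
def line [SMulCommClass F A A] (z : A) (hz : ∀ a : A, a * z = 0) : AlgIdeal F A where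
  carrier := Submodule.span F {z}
  mul_mem a x hx := by
    obtain ⟨c, rfl⟩ := Submodule.mem_span_singleton.1 hx
    rw [mul_smul_comm, hz, smul_zero]
    exact Submodule.zero_mem _

end AlgIdeal

/-! The explicit algebras. The algebra `1A` is `F` itself with axis `1`, and `2A` is `F × F` with
axes `(1, 0)` and `(0, 1)`. The indices `0`, `1`, `-1` of the axes of `3C(η)` are taken in
`ZMod 3`, so that `-i - j` is the third index if `i ≠ j`. -/

/-- Multiplication table of `3C(η)`: `aᵢ aᵢ = aᵢ` and `aᵢ aⱼ = (η/2) (aᵢ + aⱼ - aₖ)`. -/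
def threeCTable {F : Type u} [Field F] (η : F) : MulTable (ZMod 3) F where
  prod i j :=
    if i = j then Pi.single i 1
    else (η / 2) • (Pi.single i 1 + Pi.single j 1 - Pi.single (-i - j) 1)
  comm i j := by
    by_cases h : i = j
    · rw [h]
    · rw [if_neg h, if_neg (Ne.symm h), add_comm, show -j - i = -i - j by ring]

/-- The algebra `3C(η)`. -/
abbrev ThreeC {F : Type u} [Field F] (η : F) : Type u := (threeCTable η).Alg

/-- The axes `a₀`, `a₁`, `a₋₁` of `3C(η)`. -/
def ThreeC.a {F : Type u} [Field F] (η : F) (i : ZMod 3) : ThreeC η := (threeCTable η).basis i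

/-- Multiplication table of the four-dimensional algebra `3Ĉ(η)` with basis `q̂` (the index
`none`), `â₀`, `â₁`, `â₋₁`: `q̂ x = (η + 1) x` for all `x`, `âᵢ âᵢ = âᵢ`, and
`âᵢ âⱼ = -(1/2) q̂ + ((η + 1)/2) (âᵢ + âⱼ) + ((1 - η)/2) âₖ` for `{i, j, k} = {0, 1, -1}`. -/
def hatThreeCTable {F : Type u} [Field F] (η : F) : MulTable (Option (ZMod 3)) F where
  prod
    | none, none => (η + 1) • Pi.single none 1
    | none, some j => (η + 1) • Pi.single (some j) 1
    | some i, none => (η + 1) • Pi.single (some i) 1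
    | some i, some j =>
      if i = j then Pi.single (some i) 1
      else (-(1 / 2) : F) • Pi.single none 1
        + ((η + 1) / 2) • (Pi.single (some i) 1 + Pi.single (some j) 1)
        + ((1 - η) / 2) • Pi.single (some (-i - j)) 1
  comm i j := by
    rcases i with _ | i <;> rcases j with _ | j
    · rfl
    · rfl
    · rfl
    · by_cases h : i = j
      · rw [h]
      · simp only [if_neg h, if_neg (Ne.symm h)]
        rw [add_comm (Pi.single (some i) 1 : Option (ZMod 3) → F), show -j - i = -i - j by ring]

/-- The algebra `3Ĉ(η)`. -/
abbrev HatThreeC {F : Type u} [Field F] (η : F) : Type u := (hatThreeCTable η).Alg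

/-- The axes `â₀`, `â₁`, `â₋₁` of `3Ĉ(η)`. -/
def HatThreeC.a {F : Type u} [Field F] (η : F) (i : ZMod 3) : HatThreeC η :=
  (hatThreeCTable η).basis (some i)

/-- The element `q̂` of `3Ĉ(η)`. -/
def HatThreeC.q {F : Type u} [Field F] (η : F) : HatThreeC η := (hatThreeCTable η).basis none

/-- The six-dimensional algebra `4̂(η) = 3Ĉ(η) ⊕ 2A`. -/
abbrev HatFour {F : Type u} [Field F] (η : F) : Type u := HatThreeC η × (F × F)

namespace HatFour

variable {F : Type u} [Field F] (η : F)

/-- The elements `â₀`, `â₁`, `â₋₁` of `4̂(η)`. -/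
def a (i : ZMod 3) : HatFour η := (HatThreeC.a η i, 0)

/-- The element `q̂` of `4̂(η)`. -/
def q : HatFour η := (HatThreeC.q η, 0)

/-- The axis `s₀` of the summand `2A`. -/
def s₀ : HatFour η := (0, (1, 0))

/-- The axis `s₁` of the summand `2A`. -/
def s₁ : HatFour η := (0, (0, 1))

/-- The first generating axis `â₀ + s₀` of `4̂(η)`. -/
def axis₀ : HatFour η := a η 0 + s₀ η

/-- The second generating axis `â₁ + s₁` of `4̂(η)`. -/
def axis₁ : HatFour η := a η 1 + s₁ η

end HatFour

/-- `(M, (a₀, a₁))` is isomorphic to the quotient of `4̂(η)` with its two generating axes by the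
ideal `R`: there is a surjective homomorphism from `4̂(η)` to `M` with kernel `R` that maps the
generating axes to `a₀` and `a₁`, in this order. -/
def IsQuotientOfHatFour {F : Type u} [Field F] (η : F)
    {M : Type v} [NonUnitalNonAssocCommRing M] [Module F M] (a₀ a₁ : M)
    (R : Submodule F (HatFour η)) : Prop :=
  ∃ π : HatFour η →ₙₐ[F] M, Function.Surjective π ∧
    π (HatFour.axis₀ η) = a₀ ∧ π (HatFour.axis₁ η) = a₁ ∧ ∀ x, π x = 0 ↔ x ∈ R

/-- The names of the ten algebras that exist for every `η`. -/
inductive GenericName where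
  /-- `1A` -/
  | oneA
  /-- `1Â` -/
  | hatOneA
  /-- `2A` -/
  | twoA
  /-- `2Â = 1A ⊕ 2A` -/
  | hatTwoA
  /-- `3C(η)` -/
  | threeC
  /-- `3Ĉ(η)` -/
  | hatThreeC
  /-- `3C(η) ⊕ 1A` -/
  | threeC_oneA
  /-- `3C(η) ⊕ 2A` -/
  | threeC_twoA
  /-- `3Ĉ(η) ⊕ 1A` -/
  | hatThreeC_oneA
  /-- `4̂(η) = 3Ĉ(η) ⊕ 2A` -/
  | hatFour

/-- `(M, A)` is isomorphic to the named algebra with its generating axes. For `1A`, the zero vector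
may occur as a second axis. -/
def GenericName.Iso {F : Type u} [Field F] (η : F) {M : Type v} [NonUnitalNonAssocCommRing M]
    [Module F M] (A : Set M) : GenericName → Prop
  | .oneA => AxialIso F A ({1} : Set F) ∨ AxialIso F A ({1, 0} : Set F)
  | .hatOneA => AxialIso F A ({(1, 0), (1, 1)} : Set (F × F))
  | .twoA => AxialIso F A ({(1, 0), (0, 1)} : Set (F × F))
  | .hatTwoA => AxialIso F A ({(1, (1, 0)), (1, (0, 1))} : Set (F × (F × F)))
  | .threeC => AxialIso F A ({ThreeC.a η 0, ThreeC.a η 1} : Set (ThreeC η))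
  | .hatThreeC => AxialIso F A ({HatThreeC.a η 0, HatThreeC.a η 1} : Set (HatThreeC η))
  | .threeC_oneA => AxialIso F A ({(ThreeC.a η 0, 0), (ThreeC.a η 1, 1)} : Set (ThreeC η × F))
  | .threeC_twoA => AxialIso F A
      ({(ThreeC.a η 0, (1, 0)), (ThreeC.a η 1, (0, 1))} : Set (ThreeC η × (F × F)))
  | .hatThreeC_oneA => AxialIso F A
      ({(HatThreeC.a η 0, 0), (HatThreeC.a η 1, 1)} : Set (HatThreeC η × F))
  | .hatFour => AxialIso F A ({HatFour.axis₀ η, HatFour.axis₁ η} : Set (HatFour η))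

open HatFour in
/-- The ideals `R` of `4̂(η)` such that `4̂(η) / R` is the named algebra. -/
def GenericName.ideals {F : Type u} [Field F] (η : F) :
    GenericName → Set (Submodule F (HatFour η))
  | .oneA =>
    {Submodule.span F {a η 0, a η 1, a η (-1), q η - (η + 1) • a η 0, s₀ η},
     Submodule.span F {a η 0, a η 1, a η (-1), q η - (η + 1) • a η 0, s₁ η},
     Submodule.span F {a η 0 - a η (-1), a η 1 - a η 0, q η - (η + 1) • a η 0, s₀ η, s₁ η}}
  | .hatOneA =>
    {Submodule.span F {a η 0 - a η (-1), a η 1 - a η 0, q η - (η + 1) • a η 0, s₀ η},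
     Submodule.span F {a η 0 - a η (-1), a η 1 - a η 0, q η - (η + 1) • a η 0, s₁ η}}
  | .twoA =>
    {Submodule.span F {a η 0, a η 1, a η (-1), q η - (η + 1) • a η 0}}
  | .hatTwoA =>
    {Submodule.span F {a η 0 - a η (-1), a η 1 - a η 0, q η - (η + 1) • a η 0}}
  | .threeC =>
    {Submodule.span F {s₀ η, s₁ η, q η - (a η (-1) + a η 1 + a η 0)}}
  | .hatThreeC =>
    {Submodule.span F {s₀ η, s₁ η}}
  | .threeC_oneA =>
    {Submodule.span F {s₀ η, q η - (a η (-1) + a η 1 + a η 0)},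
     Submodule.span F {s₁ η, q η - (a η (-1) + a η 1 + a η 0)}}
  | .threeC_twoA =>
    {Submodule.span F {q η - (a η (-1) + a η 1 + a η 0)}}
  | .hatThreeC_oneA =>
    {Submodule.span F {s₀ η}, Submodule.span F {s₁ η}}
  | .hatFour => {⊥}

/-! The six additional algebras for `η = -1`. -/

/-- The sum `a₀ + a₁ + a₋₁` in `3C(η)`. -/
def ThreeC.sum {F : Type u} [Field F] (η : F) : ThreeC η :=
  ThreeC.a η 0 + ThreeC.a η 1 + ThreeC.a η (-1)

theorem ThreeC.mul_sum {F : Type u} [Field F] (h2 : (2 : F) ≠ 0) (x : ThreeC (-1 : F)) :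
    x * ThreeC.sum (-1 : F) = 0 := by
  have h3 : ∀ f : ZMod 3 → F, ∑ i, f i = f 0 + f 1 + f 2 := fun f => Fin.sum_univ_three f
  have hs : ∀ i, ThreeC.sum (-1 : F) i = 1 := by
    intro i
    change (Pi.single 0 1 : ZMod 3 → F) i + (Pi.single 1 1 : ZMod 3 → F) i
      + (Pi.single (-1) 1 : ZMod 3 → F) i = 1
    simp only [Pi.single_apply]
    revert i
    rw [show (-1 : ZMod 3) = 2 by decide]
    intro i
    obtain rfl | rfl | rfl : i = 0 ∨ i = 1 ∨ i = 2 := by revert i; decide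
    · rw [if_pos rfl, if_neg (by decide), if_neg (by decide)]; ring
    · rw [if_neg (by decide), if_pos rfl, if_neg (by decide)]; ring
    · rw [if_neg (by decide), if_neg (by decide), if_pos rfl]; ring
  have hp : ∀ i k : ZMod 3, (threeCTable (-1 : F)).prod i 0 k + (threeCTable (-1 : F)).prod i 1 k
      + (threeCTable (-1 : F)).prod i 2 k = 0 := by
    intro i k
    obtain rfl | rfl | rfl : i = 0 ∨ i = 1 ∨ i = 2 := by revert i; decide
    all_goals
      obtain rfl | rfl | rfl : k = 0 ∨ k = 1 ∨ k = 2 := by revert k; decide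
      all_goals
        simp only [threeCTable, show (0 : ZMod 3) ≠ 1 by decide, show (0 : ZMod 3) ≠ 2 by decide,
          show (1 : ZMod 3) ≠ 0 by decide, show (1 : ZMod 3) ≠ 2 by decide,
          show (2 : ZMod 3) ≠ 0 by decide, show (2 : ZMod 3) ≠ 1 by decide,
          show (-0 - 1 : ZMod 3) = 2 by decide, show (-0 - 2 : ZMod 3) = 1 by decide,
          show (-1 - 0 : ZMod 3) = 2 by decide, show (-1 - 2 : ZMod 3) = 0 by decide,
          show (-2 - 0 : ZMod 3) = 1 by decide, show (-2 - 1 : ZMod 3) = 0 by decide,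
          if_true, if_false, Pi.single_apply, Pi.add_apply, Pi.sub_apply, Pi.smul_apply,
          smul_eq_mul]
        field_simp
        ring
  have h : x * ThreeC.sum (-1 : F) = (0 : ZMod 3 → F) := by
    rw [MulTable.mul_def]
    refine Finset.sum_eq_zero fun i _ => ?_
    funext k
    simp only [hs, mul_one, Pi.smul_apply, Finset.sum_apply, h3, ← smul_add, hp, smul_zero]
    rfl
  exact h

theorem HatThreeC.mul_q {F : Type u} [Field F] (x : HatThreeC (-1 : F)) :
    x * HatThreeC.q (-1 : F) = 0 := by
  have hq : ∀ i : ZMod 3, HatThreeC.q (-1 : F) (some i) = 0 := fun i =>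
    Pi.single_eq_of_ne (M := fun _ : Option (ZMod 3) => F) (Option.some_ne_none i) 1
  have h : x * HatThreeC.q (-1 : F) = (0 : Option (ZMod 3) → F) := by
    rw [MulTable.mul_def]
    refine Finset.sum_eq_zero fun i _ => Finset.sum_eq_zero fun j _ => ?_
    rcases j with _ | j
    · have : (hatThreeCTable (-1 : F)).prod i none = 0 := by
        rcases i with _ | i <;> simp [hatThreeCTable]
      rw [this, smul_zero]
      rfl
    · rw [hq, mul_zero, zero_smul]
      rfl
  exact h

/-- The names of the six additional algebras for `η = -1`. -/
inductive SpecialName where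
  /-- `3C(-1)ˣ` -/
  | threeC
  /-- `3Ĉ(-1)ˣ` -/
  | hatThreeC
  /-- `(3C(-1) ⊕ 1A)ˣ` -/
  | threeC_oneA
  /-- `(3C(-1) ⊕ 2A)ˣ` -/
  | threeC_twoA
  /-- `(3Ĉ(-1) ⊕ 1A)ˣ` -/
  | hatThreeC_oneA
  /-- `4̂(-1)ˣ` -/
  | hatFour

section quotients

variable {F : Type u} [Field F]

/-- The ideal of `3C(-1)` spanned by `a₀ + a₁ + a₋₁`. -/
def threeCIdeal (h2 : (2 : F) ≠ 0) : AlgIdeal F (ThreeC (-1 : F)) :=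
  AlgIdeal.line (ThreeC.sum (-1)) (ThreeC.mul_sum h2)

/-- The ideal of `3C(-1) ⊕ B` spanned by `a₀ + a₁ + a₋₁`. -/
def threeCProdIdeal (h2 : (2 : F) ≠ 0) (B : Type u) [NonUnitalNonAssocCommRing B] [Module F B]
    [SMulCommClass F B B] : AlgIdeal F (ThreeC (-1 : F) × B) :=
  AlgIdeal.line (ThreeC.sum (-1), 0) fun x => Prod.ext (ThreeC.mul_sum h2 x.1) (mul_zero x.2)

/-- The ideal of `3Ĉ(-1)` spanned by `q̂`. -/
def hatThreeCIdeal : AlgIdeal F (HatThreeC (-1 : F)) :=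
  AlgIdeal.line (HatThreeC.q (-1)) HatThreeC.mul_q

/-- The ideal of `3Ĉ(-1) ⊕ B` spanned by `q̂`. -/
def hatThreeCProdIdeal (B : Type u) [NonUnitalNonAssocCommRing B] [Module F B]
    [SMulCommClass F B B] : AlgIdeal F (HatThreeC (-1 : F) × B) :=
  AlgIdeal.line (HatThreeC.q (-1), 0) fun x => Prod.ext (HatThreeC.mul_q x.1) (mul_zero x.2)

end quotients

/-- `(M, A)` is isomorphic to the named algebra with its generating axes. -/
def SpecialName.Iso {F : Type u} [Field F] (h2 : (2 : F) ≠ 0) {M : Type v}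
    [NonUnitalNonAssocCommRing M] [Module F M] (A : Set M) : SpecialName → Prop
  | .threeC => AxialIso F A
      ((threeCIdeal h2).proj '' {ThreeC.a (-1 : F) 0, ThreeC.a (-1 : F) 1})
  | .hatThreeC => AxialIso F A
      ((hatThreeCIdeal (F := F)).proj '' {HatThreeC.a (-1 : F) 0, HatThreeC.a (-1 : F) 1})
  | .threeC_oneA => AxialIso F A
      ((threeCProdIdeal h2 F).proj '' {(ThreeC.a (-1) 0, 0), (ThreeC.a (-1) 1, 1)})
  | .threeC_twoA => AxialIso F A
      ((threeCProdIdeal h2 (F × F)).proj ''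
        {(ThreeC.a (-1) 0, (1, 0)), (ThreeC.a (-1) 1, (0, 1))})
  | .hatThreeC_oneA => AxialIso F A
      ((hatThreeCProdIdeal (F := F) F).proj '' {(HatThreeC.a (-1) 0, 0), (HatThreeC.a (-1) 1, 1)})
  | .hatFour => AxialIso F A
      ((hatThreeCProdIdeal (F := F) (F × F)).proj '' {HatFour.axis₀ (-1 : F), HatFour.axis₁ (-1 : F)})

open HatFour in
/-- The ideals `R` of `4̂(-1)` such that `4̂(-1) / R` is the named algebra. -/
def SpecialName.ideals (F : Type u) [Field F] : SpecialName → Set (Submodule F (HatFour (-1 : F)))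
  | .threeC =>
    {Submodule.span F {s₀ (-1), s₁ (-1), a (-1) (-1) + a (-1) 1 + a (-1) 0, q (-1)}}
  | .hatThreeC =>
    {Submodule.span F {s₀ (-1), s₁ (-1), q (-1)}}
  | .threeC_oneA =>
    {Submodule.span F {s₀ (-1), a (-1) (-1) + a (-1) 1 + a (-1) 0, q (-1)},
     Submodule.span F {s₁ (-1), a (-1) (-1) + a (-1) 1 + a (-1) 0, q (-1)}}
  | .threeC_twoA =>
    {Submodule.span F {a (-1) (-1) + a (-1) 1 + a (-1) 0, q (-1)}}
  | .hatThreeC_oneA =>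
    {Submodule.span F {s₀ (-1), q (-1)}, Submodule.span F {s₁ (-1), q (-1)}}
  | .hatFour =>
    {Submodule.span F {q (-1)}}

/-! The eigenvalues `0` and `1` of an axis together give the even part of a `ℤ/2`-grading whose odd
part is the `η`-eigenspace. Nearly every relation is found by taking an identity that involves the
second axis, splitting it into even and odd components with respect to the first, and comparing with
the mirror image under exchange of the axes. For axes `a`, `b` the basic element is `q = ab - η(a +
b)`, which is even for both; put `u = aq` and `v = bq`.

The fusion rules differ only in the products of `0`- and `1`-eigenvectors. If `Φ ⊆ {0}`, the
projection of the even part to the `1`-eigenspace is multiplicative; if `Φ ⊆ {1}`, the projection to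
the `0`-eigenspace is. The critical product is the defect `(q - u)u`, and the heart of the proof is
that it vanishes (`IsZeroAxisPair.defect_eq_zero`). For `Φ ⊆ {0}`, the defect `d` and its mirror
image `d'` span a space on which `a` and `b` act by explicit matrices, and `ηd' - d` is odd for `a`
while `d` is even. The mirror comparison gives `(4 + 2η - 5η²)(d - d') = 0`, and `d = d'` forces `d
= 0`. For the roots of the quadratic factor, the products of the defects with each other give a
second relation that suffices. The case `Φ ⊆ {1}` is reduced to this one by adjoining a unit and
passing to `1 - a`, `1 - b`, which exchanges the eigenvalues `0` and `1` and replaces `η` by `1 - η`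
(`IsOneAxisPair.one_sub`).

Once the defect is zero, the products of `a`, `b`, `q` and three further elements `s`, `t`, `r` are
forced (`IsTamePair.exists_table`). This is the table of `4̂(η)`, so the axes define a homomorphism
from `4̂(η)`, which is surjective because they generate.

It remains to list the ideals of `4̂(η)`. They are products `K × A × B`, where `A`, `B` are `0` or
`F` and `K` is an ideal of `3Ĉ(η)`. An ideal with an element whose three coordinates at `â₀`, `â₁`,
`â₋₁` are not all equal contains the kernel of the map onto `1A`; any other ideal is spanned by some
of `r` and `q̂`, and `q̂` can occur only for `η = -1` (`HatThreeC.IsIdeal.classification`). Each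
quotient is identified with a listed algebra by comparing two surjections with the same kernel. If
`s₁` rather than `s₀` alone is divided out, the automorphism that exchanges `â₀` and `â₁` is applied
first. -/

/-! ### Two idempotents with `ℤ/2`-graded eigenspaces -/

section GradedAxes

variable {F : Type u} [Field F] {M : Type v} [NonUnitalNonAssocCommRing M] [Module F M]
  [IsScalarTower F M M] [SMulCommClass F M M]

/-- The sum of the eigenspaces of `a` for `0` and `1`. -/
def evenPart (F : Type u) [Field F] {M : Type v} [NonUnitalNonAssocCommRing M] [Module F M]
    [IsScalarTower F M M] [SMulCommClass F M M] (a : M) : Submodule F M :=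
  LinearMap.ker (LinearMap.mulLeft F a ∘ₗ LinearMap.mulLeft F a - LinearMap.mulLeft F a)

theorem mem_evenPart {a x : M} : x ∈ evenPart F a ↔ a * (a * x) = a * x := by
  simp [evenPart, sub_eq_zero]

theorem mem_eigSpace {a x : M} {c : F} : x ∈ eigSpace a c ↔ a * x = c • x := by
  simp [eigSpace]

/-- An idempotent with eigenvalues `0`, `1`, `h` whose eigenspaces are `ℤ/2`-graded, the
eigenspace for `h` being the odd part. -/
structure IsGradedAxis (h : F) (a : M) : Prop where
  idem : a * a = a
  cubic : ∀ x, a * (a * (a * x)) = (1 + h) • (a * (a * x)) - h • (a * x)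
  even_even : ∀ {x y}, x ∈ evenPart F a → y ∈ evenPart F a → x * y ∈ evenPart F a
  even_odd : ∀ {x y}, x ∈ evenPart F a → y ∈ eigSpace a h → x * y ∈ eigSpace a h
  odd_odd : ∀ {x y}, x ∈ eigSpace a h → y ∈ eigSpace a h → x * y ∈ evenPart F a

namespace IsGradedAxis

variable {h : F} {a : M}

theorem odd_even (ha : IsGradedAxis h a) {x y : M} (hx : x ∈ eigSpace a h)
    (hy : y ∈ evenPart F a) : x * y ∈ eigSpace a h := by
  rw [mul_comm]; exact ha.even_odd hy hx

theorem self_mem (ha : IsGradedAxis h a) : a ∈ evenPart F a := by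
  rw [mem_evenPart, ha.idem, ha.idem]

/-- By `cubic`, the operator `a(a - 1)(a - h)` is zero, so `a(a - 1)` kills the image of `a - h`. -/
theorem mul_sub_smul_mem (ha : IsGradedAxis h a) (x : M) : a * x - h • x ∈ evenPart F a := by
  rw [mem_evenPart]
  simp only [mul_sub, mul_smul_comm]
  linear_combination (norm := module) ha.cubic x

end IsGradedAxis

theorem eq_zero_of_even_of_odd {h : F} (h0 : h ≠ 0) (h1 : h ≠ 1) {a x : M}
    (hx : x ∈ evenPart F a) (hx' : x ∈ eigSpace a h) : x = 0 := by
  rw [mem_evenPart] at hx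
  rw [mem_eigSpace] at hx'
  rw [hx', mul_smul_comm, hx'] at hx
  have : (h * (h - 1)) • x = 0 := by linear_combination (norm := module) hx
  exact (smul_eq_zero.1 this).resolve_left (mul_ne_zero h0 (sub_ne_zero.2 h1))

/-- If `x + y = x' + y'` with even `x`, `x'` and odd `y`, `y'`, then `y = y'`. -/
theorem odd_eq_of_add_eq {h : F} (h0 : h ≠ 0) (h1 : h ≠ 1) {a x y x' y' : M}
    (hx : x ∈ evenPart F a) (hy : y ∈ eigSpace a h) (hx' : x' ∈ evenPart F a)
    (hy' : y' ∈ eigSpace a h) (e : x + y = x' + y') : y = y' := by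
  have e' : x - x' = y' - y := by
    rw [sub_eq_sub_iff_add_eq_add, e, add_comm]
  have := eq_zero_of_even_of_odd h0 h1 (sub_mem hx hx') (e' ▸ sub_mem hy' hy)
  rw [e', sub_eq_zero] at this
  exact this.symm

/-- Two graded axes `a`, `b` with the elements `q = ab - h(a + b)`, `u = aq` and `v = bq`. -/
structure IsAxisPair (h : F) (a b q u v : M) : Prop where
  left : IsGradedAxis h a
  right : IsGradedAxis h b
  mul_eq : a * b = q + h • a + h • b
  left_mul : a * q = u
  right_mul : b * q = v

/-- A multiple of the odd part of `b` with respect to `a`. -/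
def oddVec (h : F) (a b q u : M) : M := (h * (1 - h)) • b + (1 - h) • q - u - (h ^ 2) • a

/-- A multiple of the even part of `b` with respect to `a`. -/
def evenVec (h : F) (a q u : M) : M := u + (h ^ 2) • a - (1 - h) • q

/-- With `oddVec_mem` and `evenVec_mem` this is the decomposition of `b` into odd and even part; the
factor `h(1 - h)` clears the denominators. -/
theorem smul_eq_oddVec_add_evenVec (h : F) (a b q u : M) :
    (h * (1 - h)) • b = oddVec h a b q u + evenVec h a q u := by
  rw [oddVec, evenVec]; module

namespace IsAxisPair

variable {h : F} {a b q u v : M}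

theorem symm (H : IsAxisPair h a b q u v) : IsAxisPair h b a q v u where
  left := H.right
  right := H.left
  mul_eq := by rw [mul_comm, H.mul_eq]; abel
  left_mul := H.right_mul
  right_mul := H.left_mul

/-- The vector `ab - hb` is even by `mul_sub_smul_mem`, and so is `a`. By symmetry `q` is even for
`b` too, which makes it preferable to `ab`. -/
theorem q_mem (H : IsAxisPair h a b q u v) : q ∈ evenPart F a := by
  have e : q = (a * b - h • b) - h • a := by rw [H.mul_eq]; module
  rw [e]
  exact sub_mem (H.left.mul_sub_smul_mem b) (Submodule.smul_mem _ _ H.left.self_mem)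

theorem left_mul_u (H : IsAxisPair h a b q u v) : a * u = u := by
  have := mem_evenPart.1 H.q_mem
  rwa [H.left_mul] at this

theorem u_mem (H : IsAxisPair h a b q u v) : u ∈ evenPart F a := by
  rw [mem_evenPart, H.left_mul_u, H.left_mul_u]

theorem evenVec_mem (H : IsAxisPair h a b q u v) : evenVec h a q u ∈ evenPart F a :=
  sub_mem (add_mem H.u_mem (Submodule.smul_mem _ _ H.left.self_mem))
    (Submodule.smul_mem _ _ H.q_mem)

theorem oddVec_mem (H : IsAxisPair h a b q u v) : oddVec h a b q u ∈ eigSpace a h := by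
  rw [mem_eigSpace, oddVec]
  simp only [mul_sub, mul_add, mul_smul_comm, H.mul_eq, H.left_mul, H.left_mul_u, H.left.idem]
  module

/-- The idempotency of `b`, split into odd and even part with respect to `a`. -/
theorem two_evenVec_mul_oddVec (H : IsAxisPair h a b q u v) (h0 : h ≠ 0) (h1 : h ≠ 1) :
    (2 : F) • (evenVec h a q u * oddVec h a b q u) = (h * (1 - h)) • oddVec h a b q u := by
  set B := oddVec h a b q u with hB
  set P := evenVec h a q u with hP
  have hb := smul_eq_oddVec_add_evenVec h a b q u
  have hPe := H.evenVec_mem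
  have hBo := H.oddVec_mem
  rw [← hB] at hb hBo
  rw [← hP] at hb hPe
  have e : (B + P) * (B + P) = (h * (1 - h)) • (B + P) := by
    rw [← hb, smul_mul_smul_comm, H.right.idem, smul_smul]
  simp only [mul_add, add_mul, mul_comm B P] at e
  refine odd_eq_of_add_eq h0 h1 (add_mem (H.left.odd_odd hBo hBo) (H.left.even_even hPe hPe))
    (Submodule.smul_mem _ _ (H.left.even_odd hPe hBo)) (Submodule.smul_mem _ (h * (1 - h)) hPe)
    (Submodule.smul_mem _ _ hBo) ?_
  linear_combination (norm := module) e

/-- The even component of the identity whose odd component is `two_evenVec_mul_oddVec`. -/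
theorem oddVec_mul_self (H : IsAxisPair h a b q u v) (h0 : h ≠ 0) (h1 : h ≠ 1) :
    oddVec h a b q u * oddVec h a b q u =
      (h * (1 - h)) • evenVec h a q u - evenVec h a q u * evenVec h a q u := by
  have h2 := H.two_evenVec_mul_oddVec h0 h1
  set B := oddVec h a b q u with hB
  set P := evenVec h a q u with hP
  have hb := smul_eq_oddVec_add_evenVec h a b q u
  rw [← hB, ← hP] at hb
  have e : (B + P) * (B + P) = (h * (1 - h)) • (B + P) := by
    rw [← hb, smul_mul_smul_comm, H.right.idem, smul_smul]
  simp only [mul_add, add_mul, mul_comm B P] at e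
  linear_combination (norm := module) e - h2

end IsAxisPair

end GradedAxes

/-! ### The case `Φ ⊆ {0}`: how the axes and `q` act on the defects -/

section ZeroAxes

variable {F : Type u} [Field F] {M : Type v} [NonUnitalNonAssocCommRing M] [Module F M]
  [IsScalarTower F M M] [SMulCommClass F M M]

/-- Two graded axes for which the products of `0`- and `1`-eigenvectors are `0`-eigenvectors. -/
structure IsZeroAxisPair (h : F) (a b q u v : M) : Prop extends IsAxisPair h a b q u v where
  left_hom : ∀ {x y}, x ∈ evenPart F a → y ∈ evenPart F a → a * (x * y) = (a * x) * (a * y)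
  right_hom : ∀ {x y}, x ∈ evenPart F b → y ∈ evenPart F b → b * (x * y) = (b * x) * (b * y)
  ne_zero : h ≠ 0
  ne_one : h ≠ 1
  two_mul_ne : 2 * h - 1 ≠ 0
  two_ne : (2 : F) ≠ 0

/-- A multiple of the product of the `0`-part and the `1`-part of an axis with respect to another
axis. -/
def defect (q u : M) : M := q * u - u * u

namespace IsZeroAxisPair

variable {h : F} {a b q u v : M}

theorem symm (H : IsZeroAxisPair h a b q u v) : IsZeroAxisPair h b a q v u where
  toIsAxisPair := H.toIsAxisPair.symm
  left_hom := H.right_hom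
  right_hom := H.left_hom
  ne_zero := H.ne_zero
  ne_one := H.ne_one
  two_mul_ne := H.two_mul_ne
  two_ne := H.two_ne

theorem one_sub_ne (H : IsZeroAxisPair h a b q u v) : 1 - h ≠ 0 := sub_ne_zero.2 H.ne_one.symm

/-- Multiplication by `a` is multiplicative on the even part and fixes `u`, hence sends both `qu`
and `u²` to `u²`. -/
theorem left_mul_defect (H : IsZeroAxisPair h a b q u v) : a * defect q u = 0 := by
  rw [defect, mul_sub, H.left_hom H.q_mem H.u_mem, H.left_hom H.u_mem H.u_mem, H.left_mul,
    H.left_mul_u, sub_self]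

/-- Write `h(1 - h)u` as `q` times `h(1 - h)a` and split `a` with respect to `b`. Then `b` acts on
`q` times the odd part by the scalar `h`, and on `q` times the even part through `right_hom`. -/
theorem right_mul_u (H : IsZeroAxisPair h a b q u v) :
    (1 - h) • (b * u) = (1 - h) • (h • u + h • v + q * q) - defect q v := by
  have h1 := smul_eq_oddVec_add_evenVec h b a q v
  have hA := H.symm.oddVec_mem
  have hQ := H.symm.evenVec_mem
  have hq := H.symm.q_mem
  have e1 : b * (q * oddVec h b a q v) = h • (q * oddVec h b a q v) :=
    mem_eigSpace.1 (H.right.even_odd hq hA)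
  have e2 : b * (q * evenVec h b q v) = h • (v * v) + h ^ 2 • v := by
    rw [H.right_hom hq hQ, H.right_mul, evenVec]
    simp only [mul_sub, mul_add, mul_smul_comm, H.right_mul, H.symm.left_mul_u, H.right.idem,
      mul_comm v b]
    module
  have e3 : q * evenVec h b q v = q * v + h ^ 2 • v - (1 - h) • (q * q) := by
    rw [evenVec]
    simp only [mul_sub, mul_add, mul_smul_comm, mul_comm q b, H.right_mul]
  have e4 : (h * (1 - h)) • u = q * oddVec h b a q v + q * evenVec h b q v := by
    rw [← mul_add, ← h1, mul_smul_comm, mul_comm q a, H.left_mul]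
  have e5 : (h * (1 - h)) • (b * u) = b * (q * oddVec h b a q v) + b * (q * evenVec h b q v) := by
    rw [← mul_add, ← e4, mul_smul_comm]
  refine smul_right_injective M H.ne_zero ?_
  simp only [defect]
  rw [e3] at e4
  linear_combination (norm := module) e5 + e1 + e2 - h • e4

/-- This is `two_evenVec_mul_oddVec` after substitution of `right_mul_u`. Its value lies in showing
that a combination of the two defects is odd for `a`. -/
theorem oddVec_relation (H : IsZeroAxisPair h a b q u v) :
    (2 * h - 1) • ((2 : F) • (q * oddVec h a b q u) + (h * (h + 1)) • oddVec h a b q u) =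
      (2 : F) • (h • defect q v - defect q u) := by
  have e1 := H.two_evenVec_mul_oddVec H.ne_zero H.ne_one
  have e2 := H.right_mul_u
  have e3 := mem_eigSpace.1 H.oddVec_mem
  have e4 : evenVec h a q u * oddVec h a b q u = u * oddVec h a b q u
      + h ^ 2 • (a * oddVec h a b q u) - (1 - h) • (q * oddVec h a b q u) := by
    rw [evenVec]; simp only [sub_mul, add_mul, smul_mul_assoc]
  rw [e4, e3] at e1
  simp only [oddVec, mul_add, mul_sub, mul_smul_comm, mul_comm u b, mul_comm u q, mul_comm u a,
    H.left_mul_u, mul_comm q b, H.right_mul, mul_comm q a, H.left_mul] at e1 ⊢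
  simp only [defect] at *
  linear_combination (norm := module) e1 - (2 * h) • e2

theorem odd_defect_mem (H : IsZeroAxisPair h a b q u v) :
    h • defect q v - defect q u ∈ eigSpace a h := by
  have h1 : (2 : F) • (h • defect q v - defect q u) ∈ eigSpace a h := by
    rw [← H.oddVec_relation]
    exact Submodule.smul_mem _ _ (add_mem (Submodule.smul_mem _ _
      (H.left.even_odd H.q_mem H.oddVec_mem)) (Submodule.smul_mem _ _ H.oddVec_mem))
  exact (Submodule.smul_mem_iff _ H.two_ne).1 h1

/-- Since `a` kills `defect q u`, the eigenvector equation for `h • defect q v - defect q u`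
involves only the product of `a` with `defect q v`. -/
theorem left_mul_defect' (H : IsZeroAxisPair h a b q u v) :
    a * defect q v = h • defect q v - defect q u := by
  have h1 := mem_eigSpace.1 H.odd_defect_mem
  simp only [mul_sub, mul_smul_comm, H.left_mul_defect, sub_zero] at h1
  exact smul_right_injective M H.ne_zero h1

theorem defect_mem (H : IsZeroAxisPair h a b q u v) : defect q u ∈ evenPart F a :=
  sub_mem (H.left.even_even H.q_mem H.u_mem) (H.left.even_even H.u_mem H.u_mem)

/-- The mirror image of `oddVec_relation` is decomposed with respect to `a`. Its odd component
contains `q(qB)`, as does `q` times `oddVec_relation` itself; eliminating this term leaves the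
action of `q` on the odd combination of the defects. -/
theorem q_mul_odd_defect (H : IsZeroAxisPair h a b q u v) :
    q * (h • defect q v - defect q u) = (1 - h - h ^ 2) • (h • defect q v - defect q u) := by
  have R := H.oddVec_relation
  have R' := H.symm.oddVec_relation
  set B := oddVec h a b q u with hB
  set A := oddVec h b a q v
  set P := evenVec h a q u with hP
  have hm := smul_eq_oddVec_add_evenVec h a b q u
  have hBo := H.oddVec_mem
  have hPe := H.evenVec_mem
  have hq := H.q_mem
  have hqB := H.left.even_odd hq hBo
  have hqqB := H.left.even_odd hq hqB
  have hqP := H.left.even_even hq hPe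
  have hqqP := H.left.even_even hq hqP
  have hG := H.odd_defect_mem
  rw [← hB] at hBo hqB hqqB
  rw [← hP] at hPe hqP hqqP
  rw [← hB, ← hP] at hm
  have hv : (h * (1 - h)) • v = q * B + q * P := by
    rw [← mul_add, ← hm, mul_smul_comm, mul_comm q b, H.right_mul]
  have hqv : (h * (1 - h)) • (q * v) = q * (q * B) + q * (q * P) := by
    rw [← mul_add, ← hv, mul_smul_comm]
  -- The mirror vector `A` is odd for `b`, but has both components with respect to `a`: the first
  -- bracket is even, the second odd. The same holds for `hqA`.
  have hA : (h * (1 - h)) • A = ((h * (1 - h)) ^ 2 • a + (h * (1 - h) * (1 - h)) • q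
      - q * P - h ^ 2 • P) + (-(q * B) - h ^ 2 • B) := by
    have : A = (h * (1 - h)) • a + (1 - h) • q - v - (h ^ 2) • b := rfl
    rw [this]
    linear_combination (norm := module) -hv - h ^ 2 • hm
  have hqA : (h * (1 - h)) • (q * A) = ((h * (1 - h)) ^ 2 • u + (h * (1 - h) * (1 - h)) • (q * q)
      - q * (q * P) - h ^ 2 • (q * P)) + (-(q * (q * B)) - h ^ 2 • (q * B)) := by
    rw [← mul_smul_comm, hA]
    simp only [mul_add, mul_sub, mul_neg, mul_smul_comm, mul_comm q a, H.left_mul]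
  -- Odd component of `h²(1 - h)` times `R'`. On the right, `h(hd - d') = (h² - 1)d - (hd' - d)`
  -- separates the even and the odd defect, where `d = defect q u` and `d' = defect q v`.
  have key := odd_eq_of_add_eq H.ne_zero H.ne_one (a := a)
    (x := (h * (2 * h - 1)) • ((2 : F) • ((h * (1 - h)) ^ 2 • u
      + (h * (1 - h) * (1 - h)) • (q * q) - q * (q * P) - h ^ 2 • (q * P)) + (h * (h + 1)) •
      ((h * (1 - h)) ^ 2 • a + (h * (1 - h) * (1 - h)) • q - q * P - h ^ 2 • P)))
    (y := (h * (2 * h - 1)) • ((2 : F) • (-(q * (q * B)) - h ^ 2 • (q * B))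
      + (h * (h + 1)) • (-(q * B) - h ^ 2 • B)))
    (x' := (2 * (h * (1 - h)) * (h ^ 2 - 1)) • defect q u)
    (y' := (-(2 * (h * (1 - h)))) • (h • defect q v - defect q u))
    (by
      refine Submodule.smul_mem _ _ (add_mem (Submodule.smul_mem _ _ (sub_mem (sub_mem (add_mem
        (Submodule.smul_mem _ _ H.u_mem) (Submodule.smul_mem _ _ (H.left.even_even hq hq)))
        hqqP) (Submodule.smul_mem _ _ hqP))) (Submodule.smul_mem _ _ (sub_mem (sub_mem (add_mem
        (Submodule.smul_mem _ _ H.left.self_mem) (Submodule.smul_mem _ _ hq))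
        hqP) (Submodule.smul_mem _ _ hPe))))
      )
    (by
      exact Submodule.smul_mem _ _ (add_mem (Submodule.smul_mem _ _ (sub_mem (neg_mem hqqB)
        (Submodule.smul_mem _ _ hqB))) (Submodule.smul_mem _ _ (sub_mem (neg_mem hqB)
        (Submodule.smul_mem _ _ hBo)))))
    (Submodule.smul_mem _ _ H.defect_mem) (Submodule.smul_mem _ _ hG)
    (by linear_combination (norm := module) (h * (h * (1 - h))) • R'
          - (2 * h * (2 * h - 1)) • hqA - (h * (2 * h - 1) * (h * (h + 1))) • hA)
  have hqR : (2 * h - 1) • ((2 : F) • (q * (q * B)) + (h * (h + 1)) • (q * B)) =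
      (2 : F) • (q * (h • defect q v - defect q u)) := by
    have := congrArg (q * ·) R
    simpa only [mul_add, mul_smul_comm] using this
  refine smul_right_injective M (mul_ne_zero H.two_ne H.ne_zero) ?_
  linear_combination (norm := module) -key - h • hqR - (h * h ^ 2) • R

end IsZeroAxisPair

end ZeroAxes

/-! ### The case `Φ ⊆ {0}`: vanishing of the defect -/

section ZeroAxes

variable {F : Type u} [Field F] {M : Type v} [NonUnitalNonAssocCommRing M] [Module F M]
  [IsScalarTower F M M] [SMulCommClass F M M]

namespace IsZeroAxisPair

variable {h : F} {a b q u v : M}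

theorem smul_right_mul_defect (H : IsZeroAxisPair h a b q u v) :
    h • (b * defect q u) =
      (h ^ 2 - 1) • defect q u - (h • defect q v - defect q u) := by
  rw [H.symm.left_mul_defect']; module

/-- By `smul_right_mul_defect`, `b` sends the even vector `defect q u` to an explicit even vector
plus an explicit odd vector. The first comes from the even part of `b`, the second from the odd
part. -/
theorem vec_mul_defect (H : IsZeroAxisPair h a b q u v) :
    evenVec h a q u * defect q u = ((1 - h) * (h ^ 2 - 1)) • defect q u ∧
    oddVec h a b q u * defect q u = (-(1 - h)) • (h • defect q v - defect q u) := by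
  set B := oddVec h a b q u with hB
  set P := evenVec h a q u with hP
  have hm := smul_eq_oddVec_add_evenVec h a b q u
  have hBo := H.oddVec_mem
  have hPe := H.evenVec_mem
  rw [← hB] at hBo hm
  rw [← hP] at hPe hm
  have e := H.smul_right_mul_defect
  set G := h • defect q v - defect q u with hG
  have hGo : G ∈ eigSpace a h := H.odd_defect_mem
  have hd := H.defect_mem
  have e1 : h • (P * defect q u) + h • (B * defect q u)
      = (h * ((1 - h) * (h ^ 2 - 1))) • defect q u + (h * (-(1 - h))) • G := by
    have : (h * (1 - h)) • (b * defect q u) = B * defect q u + P * defect q u := by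
      rw [← add_mul, ← hm, smul_mul_assoc]
    linear_combination (norm := module) (h * (1 - h)) • e - h • this
  have k := odd_eq_of_add_eq H.ne_zero H.ne_one
    (Submodule.smul_mem _ _ (H.left.even_even hPe hd))
    (Submodule.smul_mem _ _ (H.left.odd_even hBo hd)) (Submodule.smul_mem _ _ hd)
    (Submodule.smul_mem _ _ hGo) e1
  constructor
  · refine smul_right_injective M H.ne_zero ?_
    linear_combination (norm := module) e1 - k
  · refine smul_right_injective M H.ne_zero ?_
    linear_combination (norm := module) k

/-- The same splitting for `defect q v`, which `b` annihilates; up to the factor `h` it is the sum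
of `h • defect q v - defect q u` and `defect q u`. -/
theorem vec_mul_odd_defect (H : IsZeroAxisPair h a b q u v) :
    evenVec h a q u * (h • defect q v - defect q u)
      = (1 - h) • (h • defect q v - defect q u) ∧
    oddVec h a b q u * (h • defect q v - defect q u)
      = ((1 - h) * (1 - h ^ 2)) • defect q u := by
  obtain ⟨hPd, hBd⟩ := H.vec_mul_defect
  set B := oddVec h a b q u with hB
  set P := evenVec h a q u with hP
  have hm := smul_eq_oddVec_add_evenVec h a b q u
  have hBo := H.oddVec_mem
  have hPe := H.evenVec_mem
  rw [← hB] at hBo hm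
  rw [← hP] at hPe hm
  have e := H.symm.left_mul_defect
  set G := h • defect q v - defect q u with hG
  have hGo : G ∈ eigSpace a h := H.odd_defect_mem
  have hd := H.defect_mem
  have e2 : B * (G + defect q u) + P * (G + defect q u) = 0 := by
    rw [← add_mul, ← hm, smul_mul_assoc, hG, sub_add_cancel, mul_smul_comm, e, smul_zero,
      smul_zero]
  rw [mul_add, mul_add] at e2
  have e1 : (P * defect q u + B * G) + (B * defect q u + P * G) = 0 + 0 := by
    linear_combination (norm := module) e2
  have k := odd_eq_of_add_eq H.ne_zero H.ne_one
    (add_mem (H.left.even_even hPe hd) (H.left.odd_odd hBo hGo))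
    (add_mem (H.left.odd_even hBo hd) (H.left.even_odd hPe hGo)) (zero_mem _) (zero_mem _) e1
  constructor
  · linear_combination (norm := module) k - hBd
  · linear_combination (norm := module) e1 - k - hPd

/-- The even component of `bv = v`, where both factors are split with respect to `a`. The terms
`B(qB)` and `P(qB)` are removed by multiplying `oddVec_relation` by `B` and by `P`; the resulting
products with defects are known. -/
theorem evenVec_relation (H : IsZeroAxisPair h a b q u v) :
    ((2 * h - 1) * h) • ((2 : F) • (evenVec h a q u * v)
      + (h * (h + 1)) • (evenVec h a q u * b)
      - (h * (1 - h)) • ((2 : F) • v + (h * (h + 1)) • b))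
      = (2 * (1 - h)) • ((h • defect q v - defect q u) - (1 + h) • defect q u) := by
  have R := H.oddVec_relation
  have hBB := H.oddVec_mul_self H.ne_zero H.ne_one
  have hPB := H.two_evenVec_mul_oddVec H.ne_zero H.ne_one
  obtain ⟨hPd, hBd⟩ := H.vec_mul_defect
  obtain ⟨hPG, hBG⟩ := H.vec_mul_odd_defect
  set B := oddVec h a b q u with hB
  set P := evenVec h a q u with hP
  have hm := smul_eq_oddVec_add_evenVec h a b q u
  have hBo := H.oddVec_mem
  have hPe := H.evenVec_mem
  rw [← hB] at hBo hm
  rw [← hP] at hPe hm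
  set G := h • defect q v - defect q u with hG
  have hqB := H.left.even_odd H.q_mem hBo
  have hqP := H.left.even_even H.q_mem hPe
  have hv : (h * (1 - h)) • v = q * B + q * P := by
    rw [← mul_add, ← hm, mul_smul_comm, mul_comm q b, H.right_mul]
  have e : (B + P) * (q * B + q * P) = (h * (1 - h)) • (q * B + q * P) := by
    rw [← hm, ← hv, smul_mul_smul_comm, H.symm.left_mul_u, smul_smul]
  simp only [mul_add, add_mul] at e
  have k := odd_eq_of_add_eq H.ne_zero H.ne_one
    (add_mem (H.left.odd_odd hBo hqB) (H.left.even_even hPe hqP))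
    (add_mem (H.left.odd_even hBo hqP) (H.left.even_odd hPe hqB))
    (Submodule.smul_mem _ (h * (1 - h)) hqP) (Submodule.smul_mem _ (h * (1 - h)) hqB)
    (by linear_combination (norm := module) e)
  have hBR := congrArg (B * ·) R
  have hPR := congrArg (P * ·) R
  simp only [mul_add, mul_smul_comm] at hBR hPR
  have hPv := congrArg (P * ·) hv
  have hPb := congrArg (P * ·) hm
  simp only [mul_add, mul_smul_comm] at hPv hPb
  refine smul_right_injective M H.one_sub_ne ?_
  linear_combination (norm := module) (2 * (2 * h - 1)) • e - (2 * (2 * h - 1)) • k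
    + (2 * (2 * h - 1)) • hPv + ((2 * h - 1) * (h * (h + 1))) • hPb - hBR
    + ((2 * h - 1) * (h * (h + 1))) • hBB + hPR - (2 * (2 * h - 1) * (h * (1 - h))) • hv
    - ((2 * h - 1) * (h * (h + 1)) * (h * (1 - h))) • hm - (h * (1 - h)) • R - (2 : F) • hBG
    + (2 : F) • hPG

/-- In the difference of `evenVec_relation` and its mirror image, all products other than the
defects are removed by `oddVec_relation`, `right_mul_u` and their mirror images. -/
theorem smul_defect_sub (H : IsZeroAxisPair h a b q u v) :
    (4 + 2 * h - 5 * h ^ 2) • (defect q u - defect q v) = 0 := by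
  have e := H.evenVec_relation
  have e' := H.symm.evenVec_relation
  have R := H.oddVec_relation
  have R' := H.symm.oddVec_relation
  have S := H.right_mul_u
  have S' := H.symm.right_mul_u
  simp only [evenVec, oddVec, mul_sub, mul_add, sub_mul, add_mul, smul_mul_assoc, mul_smul_comm,
    H.mul_eq, H.symm.mul_eq, mul_comm q a, mul_comm q b, H.left_mul, H.right_mul, mul_comm v a,
    mul_comm u b, mul_comm v u] at e e' R R' S S'
  have : (1 - h) • (4 + 2 * h - 5 * h ^ 2) • (defect q u - defect q v) = 0 := by
    simp only [defect] at *
    linear_combination (norm := module) (1 - h) • (e - e') - ((1 - h) * (h * (1 - h))) • (R' - R)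
      - ((2*h-1) * h * (h*(h+1)) - (2*h-1)*h*(2*h^2)) • (S - S')
  exact (smul_eq_zero.1 this).resolve_left H.one_sub_ne

/-- With `d`, `d'` the two defects, the vectors `hd' - d` and `hd - d'` both have the eigenvalue `1
- h - h²` of `q`, and `(hd' - d) + h(hd - d') = (h² - 1)d`. -/
theorem q_mul_defect (H : IsZeroAxisPair h a b q u v) (hh : h ^ 2 - 1 ≠ 0) :
    q * defect q u = (1 - h - h ^ 2) • defect q u := by
  have e := H.q_mul_odd_defect
  have e' := H.symm.q_mul_odd_defect
  simp only [mul_sub, mul_smul_comm] at e e'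
  refine smul_right_injective M hh ?_
  linear_combination (norm := module) e + h • e'

theorem left_mul_defect_of_ne (H : IsZeroAxisPair h a b q u v) (hh : h ^ 2 - 1 ≠ 0) :
    u * defect q u = (-(h * (1 - h))) • defect q u := by
  have e := H.vec_mul_defect.1
  simp only [evenVec, sub_mul, add_mul, smul_mul_assoc, H.left_mul_defect, H.q_mul_defect hh] at e
  linear_combination (norm := module) e

theorem left_mul_odd_defect (H : IsZeroAxisPair h a b q u v) :
    u * (h • defect q v - defect q u) = (2 - 3 * h) • (h • defect q v - defect q u) := by
  have e := H.vec_mul_odd_defect.1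
  have e1 := mem_eigSpace.1 H.odd_defect_mem
  have e2 := H.q_mul_odd_defect
  set G := h • defect q v - defect q u
  simp only [evenVec, sub_mul, add_mul, smul_mul_assoc, e1, e2] at e
  linear_combination (norm := module) e

/-- By `oddVec_relation`, the odd component of a multiple of `2v + h(h + 1)b` is twice the vector `G
= hd' - d`. The products of `v` and `b` with `d` and `G` are known combinations of `d` and `G`, so
comparing components yields `Gd` and `GG`. -/
theorem odd_defect_mul (H : IsZeroAxisPair h a b q u v) (hh : h ^ 2 - 1 ≠ 0) :
    (2 * h ^ 2) • ((h • defect q v - defect q u) * defect q u) =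
      ((2 * h - 1) * h * (1 - h) ^ 2 * (h ^ 2 - 4)) • (h • defect q v - defect q u) ∧
    (2 * h ^ 2) • ((h • defect q v - defect q u) * (h • defect q v - defect q u)) =
      (-((2 * h - 1) * h * (1 - h) ^ 2 * (h ^ 2 - 4)) * (1 - h ^ 2)) • defect q u := by
  have R := H.oddVec_relation
  have hm := smul_eq_oddVec_add_evenVec h a b q u
  have hPe := H.evenVec_mem
  have f1 := H.symm.left_mul_odd_defect
  have f2 := H.symm.left_mul_defect_of_ne hh
  have f3 := H.symm.left_mul_defect
  have f4 := H.smul_right_mul_defect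
  have hGo := H.odd_defect_mem
  have hd := H.defect_mem
  set B := oddVec h a b q u
  set P := evenVec h a q u
  have hv : (h * (1 - h)) • v = q * B + q * P := by
    rw [← mul_add, ← hm, mul_smul_comm, mul_comm q b, H.right_mul]
  have hqP := H.left.even_even H.q_mem hPe
  set d := defect q u
  set d' := defect q v
  set G := h • d' - d with hG
  set E := (2 * h - 1) • ((2 : F) • (q * P) + (h * (h + 1)) • P) with hE
  have hEe : E ∈ evenPart F a := Submodule.smul_mem _ _ (add_mem (Submodule.smul_mem _ _ hqP)
    (Submodule.smul_mem _ _ hPe))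
  -- Decomposition of the left side with respect to `a`, with odd part `2G` and even part `E`.
  have key : ((2 * h - 1) * (h * (1 - h))) • ((2 : F) • v + (h * (h + 1)) • b) = (2 : F) • G + E := by
    linear_combination (norm := module) R + (2 * (2 * h - 1)) • hv
      + ((2 * h - 1) * (h * (h + 1))) • hm
  simp only [mul_sub, mul_smul_comm] at f1
  have hbd : h ^ 2 • (b * d) = (h * (h ^ 2 - 1)) • d - h • G := by
    linear_combination (norm := module) h • f4
  have hvd : h ^ 2 • (v * d) = (2 - 3 * h) • ((h ^ 2 - 1) • d - G) - (h * (1 - h)) • (G + d) := by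
    linear_combination (norm := module) h • f1 + h • f2
  have hvG : h ^ 2 • (v * G) = ((2 - 3 * h) + h * (1 - h) * (1 - h ^ 2)) • G
      + ((1 - h ^ 2) * (h * (1 - h) + (2 - 3 * h))) • d := by
    rw [hG]
    simp only [mul_sub, mul_smul_comm]
    linear_combination (norm := module) h ^ 3 • f2 - hvd
  have hbG : h ^ 2 • (b * G) = h • G + (h * (1 - h ^ 2)) • d := by
    rw [hG]
    simp only [mul_sub, mul_smul_comm, f3]
    linear_combination (norm := module) -hbd
  have k1 := congrArg (· * d) key
  have k2 := congrArg (· * G) key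
  simp only [add_mul, smul_mul_assoc] at k1 k2
  constructor
  · have := odd_eq_of_add_eq H.ne_zero H.ne_one
      (Submodule.smul_mem _ (h ^ 2) (H.left.even_even hEe hd))
      (Submodule.smul_mem _ (2 * h ^ 2) (H.left.odd_even hGo hd))
      (Submodule.smul_mem _ ((2 * h - 1) * (h * (1 - h)) * (2 * (2 - 3 * h) * (h ^ 2 - 1)
        - 2 * (h * (1 - h)) + (h * (h + 1)) * (h * (h ^ 2 - 1)))) hd)
      (Submodule.smul_mem _ (((2 * h - 1) * h * (1 - h) ^ 2 * (h ^ 2 - 4))) hGo)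
      (by linear_combination (norm := module) -h ^ 2 • k1
            + (2 * (2 * h - 1) * (h * (1 - h))) • hvd
            + ((2 * h - 1) * (h * (1 - h)) * (h * (h + 1))) • hbd)
    exact this
  · have e := (by linear_combination (norm := module) -h ^ 2 • k2
            + (2 * (2 * h - 1) * (h * (1 - h))) • hvG
            + ((2 * h - 1) * (h * (1 - h)) * (h * (h + 1))) • hbG :
      (2 * h ^ 2) • (G * G) + h ^ 2 • (E * G) =
        (-((2 * h - 1) * h * (1 - h) ^ 2 * (h ^ 2 - 4)) * (1 - h ^ 2)) • d +
        ((2 * h - 1) * (h * (1 - h)) * (2 * ((2 - 3 * h) + h * (1 - h) * (1 - h ^ 2))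
          + h * (h + 1) * h)) • G)
    have := odd_eq_of_add_eq H.ne_zero H.ne_one
      (Submodule.smul_mem _ (2 * h ^ 2) (H.left.odd_odd hGo hGo))
      (Submodule.smul_mem _ (h ^ 2) (H.left.even_odd hEe hGo))
      (Submodule.smul_mem _ _ hd) (Submodule.smul_mem _ _ hGo) e
    linear_combination (norm := module) e - this

/-- Outside the roots of `4 + 2h - 5h²` the two defects agree, and then `defect q u` is both even
and odd. At a root, the products of the defects give the vanishing of their odd combination instead.
-/
theorem defect_eq_zero (H : IsZeroAxisPair h a b q u v) : defect q u = 0 := by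
  have hh1 := H.one_sub_ne
  by_cases hc : 4 + 2 * h - 5 * h ^ 2 = 0
  -- At `h = 2`, `-2`, `-1` the polynomial `4 + 2h - 5h²` takes the values `-12`, `-20`, `-3`. It
  -- could vanish there only in characteristic `3`, `5`, `3` respectively, and in each case `2h - 1`
  -- would be zero.
  · have h2 : h ≠ 2 := by
      rintro rfl
      have h3 : (3 : F) * (2 * 2) = 0 := by linear_combination -hc
      have h3' := (mul_eq_zero.1 h3).resolve_right (mul_ne_zero H.two_ne H.two_ne)
      exact H.two_mul_ne (by linear_combination h3')
    have h2' : h ≠ -2 := by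
      rintro rfl
      have h3 : (5 : F) * (2 * 2) = 0 := by linear_combination -hc
      have h3' := (mul_eq_zero.1 h3).resolve_right (mul_ne_zero H.two_ne H.two_ne)
      exact H.two_mul_ne (by linear_combination -h3')
    have h1' : h + 1 ≠ 0 := by
      intro h3
      have h4 : (3 : F) = 0 := by linear_combination -hc + (7 - 5 * h) * h3
      exact H.two_mul_ne (by linear_combination 2 * h3 - h4)
    have hh : h ^ 2 - 1 ≠ 0 := by
      rw [show h ^ 2 - 1 = (h + 1) * (-(1 - h)) by ring]
      exact mul_ne_zero h1' (neg_ne_zero.2 hh1)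
    have e1 := (H.odd_defect_mul hh).1
    have e2 := (H.odd_defect_mul hh).2
    have e3 := (H.symm.odd_defect_mul hh).1
    have hGo := H.odd_defect_mem
    have hd := H.defect_mem
    set d := defect q u
    set d' := defect q v
    have hdd := H.left.even_even hd hd
    set κ := (2 * h - 1) * h * (1 - h) ^ 2 * (h ^ 2 - 4) with hκ
    simp only [sub_mul, mul_sub, smul_mul_assoc, mul_smul_comm, mul_comm d' d] at e1 e2 e3
    -- The combination `e2 + 2e1 + h²(e3 - e1)` cancels `dd'` and `d'd'`. Only the even term `dd`
    -- survives on the left, so the odd term on the right must vanish.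
    have := odd_eq_of_add_eq H.ne_zero H.ne_one
      (Submodule.smul_mem _ (2 * h ^ 2 * (h ^ 2 - 1)) hdd) (zero_mem _)
      (Submodule.smul_mem _ (κ * (h ^ 2 - 1) - κ * (h * (h + 1)) * (1 - h)) hd)
      (Submodule.smul_mem _ (-(κ * ((h + 2) * (h - 1)))) hGo)
      (by linear_combination (norm := module) e2 + (2 : F) • e1 + h ^ 2 • (e3 - e1))
    have hG : h • d' - d = 0 := by
      refine (smul_eq_zero.1 this.symm).resolve_left (neg_ne_zero.2 (mul_ne_zero ?_ ?_))
      · rw [hκ, show h ^ 2 - 4 = (h - 2) * (h + 2) by ring]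
        exact mul_ne_zero (mul_ne_zero (mul_ne_zero H.two_mul_ne H.ne_zero) (pow_ne_zero _ hh1))
          (mul_ne_zero (sub_ne_zero.2 h2) (fun h3 => h2' (eq_neg_of_add_eq_zero_left h3)))
      · exact mul_ne_zero (fun h3 => h2' (eq_neg_of_add_eq_zero_left h3)) (sub_ne_zero.2 H.ne_one)
    -- Now `d = hd'`, and `b` annihilates `d'`; with `smul_right_mul_defect` this leaves `(h² - 1)d
    -- = 0`.
    have hb : b * d = 0 := by
      rw [← sub_eq_zero.1 hG, mul_smul_comm, H.symm.left_mul_defect, smul_zero]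
    have e4 : h • (b * d) = (h ^ 2 - 1) • d - (h • d' - d) := H.smul_right_mul_defect
    rw [hb, hG, smul_zero, sub_zero] at e4
    exact (smul_eq_zero.1 e4.symm).resolve_left hh
  -- If `d = d'`, the odd vector `hd' - d` is `(h - 1)d`.
  · have hs := H.smul_defect_sub
    have hs' := sub_eq_zero.1 ((smul_eq_zero.1 hs).resolve_left hc)
    have hG := H.odd_defect_mem
    rw [← hs'] at hG
    have hG' : (h - 1) • defect q u ∈ eigSpace a h := by
      convert hG using 1
      module
    exact eq_zero_of_even_of_odd H.ne_zero H.ne_one H.defect_mem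
      ((Submodule.smul_mem_iff _ (sub_ne_zero.2 H.ne_one)).1 hG')

end IsZeroAxisPair

end ZeroAxes

/-! ### The case `Φ ⊆ {1}`: complementary idempotents in the unitization -/

section OneAxes

variable {F : Type u} [Field F] {M : Type v} [NonUnitalNonAssocCommRing M] [Module F M]

instance unitizationNonUnitalNonAssocCommRing : NonUnitalNonAssocCommRing (Unitization F M) where
  mul_comm x y := by
    apply Unitization.ext
    · simp [mul_comm]
    · simp only [Unitization.snd_mul, mul_comm x.snd]
      abel

theorem unitization_fst_sub (x y : Unitization F M) : (x - y).fst = x.fst - y.fst := rfl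

theorem unitization_snd_sub (x y : Unitization F M) : (x - y).snd = x.snd - y.snd := rfl

theorem fst_one_sub_mul (a : M) (z : Unitization F M) :
    ((1 - (a : Unitization F M)) * z).fst = z.fst := by
  rw [sub_mul, one_mul]; simp [sub_eq_add_neg]

theorem snd_one_sub_mul (a : M) (z : Unitization F M) :
    ((1 - (a : Unitization F M)) * z).snd = z.snd - a * z.snd - z.fst • a := by
  rw [sub_mul, one_mul]; simp [sub_eq_add_neg]; abel

variable [IsScalarTower F M M] [SMulCommClass F M M]

instance unitizationSMulCommClass : SMulCommClass F (Unitization F M) (Unitization F M) where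
  smul_comm c x y := by
    apply Unitization.ext
    · simp only [smul_eq_mul, Unitization.fst_mul, Unitization.fst_smul]; ring
    · simp only [smul_eq_mul, Unitization.snd_mul, Unitization.snd_smul, Unitization.fst_smul,
        mul_smul_comm]
      module

instance unitizationIsScalarTower : IsScalarTower F (Unitization F M) (Unitization F M) where
  smul_assoc c x y := by
    apply Unitization.ext
    · simp only [smul_eq_mul, Unitization.fst_mul, Unitization.fst_smul]; ring
    · simp only [smul_eq_mul, Unitization.snd_mul, Unitization.snd_smul, Unitization.fst_smul,
        smul_mul_assoc]
      module

/-- Two graded axes for which the products of `0`- and `1`-eigenvectors are `1`-eigenvectors. -/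
structure IsOneAxisPair (h : F) (a b q u v : M) : Prop extends IsAxisPair h a b q u v where
  left_hom : ∀ {x y}, x ∈ evenPart F a → y ∈ evenPart F a →
    a * (x * y) = x * y - (x - a * x) * (y - a * y)
  right_hom : ∀ {x y}, x ∈ evenPart F b → y ∈ evenPart F b →
    b * (x * y) = x * y - (x - b * x) * (y - b * y)
  ne_zero : h ≠ 0
  ne_one : h ≠ 1
  two_mul_ne : 2 * h - 1 ≠ 0
  two_ne : (2 : F) ≠ 0

theorem IsOneAxisPair.symm {h : F} {a b q u v : M} (H : IsOneAxisPair h a b q u v) :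
    IsOneAxisPair h b a q v u where
  toIsAxisPair := H.toIsAxisPair.symm
  left_hom := H.right_hom
  right_hom := H.left_hom
  ne_zero := H.ne_zero
  ne_one := H.ne_one
  two_mul_ne := H.two_mul_ne
  two_ne := H.two_ne

theorem mem_evenPart_one_sub {a : M} (ha : a * a = a) {z : Unitization F M} :
    z ∈ evenPart F (1 - (a : Unitization F M)) ↔ z.snd ∈ evenPart F a := by
  rw [mem_evenPart, mem_evenPart, Unitization.ext_iff]
  simp only [fst_one_sub_mul, snd_one_sub_mul, true_and, mul_sub, mul_smul_comm, ha]
  constructor <;> intro e <;> linear_combination (norm := module) e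

theorem mem_eigSpace_one_sub {a : M} {h : F} (h0 : h ≠ 0) {z : Unitization F M} :
    z ∈ eigSpace (1 - (a : Unitization F M)) (1 - h) ↔ z.fst = 0 ∧ z.snd ∈ eigSpace a h := by
  rw [mem_eigSpace, mem_eigSpace, Unitization.ext_iff]
  simp only [fst_one_sub_mul, snd_one_sub_mul, Unitization.fst_smul, Unitization.snd_smul,
    smul_eq_mul]
  constructor
  · rintro ⟨e1, e2⟩
    have e3 : z.fst = 0 := by
      have : h * z.fst = 0 := by linear_combination e1
      exact (mul_eq_zero.1 this).resolve_left h0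
    refine ⟨e3, ?_⟩
    rw [e3] at e2
    linear_combination (norm := module) -e2
  · rintro ⟨e1, e2⟩
    rw [e1]
    refine ⟨by ring, ?_⟩
    linear_combination (norm := module) -e2

/-- The complement of a graded axis in the unitization. -/
theorem IsGradedAxis.one_sub {h : F} (h0 : h ≠ 0) {a : M} (ha : IsGradedAxis h a) :
    IsGradedAxis (1 - h) (1 - (a : Unitization F M)) where
  idem := by
    apply Unitization.ext
    · rw [fst_one_sub_mul]
    · rw [snd_one_sub_mul]
      simp [ha.idem, sub_eq_add_neg]
  cubic z := by
    apply Unitization.ext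
    · simp only [fst_one_sub_mul, unitization_fst_sub, Unitization.fst_smul, smul_eq_mul]; ring
    · simp only [snd_one_sub_mul, fst_one_sub_mul, unitization_snd_sub, Unitization.snd_smul,
        mul_sub, mul_smul_comm, ha.idem]
      linear_combination (norm := module) -ha.cubic z.snd
  even_even {x y} hx hy := by
    rw [mem_evenPart_one_sub ha.idem] at *
    rw [Unitization.snd_mul]
    exact add_mem (add_mem (Submodule.smul_mem _ _ hy) (Submodule.smul_mem _ _ hx))
      (ha.even_even hx hy)
  even_odd {x y} hx hy := by
    rw [mem_evenPart_one_sub ha.idem] at hx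
    rw [mem_eigSpace_one_sub h0] at *
    rw [Unitization.fst_mul, Unitization.snd_mul, hy.1]
    refine ⟨mul_zero _, ?_⟩
    rw [zero_smul, add_zero]
    exact add_mem (Submodule.smul_mem _ _ hy.2) (ha.even_odd hx hy.2)
  odd_odd {x y} hx hy := by
    rw [mem_eigSpace_one_sub h0] at *
    rw [mem_evenPart_one_sub ha.idem, Unitization.snd_mul, hx.1, hy.1]
    simpa using ha.odd_odd hx.2 hy.2

/-- The hypothesis says that `x ↦ x - ax` is multiplicative on the even part, and this map is
multiplication by `1 - a`. -/
theorem one_sub_hom {a : M} (ha : a * a = a)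
    (hom : ∀ {x y}, x ∈ evenPart F a → y ∈ evenPart F a →
      a * (x * y) = x * y - (x - a * x) * (y - a * y))
    {x y : Unitization F M} (hx : x ∈ evenPart F (1 - (a : Unitization F M)))
    (hy : y ∈ evenPart F (1 - (a : Unitization F M))) :
    (1 - (a : Unitization F M)) * (x * y)
      = ((1 - (a : Unitization F M)) * x) * ((1 - (a : Unitization F M)) * y) := by
  rw [mem_evenPart_one_sub ha] at *
  have e := hom hx hy
  have e1 := mem_evenPart.1 hx
  have e2 := mem_evenPart.1 hy
  apply Unitization.ext
  · rw [fst_one_sub_mul, Unitization.fst_mul, Unitization.fst_mul, fst_one_sub_mul,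
      fst_one_sub_mul]
  · rw [snd_one_sub_mul, Unitization.snd_mul x y, Unitization.fst_mul x y,
      Unitization.snd_mul (_ * x) (_ * y)]
    simp only [snd_one_sub_mul, fst_one_sub_mul]
    simp only [mul_sub, sub_mul, mul_add, mul_smul_comm, smul_mul_assoc, ha, e1, e2, e,
      mul_comm (a * x.snd) a, mul_comm x.snd a]
    module

namespace IsOneAxisPair

variable {h : F} {a b q u v : M}

/-- The complements of the axes in the unitization. -/
theorem one_sub (H : IsOneAxisPair h a b q u v) :
    IsZeroAxisPair (1 - h) (1 - (a : Unitization F M)) (1 - (b : Unitization F M))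
      ((2 * h - 1) • 1 + (q : Unitization F M))
      ((2 * h - 1) • 1 + ((q - u - (2 * h - 1) • a : M) : Unitization F M))
      ((2 * h - 1) • 1 + ((q - v - (2 * h - 1) • b : M) : Unitization F M)) where
  left := H.left.one_sub H.ne_zero
  right := H.right.one_sub H.ne_zero
  -- The element `(1 - a)(1 - b) - (1 - h)((1 - a) + (1 - b))` equals `(2h - 1) + q`, which accounts
  -- for the scalar `2h - 1`.
  mul_eq := by
    apply Unitization.ext
    · rw [fst_one_sub_mul]; simp [sub_eq_add_neg]; ring
    · rw [snd_one_sub_mul]; simp [sub_eq_add_neg, H.mul_eq]; module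
  left_mul := by
    apply Unitization.ext
    · rw [fst_one_sub_mul]; simp [unitization_fst_sub]
    · rw [snd_one_sub_mul]; simp [H.left_mul, unitization_snd_sub]
  right_mul := by
    apply Unitization.ext
    · rw [fst_one_sub_mul]; simp [unitization_fst_sub]
    · rw [snd_one_sub_mul]; simp [H.right_mul, unitization_snd_sub]
  left_hom hx hy := one_sub_hom H.left.idem H.left_hom hx hy
  right_hom hx hy := one_sub_hom H.right.idem H.right_hom hx hy
  ne_zero := sub_ne_zero.2 H.ne_one.symm
  ne_one e := H.ne_zero (by linear_combination -e)
  two_mul_ne e := H.two_mul_ne (by linear_combination -e)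
  two_ne := H.two_ne

/-- The component in `M` of the defect of the complements is again `qu - u²`: the terms with the
factor `2h - 1` cancel because `aq = u` and `au = u`. -/
theorem defect_eq_zero (H : IsOneAxisPair h a b q u v) : defect q u = 0 := by
  have e := congrArg (fun z : Unitization F M => z.snd) H.one_sub.defect_eq_zero
  rw [defect, ← sub_mul] at e
  simp only [Unitization.snd_mul, Unitization.snd_add, Unitization.fst_add, unitization_snd_sub,
    Unitization.fst_smul, Unitization.snd_smul, Unitization.fst_one, Unitization.snd_one,
    Unitization.fst_inr, Unitization.snd_inr, Unitization.snd_zero, smul_zero, mul_sub,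
    sub_mul, mul_add, add_mul, mul_smul_comm, smul_mul_assoc, zero_add, H.left.idem,
    mul_comm u a, mul_comm q a, mul_comm u q, H.left_mul, H.left_mul_u, zero_mul, mul_zero,
    one_smul] at e
  rw [defect]
  linear_combination (norm := module) e

end IsOneAxisPair

end OneAxes

/-! ### The multiplication table forced by a vanishing defect -/

section Table

variable {F : Type u} [Field F] {M : Type v} [NonUnitalNonAssocCommRing M] [Module F M]
  [IsScalarTower F M M] [SMulCommClass F M M]

/-- On the even part `a` has only the eigenvalues `0` and `1`, and `1 - h` is neither. -/
theorem eq_zero_of_even_of_mul_eq {h : F} (h0 : h ≠ 0) (h1 : h ≠ 1) {a x : M}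
    (hx : x ∈ evenPart F a) (hx' : a * x = (1 - h) • x) : x = 0 := by
  rw [mem_evenPart, hx', mul_smul_comm, hx'] at hx
  have : ((1 - h) * -h) • x = 0 := by linear_combination (norm := module) hx
  exact (smul_eq_zero.1 this).resolve_left
    (mul_ne_zero (sub_ne_zero.2 h1.symm) (neg_ne_zero.2 h0))

/-- Twice the image of `a` under `(q + h(h + 1)/2)(q + h)`. -/
def radicalVec (h : F) (a q u : M) : M :=
  (2 : F) • (q * u) + (h ^ 2 + 3 * h) • u + (h ^ 2 * (h + 1)) • a

/-- The part of the multiplication table of a pair of axes that both fusion rules imply. -/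
structure IsTamePair (h : F) (a b q u v : M) : Prop extends IsAxisPair h a b q u v where
  left_mul_qu : a * (q * u) = q * u
  right_mul_qv : b * (q * v) = q * v
  right_mul_u : b * u = h • u + h • v + q * q
  left_mul_v : a * v = h • v + h • u + q * q
  ne_zero : h ≠ 0
  ne_one : h ≠ 1
  two_mul_ne : 2 * h - 1 ≠ 0
  two_ne : (2 : F) ≠ 0

namespace IsTamePair

variable {h : F} {a b q u v : M}

theorem symm (H : IsTamePair h a b q u v) : IsTamePair h b a q v u where
  toIsAxisPair := H.toIsAxisPair.symm
  left_mul_qu := H.right_mul_qv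
  right_mul_qv := H.left_mul_qu
  right_mul_u := H.left_mul_v
  left_mul_v := H.right_mul_u
  ne_zero := H.ne_zero
  ne_one := H.ne_one
  two_mul_ne := H.two_mul_ne
  two_ne := H.two_ne

theorem one_sub_ne (H : IsTamePair h a b q u v) : 1 - h ≠ 0 := sub_ne_zero.2 H.ne_one.symm

/-- The odd component of the idempotency of `b`, with the known values of `bu` and `u²` inserted. It
makes the odd part of `b` an eigenvector of `q` and, being linear in `q²`, also determines `q²`. -/
theorem oddVec_relation (H : IsTamePair h a b q u v) (hu : u * u = q * u) :
    (2 : F) • (q * oddVec h a b q u) + (h * (h + 1)) • oddVec h a b q u = 0 := by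
  have e1 := H.two_evenVec_mul_oddVec H.ne_zero H.ne_one
  have e2 := H.right_mul_u
  have e3 := mem_eigSpace.1 H.oddVec_mem
  have e4 : evenVec h a q u * oddVec h a b q u = u * oddVec h a b q u
      + h ^ 2 • (a * oddVec h a b q u) - (1 - h) • (q * oddVec h a b q u) := by
    rw [evenVec]; simp only [sub_mul, add_mul, smul_mul_assoc]
  rw [e4, e3] at e1
  refine smul_right_injective M H.two_mul_ne ?_
  simp only [oddVec, mul_add, mul_sub, mul_smul_comm, mul_comm u b, mul_comm u q, mul_comm u a,
    H.left_mul_u, mul_comm q b, H.right_mul, mul_comm q a, H.left_mul] at e1 ⊢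
  linear_combination (norm := module) e1 - (2 * h * (1 - h)) • e2 + (2 : F) • hu

theorem mul_radicalVec (H : IsTamePair h a b q u v) :
    a * radicalVec h a q u = radicalVec h a q u := by
  simp only [radicalVec, mul_add, mul_smul_comm, H.left_mul_qu, H.left_mul_u, H.left.idem]

/-- Since `bx` is a multiple of the even vector `x`, the odd part of `b` must annihilate `x`. -/
theorem evenVec_mul (H : IsTamePair h a b q u v) {x : M} {c : F} (hx : x ∈ evenPart F a)
    (hb : b * x = c • x) : evenVec h a q u * x = (h * (1 - h) * c) • x := by
  have hm := smul_eq_oddVec_add_evenVec h a b q u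
  have e : evenVec h a q u * x + oddVec h a b q u * x = (h * (1 - h) * c) • x + 0 := by
    rw [add_comm, ← add_mul, ← hm, smul_mul_assoc, hb]; module
  have k := odd_eq_of_add_eq H.ne_zero H.ne_one (H.left.even_even H.evenVec_mem hx)
    (H.left.odd_even H.oddVec_mem hx) (Submodule.smul_mem _ _ hx) (zero_mem _) e
  rwa [k, add_left_inj] at e

/-- The action of `u` on common eigenvectors of the axes. -/
theorem u_mul (H : IsTamePair h a b q u v) {x : M} {c d : F} (hx : x ∈ evenPart F a)
    (ha : a * x = d • x) (hb : b * x = c • x) :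
    u * x = (h * (1 - h) * c - h ^ 2 * d) • x + (1 - h) • (q * x) := by
  have e := H.evenVec_mul hx hb
  simp only [evenVec, sub_mul, add_mul, smul_mul_assoc, ha] at e
  linear_combination (norm := module) e

end IsTamePair

/-- The multiplication table of `4̂(h)` with respect to the basis that consists of the axes, the
element `q = ab - h(a + b)`, and the three annihilating idempotent-like elements. -/
structure IsHatFourTable (h : F) (a b q s t r : M) : Prop where
  a_a : a * a = a
  b_b : b * b = b
  a_b : a * b = q + h • a + h • b
  a_q : (2 : F) • (a * q) = (-(h * (h + 1))) • a + (h - 1) • (h • s + r)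
  b_q : (2 : F) • (b * q) = (-(h * (h + 1))) • b + (h - 1) • (h • t + r)
  q_q : (2 : F) • (q * q) = (-(h * (h + 1))) • q
    - (h - 1) • (h ^ 2 • (s + t) + (2 * h - 1) • r)
  a_s : a * s = s
  a_t : a * t = 0
  a_r : a * r = r
  b_s : b * s = 0
  b_t : b * t = t
  b_r : b * r = r
  q_s : q * s = (-h) • s
  q_t : q * t = (-h) • t
  q_r : q * r = (1 - 2 * h) • r
  s_s : s * s = s
  s_t : s * t = 0
  t_t : t * t = t
  r_s : r * s = 0
  r_t : r * t = 0
  r_r : r * r = (h - 2) • r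

/-- The vector `radicalVec` is the same for both axes, hence fixed by both; `r` is a multiple of it.
The rows for `aq` and `bq` serve as definitions of `s` and `t`, and the remaining rows follow by
multiplying these by `a`, `b`, `q`, `s`, `t`, `r`. The hypotheses `hR` and `hmul` isolate the two
points where the two fusion rules need different arguments. -/
theorem IsTamePair.exists_table {h : F} {a b q u v : M} (H : IsTamePair h a b q u v)
    (hu : u * u = q * u) (hv : v * v = q * v)
    (hR : q * radicalVec h a q u = (1 - 2 * h) • radicalVec h a q u)
    (hmul : ∀ s t r : M, a * s = s → b * s = 0 → a * t = 0 → b * t = t → a * r = r →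
      h • (s * t) + r * s = 0 → h • (s * t) + r * t = 0 → h • (t * t) + r * t = h • t →
      s * t = 0) : ∃ s t r : M, IsHatFourTable h a b q s t r := by
  have T := H.oddVec_relation hu
  have T' := H.symm.oddVec_relation hv
  have h0 := H.ne_zero
  have h1 := H.one_sub_ne
  have haR := H.mul_radicalVec
  have hbR := H.symm.mul_radicalVec
  -- With this scaling `r` becomes the image of `q̂ - (â₀ + â₁ + â₋₁)` under the homomorphism from
  -- `4̂(h)`.
  obtain ⟨r, hr⟩ : ∃ r, r = (-((1 - h) ^ 2)⁻¹) • radicalVec h a q u := ⟨_, rfl⟩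
  have hr' : (1 - h) ^ 2 • r = - radicalVec h a q u := by
    rw [hr, smul_smul, mul_neg, mul_inv_cancel₀ (pow_ne_zero 2 h1), neg_one_smul]
  have ha_r : a * r = r := by rw [hr, mul_smul_comm, haR]
  have hq_r : q * r = (1 - 2 * h) • r := by rw [hr, mul_smul_comm, hR, smul_comm]
  simp only [oddVec, mul_add, mul_sub, mul_smul_comm, mul_comm q a, mul_comm q b, H.left_mul,
    H.right_mul] at T T'
  have hRR : radicalVec h a q u = radicalVec h b q v := by
    simp only [radicalVec]
    linear_combination (norm := module) T' - T
  have hb_r : b * r = r := by rw [hr, hRR, mul_smul_comm, hbR]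
  obtain ⟨s, hs⟩ : ∃ s : M, (2 : F) • u = (-(h * (h + 1))) • a + (h - 1) • (h • s + r) := by
    refine ⟨h⁻¹ • ((h - 1)⁻¹ • ((2 : F) • u + (h * (h + 1)) • a) - r), ?_⟩
    rw [smul_inv_smul₀ h0, sub_add_cancel, smul_inv_smul₀ (sub_ne_zero.2 H.ne_one)]
    module
  obtain ⟨t, ht⟩ : ∃ t : M, (2 : F) • v = (-(h * (h + 1))) • b + (h - 1) • (h • t + r) := by
    refine ⟨h⁻¹ • ((h - 1)⁻¹ • ((2 : F) • v + (h * (h + 1)) • b) - r), ?_⟩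
    rw [smul_inv_smul₀ h0, sub_add_cancel, smul_inv_smul₀ (sub_ne_zero.2 H.ne_one)]
    module
  have hc : (h - 1) * h ≠ 0 := mul_ne_zero (sub_ne_zero.2 H.ne_one) h0
  have hqu : (2 : F) • (q * u) = -((1 - h) ^ 2 • r) - (h ^ 2 + 3 * h) • u
      - (h ^ 2 * (h + 1)) • a := by
    rw [hr', radicalVec]; module
  have hqv : (2 : F) • (q * v) = -((1 - h) ^ 2 • r) - (h ^ 2 + 3 * h) • v
      - (h ^ 2 * (h + 1)) • b := by
    rw [hr', hRR, radicalVec]; module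
  -- The relation `T` contains `2(1 - h)q²` and is solved for it.
  have hq_q : (2 : F) • (q * q) = (-(h * (h + 1))) • q
      - (h - 1) • (h ^ 2 • (s + t) + (2 * h - 1) • r) := by
    refine smul_right_injective M (mul_ne_zero H.two_ne h1) ?_
    linear_combination (norm := module) (2 : F) • T + (2 : F) • hqu
      + (3 * h ^ 2 + h - (h ^ 2 + 3 * h)) • hs - (2 * h * (1 - h)) • ht
  have eqs : ∀ x : M, (2 : F) • (u * x) =
      (-(h * (h + 1))) • (a * x) + (h - 1) • (h • (s * x) + r * x) := by
    intro x
    have := congrArg (· * x) hs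
    simpa only [add_mul, smul_mul_assoc] using this
  have eqt : ∀ x : M, (2 : F) • (v * x) =
      (-(h * (h + 1))) • (b * x) + (h - 1) • (h • (t * x) + r * x) := by
    intro x
    have := congrArg (· * x) ht
    simpa only [add_mul, smul_mul_assoc] using this
  have ha_s : a * s = s := by
    refine smul_right_injective M hc ?_
    have := eqs a
    simp only [mul_comm _ a, H.left_mul_u, H.left.idem, ha_r] at this
    linear_combination (norm := module) hs - this
  have hb_t : b * t = t := by
    refine smul_right_injective M hc ?_
    have := eqt b
    simp only [mul_comm _ b, H.symm.left_mul_u, H.right.idem, hb_r] at this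
    linear_combination (norm := module) ht - this
  have hb_s : b * s = 0 := by
    refine smul_right_injective M hc ?_
    have := eqs b
    simp only [mul_comm _ b, H.right_mul_u, H.symm.mul_eq, hb_r] at this
    linear_combination (norm := module) hq_q - this + h • hs + h • ht
  have ha_t : a * t = 0 := by
    refine smul_right_injective M hc ?_
    have := eqt a
    simp only [mul_comm _ a, H.left_mul_v, H.mul_eq, ha_r] at this
    linear_combination (norm := module) hq_q - this + h • hs + h • ht
  have hq_s : q * s = (-h) • s := by
    refine smul_right_injective M hc ?_
    have := eqs q
    simp only [mul_comm u q, mul_comm s q, mul_comm r q, H.left_mul, hq_r] at this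
    linear_combination (norm := module) hqu - this - h • hs
  have hq_t : q * t = (-h) • t := by
    refine smul_right_injective M hc ?_
    have := eqt q
    simp only [mul_comm v q, mul_comm t q, mul_comm r q, H.right_mul, hq_r] at this
    linear_combination (norm := module) hqv - this - h • ht
  have ea_s : s ∈ evenPart F a := by rw [mem_evenPart, ha_s, ha_s]
  have eb_s : s ∈ evenPart F b := by rw [mem_evenPart, hb_s, mul_zero]
  have ea_t : t ∈ evenPart F a := by rw [mem_evenPart, ha_t, mul_zero]
  have eb_t : t ∈ evenPart F b := by rw [mem_evenPart, hb_t, hb_t]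
  have ea_r : r ∈ evenPart F a := by rw [mem_evenPart, ha_r, ha_r]
  have eb_r : r ∈ evenPart F b := by rw [mem_evenPart, hb_r, hb_r]
  -- Each of `s`, `t`, `r` is a common eigenvector of both axes with eigenvalues `0` or `1`, so its
  -- products with `u` and `v` reduce to its product with `q`.
  have us := H.u_mul (c := 0) (d := 1) ea_s (by rw [ha_s, one_smul]) (by rw [hb_s, zero_smul])
  have ut := H.u_mul (c := 1) (d := 0) ea_t (by rw [ha_t, zero_smul]) (by rw [hb_t, one_smul])
  have ur := H.u_mul (c := 1) (d := 1) ea_r (by rw [ha_r, one_smul]) (by rw [hb_r, one_smul])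
  have vs := H.symm.u_mul (c := 1) (d := 0) eb_s (by rw [hb_s, zero_smul])
    (by rw [ha_s, one_smul])
  have vt := H.symm.u_mul (c := 0) (d := 1) eb_t (by rw [hb_t, one_smul])
    (by rw [ha_t, zero_smul])
  have vr := H.symm.u_mul (c := 1) (d := 1) eb_r (by rw [hb_r, one_smul]) (by rw [ha_r, one_smul])
  rw [hq_s] at us vs
  rw [hq_t] at ut vt
  rw [hq_r] at ur vr
  have hh1 := sub_ne_zero.2 H.ne_one
  -- The relations `k1` to `k5` compare these values with the products computed from the definitions
  -- of `s` and `t`. They do not separate `st`, `rs` and `rt`; that is the role of `hmul`.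
  have k1 : h • (s * s) + r * s = h • s := by
    refine smul_right_injective M hh1 ?_
    have := eqs s
    rw [us, ha_s] at this
    linear_combination (norm := module) -this
  have k2 : h • (s * t) + r * t = 0 := by
    refine smul_right_injective M hh1 ?_
    have := eqs t
    rw [ut, ha_t] at this
    linear_combination (norm := module) -this
  have k3 : h • (r * s) + r * r = (h - 2) • r := by
    refine smul_right_injective M hh1 ?_
    have := eqs r
    rw [ur, ha_r, mul_comm s r] at this
    linear_combination (norm := module) -this
  have k4 : h • (t * t) + r * t = h • t := by
    refine smul_right_injective M hh1 ?_
    have := eqt t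
    rw [vt, hb_t] at this
    linear_combination (norm := module) -this
  have k5 : h • (s * t) + r * s = 0 := by
    refine smul_right_injective M hh1 ?_
    have := eqt s
    rw [vs, hb_s, mul_comm t s] at this
    linear_combination (norm := module) -this
  have hst := hmul s t r ha_s hb_s ha_t hb_t ha_r k5 k2 k4
  rw [hst, smul_zero, zero_add] at k2 k5
  rw [k5, add_zero] at k1
  rw [k2, add_zero] at k4
  rw [k5, smul_zero, zero_add] at k3
  exact ⟨s, t, r, H.left.idem, H.right.idem, H.mul_eq, by rw [H.left_mul, hs],
    by rw [H.right_mul, ht], hq_q, ha_s, ha_t, ha_r, hb_s, hb_t, hb_r, hq_s, hq_t, hq_r,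
    smul_right_injective M h0 k1, hst, smul_right_injective M h0 k4, k5, k2, k3⟩

namespace IsZeroAxisPair

variable {h : F} {a b q u v : M}

theorem sq_eq (H : IsZeroAxisPair h a b q u v) : u * u = q * u :=
  (sub_eq_zero.1 H.defect_eq_zero).symm

theorem tame (H : IsZeroAxisPair h a b q u v) : IsTamePair h a b q u v where
  toIsAxisPair := H.toIsAxisPair
  left_mul_qu := by rw [H.left_hom H.q_mem H.u_mem, H.left_mul, H.left_mul_u, H.sq_eq]
  right_mul_qv := by
    rw [H.right_hom H.symm.q_mem H.symm.u_mem, H.right_mul, H.symm.left_mul_u, H.symm.sq_eq]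
  right_mul_u := by
    have := H.right_mul_u
    rw [H.symm.defect_eq_zero, sub_zero] at this
    exact smul_right_injective M H.one_sub_ne this
  left_mul_v := by
    have := H.symm.right_mul_u
    rw [H.defect_eq_zero, sub_zero] at this
    exact smul_right_injective M H.one_sub_ne this
  ne_zero := H.ne_zero
  ne_one := H.ne_one
  two_mul_ne := H.two_mul_ne
  two_ne := H.two_ne

end IsZeroAxisPair

/-- The terms in `q²` cancel in the difference of the two mirror forms of `oddVec_relation`. -/
theorem IsTamePair.radicalVec_eq {h : F} {a b q u v : M} (H : IsTamePair h a b q u v)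
    (hu : u * u = q * u) (hv : v * v = q * v) : radicalVec h a q u = radicalVec h b q v := by
  have T := H.oddVec_relation hu
  have T' := H.symm.oddVec_relation hv
  simp only [oddVec, mul_add, mul_sub, mul_smul_comm, mul_comm q a, mul_comm q b, H.left_mul,
    H.right_mul] at T T'
  simp only [radicalVec]
  linear_combination (norm := module) T' - T

theorem IsTamePair.radicalVec_mem {h : F} {a b q u v : M} (H : IsTamePair h a b q u v) :
    radicalVec h a q u ∈ evenPart F a := by
  rw [mem_evenPart, H.mul_radicalVec, H.mul_radicalVec]

theorem IsZeroAxisPair.exists_table {h : F} {a b q u v : M} (H : IsZeroAxisPair h a b q u v) :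
    ∃ s t r : M, IsHatFourTable h a b q s t r := by
  have hb := H.tame.symm.mul_radicalVec
  have ha := H.tame.mul_radicalVec
  have hRe := H.tame.radicalVec_mem
  refine H.tame.exists_table H.sq_eq H.symm.sq_eq ?_ ?_
  -- Write `R` for `radicalVec`. As `a(qR) = uR` by multiplicativity and `u_mul` expresses `uR`
  -- through `qR`, the even vector `qR - (1 - 2h)R` satisfies the eigenvector equation of `a` for `1
  -- - h`.
  · rw [← H.tame.radicalVec_eq H.sq_eq H.symm.sq_eq] at hb
    set R := radicalVec h a q u
    have e := H.tame.u_mul (c := 1) (d := 1) hRe (by rw [ha, one_smul]) (by rw [hb, one_smul])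
    have e1 := H.left_hom H.q_mem hRe
    rw [ha, H.left_mul] at e1
    rw [← sub_eq_zero]
    refine eq_zero_of_even_of_mul_eq H.ne_zero H.ne_one
      (sub_mem (H.left.even_even H.q_mem hRe) (Submodule.smul_mem _ _ hRe)) ?_
    rw [mul_sub, mul_smul_comm, ha, e1, e]
    module
  · intro s t r has hbs hat hbt har e1 e2 e3
    have es : s ∈ evenPart F a := by rw [mem_evenPart, has, has]
    have et : t ∈ evenPart F a := by rw [mem_evenPart, hat, mul_zero]
    have er : r ∈ evenPart F a := by rw [mem_evenPart, har, har]
    have k1 := H.left_hom es et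
    have k2 := H.left_hom er es
    rw [hat, mul_zero] at k1
    rw [har, has] at k2
    -- Here `a` annihilates `st` and fixes `rs`, so multiplying the sum by `a` isolates `rs`.
    have k3 := congrArg (a * ·) e1
    simp only [mul_add, mul_smul_comm, k1, k2, smul_zero, zero_add, mul_zero] at k3
    rw [k3, add_zero] at e1
    exact (smul_eq_zero.1 e1).resolve_left H.ne_zero

namespace IsOneAxisPair

variable {h : F} {a b q u v : M}

theorem sq_eq (H : IsOneAxisPair h a b q u v) : u * u = q * u :=
  (sub_eq_zero.1 H.defect_eq_zero).symm

/-- The argument of `IsZeroAxisPair.right_mul_u`, except that `x ↦ x - bx` is now the multiplicative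
map; the defect, already known to vanish, leaves no correction term. -/
theorem right_mul_u (H : IsOneAxisPair h a b q u v) :
    b * u = h • u + h • v + q * q := by
  have h1 := smul_eq_oddVec_add_evenVec h b a q v
  have hA := H.symm.oddVec_mem
  have hQ := H.symm.evenVec_mem
  have hq := H.symm.q_mem
  have hv := H.symm.sq_eq
  have e1 : b * (q * oddVec h b a q v) = h • (q * oddVec h b a q v) :=
    mem_eigSpace.1 (H.right.even_odd hq hA)
  have e0 : evenVec h b q v - b * evenVec h b q v = (1 - h) • (v - q) := by
    rw [evenVec]
    simp only [mul_sub, mul_add, mul_smul_comm, H.right_mul, H.symm.left_mul_u, H.right.idem]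
    module
  have e2 : b * (q * evenVec h b q v)
      = q * evenVec h b q v + (1 - h) • (q * q - q * v) := by
    rw [H.right_hom hq hQ, e0, H.right_mul]
    simp only [mul_sub, sub_mul, mul_smul_comm, mul_comm v q, hv]
    module
  have e3 : q * evenVec h b q v = q * v + h ^ 2 • v - (1 - h) • (q * q) := by
    rw [evenVec]
    simp only [mul_sub, mul_add, mul_smul_comm, mul_comm q b, H.right_mul]
  have e4 : (h * (1 - h)) • u = q * oddVec h b a q v + q * evenVec h b q v := by
    rw [← mul_add, ← h1, mul_smul_comm, mul_comm q a, H.left_mul]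
  have e5 : (h * (1 - h)) • (b * u) = b * (q * oddVec h b a q v) + b * (q * evenVec h b q v) := by
    rw [← mul_add, ← e4, mul_smul_comm]
  refine smul_right_injective M (mul_ne_zero H.ne_zero (sub_ne_zero.2 H.ne_one.symm)) ?_
  linear_combination (norm := module) e5 + e1 + e2 - h • e4 + (1 - h) • e3

theorem tame (H : IsOneAxisPair h a b q u v) : IsTamePair h a b q u v where
  toIsAxisPair := H.toIsAxisPair
  left_mul_qu := by rw [H.left_hom H.q_mem H.u_mem, H.left_mul_u, sub_self, mul_zero, sub_zero]
  right_mul_qv := by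
    rw [H.right_hom H.symm.q_mem H.symm.u_mem, H.symm.left_mul_u, sub_self, mul_zero, sub_zero]
  right_mul_u := H.right_mul_u
  left_mul_v := H.symm.right_mul_u
  ne_zero := H.ne_zero
  ne_one := H.ne_one
  two_mul_ne := H.two_mul_ne
  two_ne := H.two_ne

/-- The square of the `0`-part `q - u` is `q² - qu`, because `u² = qu`. -/
theorem left_mul_sq (H : IsOneAxisPair h a b q u v) : a * (q * q) = q * u := by
  rw [H.left_hom H.q_mem H.q_mem, H.left_mul]
  simp only [mul_sub, sub_mul, mul_comm u q, H.sq_eq]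
  abel

theorem exists_table (H : IsOneAxisPair h a b q u v) :
    ∃ s t r : M, IsHatFourTable h a b q s t r := by
  have hb := H.tame.symm.mul_radicalVec
  have ha := H.tame.mul_radicalVec
  have hRe := H.tame.radicalVec_mem
  have T := H.tame.oddVec_relation H.sq_eq
  have hRR := H.tame.radicalVec_eq H.sq_eq H.symm.sq_eq
  refine H.tame.exists_table H.sq_eq H.symm.sq_eq ?_ ?_
  · rw [← hRR] at hb
    -- This vector multiplies both axes by the scalar `-h²(h + 1)`: since `aq² = qu`, the
    -- combination `2q² + (h² + 3h)q` sends `a` to `radicalVec h a q u - h²(h + 1)a`, and likewise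
    -- for `b`.
    have hye : (2 : F) • (q * q) + (h ^ 2 + 3 * h) • q - radicalVec h a q u ∈ evenPart F a :=
      sub_mem (add_mem (Submodule.smul_mem _ _ (H.left.even_even H.q_mem H.q_mem))
        (Submodule.smul_mem _ _ H.q_mem)) hRe
    have hy : a * ((2 : F) • (q * q) + (h ^ 2 + 3 * h) • q - radicalVec h a q u)
        = (-(h ^ 2 * (h + 1))) • a := by
      simp only [mul_sub, mul_add, mul_smul_comm, ha, H.left_mul_sq, H.left_mul]
      rw [radicalVec]; module
    have hy' : b * ((2 : F) • (q * q) + (h ^ 2 + 3 * h) • q - radicalVec h a q u)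
        = (-(h ^ 2 * (h + 1))) • b := by
      simp only [mul_sub, mul_add, mul_smul_comm, hb, H.symm.left_mul_sq, H.right_mul]
      rw [hRR, radicalVec]; module
    obtain ⟨y, hyd⟩ : ∃ y, y = (2 : F) • (q * q) + (h ^ 2 + 3 * h) • q - radicalVec h a q u :=
      ⟨_, rfl⟩
    rw [← hyd] at hye hy hy'
    have hm := smul_eq_oddVec_add_evenVec h a b q u
    have hPe := H.evenVec_mem
    have hBo := H.oddVec_mem
    have e1 : evenVec h a q u * y + oddVec h a b q u * y = (-(h ^ 2 * (h + 1))) • evenVec h a q u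
        + (-(h ^ 2 * (h + 1))) • oddVec h a b q u := by
      rw [← add_mul, ← smul_add, add_comm (evenVec h a q u), ← hm, smul_mul_assoc, hy', smul_comm]
    have k := odd_eq_of_add_eq H.ne_zero H.ne_one (H.left.even_even hPe hye)
      (H.left.odd_even hBo hye) (Submodule.smul_mem _ _ hPe) (Submodule.smul_mem _ _ hBo) e1
    rw [k, add_left_inj, evenVec] at e1
    simp only [sub_mul, add_mul, smul_mul_assoc, hy] at e1
    have e2 := H.left_hom H.q_mem hye
    rw [hy, H.left_mul] at e2
    simp only [sub_mul, mul_sub, mul_smul_comm, mul_comm q a, mul_comm u a, H.left_mul,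
      H.left_mul_u] at e2
    -- The left side is even for `a` and satisfies the eigenvector equation for `1 - h`.
    have e3 : q * y + (h ^ 2 * (h + 1)) • q = 0 := by
      refine eq_zero_of_even_of_mul_eq H.ne_zero H.ne_one
        (add_mem (H.left.even_even H.q_mem hye) (Submodule.smul_mem _ _ H.q_mem)) ?_
      rw [mul_add, mul_smul_comm, H.left_mul, e2]
      linear_combination (norm := module) e1
    rw [hyd] at e3
    -- Multiplying `T` by `q` produces `q(q²)`, which is eliminated against `e3` to leave the
    -- product of `q` and `radicalVec`.
    have qT := congrArg (q * ·) T
    simp only [radicalVec, oddVec, mul_add, mul_sub, mul_smul_comm, mul_comm q a, mul_comm q b,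
      H.left_mul, H.right_mul, mul_zero] at e3 qT T hRR ⊢
    refine smul_right_injective M H.ne_zero ?_
    linear_combination (norm := module) (1 - h) • e3 - qT - h • T - (h * (1 - h)) • hRR
  · intro s t r has hbs hat hbt har e1 e2 e3
    have es : s ∈ evenPart F a := by rw [mem_evenPart, has, has]
    have et : t ∈ evenPart F a := by rw [mem_evenPart, hat, mul_zero]
    have k1 := H.left_hom es et
    have k2 := H.left_hom et et
    rw [hat, has, sub_self, zero_mul, sub_zero] at k1
    rw [hat, sub_zero, sub_self] at k2
    -- Here `a` fixes `st` and annihilates `t²` and `t`, so multiplying this equation by `a` gives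
    -- `st = 0`.
    have e4 : t * t = t + s * t := by
      refine smul_right_injective M H.ne_zero ?_
      linear_combination (norm := module) e3 - e2
    rw [e4, mul_add, hat, k1, zero_add] at k2
    exact k2

end IsOneAxisPair

end Table

/-! ### From the fusion rules to graded axes -/

section JordanAxes

variable {F : Type u} [Field F] {M : Type v} [NonUnitalNonAssocCommRing M] [Module F M]
  [IsScalarTower F M M] [SMulCommClass F M M]

namespace IsAxis

variable {Φ : Set JordanLabel} {h : F} {a : M}

theorem mul_mem_of_star_subset {s t i : JordanLabel}
    (H : IsAxis (jordanRule Φ) (JordanLabel.ev h) a) (hi : (jordanRule Φ).star s t ⊆ {i}) {x y : M}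
    (hx : x ∈ eigSpace a (JordanLabel.ev h s)) (hy : y ∈ eigSpace a (JordanLabel.ev h t)) :
    x * y ∈ eigSpace a (JordanLabel.ev h i) := by
  have hle : ⨆ j ∈ (jordanRule Φ).star s t, eigSpace a (JordanLabel.ev h j) ≤
      eigSpace a (JordanLabel.ev h i) := by
    refine iSup₂_le fun j hj => ?_
    rw [hi hj]
  exact hle (H.fusion s t x hx y hy)

theorem mul_mem_evenPart {s t : JordanLabel}
    (H : IsAxis (jordanRule Φ) (JordanLabel.ev h) a)
    (hi : (jordanRule Φ).star s t ⊆ {.zero, .one}) {x y : M}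
    (hx : x ∈ eigSpace a (JordanLabel.ev h s)) (hy : y ∈ eigSpace a (JordanLabel.ev h t)) :
    x * y ∈ evenPart F a := by
  have hle : ⨆ j ∈ (jordanRule Φ).star s t, eigSpace a (JordanLabel.ev h j) ≤ evenPart F a := by
    refine iSup₂_le fun j hj z hz => ?_
    rw [mem_eigSpace] at hz
    rw [mem_evenPart]
    rcases hi hj with rfl | hj
    · rw [hz, JordanLabel.ev, zero_smul, mul_zero]
    · rw [Set.mem_singleton_iff.1 hj] at hz
      rw [hz, JordanLabel.ev, one_smul, hz, JordanLabel.ev, one_smul]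
  exact hle (H.fusion s t x hx y hy)

theorem exists_decomposition (H : IsAxis (jordanRule Φ) (JordanLabel.ev h) a) (x : M) :
    ∃ y z w, y ∈ eigSpace a (0 : F) ∧ z ∈ eigSpace a (1 : F) ∧ w ∈ eigSpace a h ∧
      x = y + z + w := by
  have hle : (⊤ : Submodule F M) ≤ eigSpace a (0 : F) ⊔ eigSpace a (1 : F) ⊔ eigSpace a h := by
    rw [← H.span]
    refine iSup_le fun s => ?_
    cases s
    · exact le_sup_left.trans le_sup_left
    · exact le_sup_right.trans le_sup_left
    · exact le_sup_right
  obtain ⟨p, hp, w, hw, rfl⟩ := Submodule.mem_sup.1 (hle (Submodule.mem_top (x := x)))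
  obtain ⟨y, hy, z, hz, rfl⟩ := Submodule.mem_sup.1 hp
  exact ⟨y, z, w, hy, hz, hw, rfl⟩

theorem sub_mul_mem {x : M} (hx : x ∈ evenPart F a) : x - a * x ∈ eigSpace a (0 : F) := by
  rw [mem_eigSpace, mul_sub, mem_evenPart.1 hx, sub_self, zero_smul]

theorem mul_mem {x : M} (hx : x ∈ evenPart F a) : a * x ∈ eigSpace a (1 : F) := by
  rw [mem_eigSpace, mem_evenPart.1 hx, one_smul]

/-- For even `x` and `y`, the vectors `x - ax` and `ax` are the `0`- and `1`-parts, so each of the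
four terms is governed by one entry of the fusion rule. -/
theorem mul_expand (a x y : M) : x * y = (x - a * x) * (y - a * y) + (x - a * x) * (a * y)
    + (y - a * y) * (a * x) + (a * x) * (a * y) := by
  simp only [mul_sub, sub_mul, mul_comm y (a * x), mul_comm (a * y) (a * x)]
  abel

theorem isGradedAxis (hΦ : Φ ⊆ {JordanLabel.zero, JordanLabel.one})
    (H : IsAxis (jordanRule Φ) (JordanLabel.ev h) a) : IsGradedAxis h a where
  idem := H.idem
  cubic x := by
    obtain ⟨y, z, w, hy, hz, hw, rfl⟩ := H.exists_decomposition x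
    rw [mem_eigSpace] at hy hz hw
    simp only [mul_add, hy, hz, hw, mul_smul_comm]
    module
  even_even {x y} hx hy := by
    rw [mul_expand a x y]
    refine add_mem (add_mem (add_mem ?_ ?_) ?_) ?_
    · exact H.mul_mem_evenPart (s := .zero) (t := .zero) (by intro j hj; exact Or.inl hj)
        (sub_mul_mem hx) (sub_mul_mem hy)
    · exact H.mul_mem_evenPart (s := .zero) (t := .one) hΦ (sub_mul_mem hx) (mul_mem hy)
    · exact H.mul_mem_evenPart (s := .zero) (t := .one) hΦ (sub_mul_mem hy) (mul_mem hx)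
    · exact H.mul_mem_evenPart (s := .one) (t := .one) (by intro j hj; exact Or.inr hj)
        (mul_mem hx) (mul_mem hy)
  even_odd {x y} hx hy := by
    have e : x * y = (x - a * x) * y + (a * x) * y := by rw [← add_mul, sub_add_cancel]
    rw [e]
    exact add_mem (H.mul_mem_of_star_subset (s := .zero) (t := .eta) (i := .eta)
        (fun j hj => hj) (sub_mul_mem hx) hy)
      (H.mul_mem_of_star_subset (s := .one) (t := .eta) (i := .eta)
        (fun j hj => hj) (mul_mem hx) hy)
  odd_odd hx hy := H.mul_mem_evenPart (s := .eta) (t := .eta) (fun j hj => hj) hx hy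

/-- Only the product of the two `1`-parts survives multiplication by `a`, and it is fixed. -/
theorem zero_hom (hΦ : Φ ⊆ {JordanLabel.zero})
    (H : IsAxis (jordanRule Φ) (JordanLabel.ev h) a) {x y : M} (hx : x ∈ evenPart F a)
    (hy : y ∈ evenPart F a) : a * (x * y) = (a * x) * (a * y) := by
  have e1 := mem_eigSpace.1 (H.mul_mem_of_star_subset (s := .zero) (t := .zero) (i := .zero)
    (fun j hj => hj) (sub_mul_mem hx) (sub_mul_mem hy))
  have e2 := mem_eigSpace.1 (H.mul_mem_of_star_subset (s := .zero) (t := .one) (i := .zero)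
    hΦ (sub_mul_mem hx) (mul_mem hy))
  have e3 := mem_eigSpace.1 (H.mul_mem_of_star_subset (s := .zero) (t := .one) (i := .zero)
    hΦ (sub_mul_mem hy) (mul_mem hx))
  have e4 := mem_eigSpace.1 (H.mul_mem_of_star_subset (s := .one) (t := .one) (i := .one)
    (fun j hj => hj) (mul_mem hx) (mul_mem hy))
  simp only [JordanLabel.ev, zero_smul, one_smul] at e1 e2 e3 e4
  rw [mul_expand a x y, mul_add, mul_add, mul_add, e1, e2, e3, e4, zero_add, zero_add, zero_add]

/-- Only the product of the two `0`-parts is annihilated by `a`; the other three terms are fixed. -/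
theorem one_hom (hΦ : Φ ⊆ {JordanLabel.one})
    (H : IsAxis (jordanRule Φ) (JordanLabel.ev h) a) {x y : M} (hx : x ∈ evenPart F a)
    (hy : y ∈ evenPart F a) : a * (x * y) = x * y - (x - a * x) * (y - a * y) := by
  have e1 := mem_eigSpace.1 (H.mul_mem_of_star_subset (s := .zero) (t := .zero) (i := .zero)
    (fun j hj => hj) (sub_mul_mem hx) (sub_mul_mem hy))
  have e2 := mem_eigSpace.1 (H.mul_mem_of_star_subset (s := .zero) (t := .one) (i := .one)
    hΦ (sub_mul_mem hx) (mul_mem hy))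
  have e3 := mem_eigSpace.1 (H.mul_mem_of_star_subset (s := .zero) (t := .one) (i := .one)
    hΦ (sub_mul_mem hy) (mul_mem hx))
  have e4 := mem_eigSpace.1 (H.mul_mem_of_star_subset (s := .one) (t := .one) (i := .one)
    (fun j hj => hj) (mul_mem hx) (mul_mem hy))
  simp only [JordanLabel.ev, zero_smul, one_smul] at e1 e2 e3 e4
  have e := mul_expand a x y
  rw [e, mul_add, mul_add, mul_add, e1, e2, e3, e4, zero_add]
  abel

end IsAxis

theorem IsJordanAxialAlgebra.exists_table (h2 : (2 : F) ≠ 0) {Φ : Set JordanLabel}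
    (hΦ : Φ ⊆ {JordanLabel.zero, JordanLabel.one})
    (hΦ' : Φ ≠ {JordanLabel.zero, JordanLabel.one}) {h : F} (h0 : h ≠ 0) (h1 : h ≠ 1)
    (hh : h ≠ 1 / 2) {a b : M} (H : IsJordanAxialAlgebra Φ h ({a, b} : Set M)) :
    ∃ q s t r : M, IsHatFourTable h a b q s t r := by
  have ha := H.axis a (Set.mem_insert _ _)
  have hb := H.axis b (Set.mem_insert_of_mem _ rfl)
  have hp : IsAxisPair h a b (a * b - h • a - h • b) (a * (a * b - h • a - h • b))
      (b * (a * b - h • a - h • b)) :=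
    ⟨ha.isGradedAxis hΦ, hb.isGradedAxis hΦ, by abel, rfl, rfl⟩
  have h2' : 2 * h - 1 ≠ 0 := by
    intro e
    refine hh ?_
    rw [eq_div_iff h2]
    linear_combination e
  refine ⟨a * b - h • a - h • b, ?_⟩
  -- A proper subset of `{0, 1}` lies in `{0}` or in `{1}`; the empty set falls under the second
  -- case.
  by_cases hz : JordanLabel.zero ∈ Φ
  · have hs : Φ ⊆ {JordanLabel.zero} := by
      intro j hj
      rcases hΦ hj with rfl | hj'
      · rfl
      · rw [Set.mem_singleton_iff.1 hj'] at hj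
        refine absurd (hΦ.antisymm ?_) hΦ'
        rintro k (rfl | hk)
        · exact hz
        · rwa [Set.mem_singleton_iff.1 hk]
    exact IsZeroAxisPair.exists_table ⟨hp, ha.zero_hom hs, hb.zero_hom hs, h0, h1, h2', h2⟩
  · have hs : Φ ⊆ {JordanLabel.one} := by
      intro j hj
      rcases hΦ hj with rfl | hj'
      · exact absurd hj hz
      · exact hj'
    exact IsOneAxisPair.exists_table ⟨hp, ha.one_hom hs, hb.one_hom hs, h0, h1, h2', h2⟩

end JordanAxes

/-! ### Homomorphisms from `3Ĉ(η)` and `4̂(η)` given on basis vectors -/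

section Homs

variable {F : Type u} [Field F]

theorem linearCombination_sum_sum {ι : Type} [Fintype ι] {M : Type v}
    [NonUnitalNonAssocCommRing M] [Module F M] [IsScalarTower F M M] [SMulCommClass F M M]
    {p : ι → ι → (ι → F)} {e : ι → M}
    (he : ∀ i j, Fintype.linearCombination F e (p i j) = e i * e j) (x y : ι → F) :
    Fintype.linearCombination F e (∑ i, ∑ j, (x i * y j) • p i j)
      = Fintype.linearCombination F e x * Fintype.linearCombination F e y := by
  simp only [map_sum, map_smul, he]
  simp only [Fintype.linearCombination_apply, Finset.sum_mul_sum, smul_mul_smul_comm]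

/-- The homomorphism given by the images of the basis vectors. -/
def MulTable.lift {ι : Type} [Fintype ι] (T : MulTable ι F) {M : Type v}
    [NonUnitalNonAssocCommRing M] [Module F M] [IsScalarTower F M M] [SMulCommClass F M M]
    (e : ι → M)
    (he : ∀ i j, Fintype.linearCombination F e (T.prod i j) = e i * e j) : T.Alg →ₙₐ[F] M where
  toFun x := Fintype.linearCombination F e x
  map_smul' c x := map_smul (Fintype.linearCombination F e) c x
  map_zero' := map_zero (Fintype.linearCombination F e)
  map_add' x y := map_add (Fintype.linearCombination F e) x y
  map_mul' x y := linearCombination_sum_sum he x y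

theorem MulTable.lift_apply {ι : Type} [Fintype ι] (T : MulTable ι F) {M : Type v}
    [NonUnitalNonAssocCommRing M] [Module F M] [IsScalarTower F M M] [SMulCommClass F M M]
    (e : ι → M) (he : ∀ i j, Fintype.linearCombination F e (T.prod i j) = e i * e j) (x : T.Alg) :
    T.lift e he x = ∑ i, x i • e i := rfl

theorem zmod_three_neg_one : (-1 : ZMod 3) = 2 := rfl

theorem zmod_three_cases (i : ZMod 3) : i = 0 ∨ i = 1 ∨ i = 2 := by revert i; decide

theorem zmod_three_sum {N : Type v} [AddCommMonoid N] (f : ZMod 3 → N) :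
    ∑ i, f i = f 0 + f 1 + f 2 := Fin.sum_univ_three f

variable {M : Type v} [NonUnitalNonAssocCommRing M] [Module F M]

/-- Commutativity reduces the products of distinct `âᵢ` to three. -/
theorem hatThreeC_lift_condition {η : F} {e : Option (ZMod 3) → M}
    (hqq : e none * e none = (η + 1) • e none)
    (hqe : ∀ i, e none * e (some i) = (η + 1) • e (some i))
    (hee : ∀ i, e (some i) * e (some i) = e (some i))
    (h01 : e (some 0) * e (some 1) = (-(1 / 2) : F) • e none
      + ((η + 1) / 2) • (e (some 0) + e (some 1)) + ((1 - η) / 2) • e (some 2))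
    (h02 : e (some 0) * e (some 2) = (-(1 / 2) : F) • e none
      + ((η + 1) / 2) • (e (some 0) + e (some 2)) + ((1 - η) / 2) • e (some 1))
    (h12 : e (some 1) * e (some 2) = (-(1 / 2) : F) • e none
      + ((η + 1) / 2) • (e (some 1) + e (some 2)) + ((1 - η) / 2) • e (some 0))
    (i j : Option (ZMod 3)) :
    Fintype.linearCombination F e ((hatThreeCTable η).prod i j) = e i * e j := by
  have hs : ∀ i, Fintype.linearCombination F e (Pi.single i 1) = e i := by
    intro i
    rw [Fintype.linearCombination_apply_single, one_smul]
  rcases i with _ | i <;> rcases j with _ | j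
  · simp only [hatThreeCTable, map_smul, hs, hqq]
  · simp only [hatThreeCTable, map_smul, hs, hqe]
  · simp only [hatThreeCTable, map_smul, hs, mul_comm (e (some i)), hqe]
  · by_cases hij : i = j
    · subst hij
      simp [hatThreeCTable, hs, hee]
    · simp only [hatThreeCTable, if_neg hij, map_smul, map_add, hs]
      rcases zmod_three_cases i with rfl | rfl | rfl <;>
      rcases zmod_three_cases j with rfl | rfl | rfl <;>
      first
      | exact absurd rfl hij
      | (rw [show (-0 - 1 : ZMod 3) = 2 from rfl, h01])
      | (rw [show (-0 - 2 : ZMod 3) = 1 from rfl, h02])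
      | (rw [show (-1 - 2 : ZMod 3) = 0 from rfl, h12])
      | (rw [show (-1 - 0 : ZMod 3) = 2 from rfl, mul_comm, h01]; module)
      | (rw [show (-2 - 0 : ZMod 3) = 1 from rfl, mul_comm, h02]; module)
      | (rw [show (-2 - 1 : ZMod 3) = 0 from rfl, mul_comm, h12]; module)

variable [IsScalarTower F M M] [SMulCommClass F M M]

/-- The sum of a homomorphism from `3Ĉ(η)` and the homomorphism from `2A` that is given by two
idempotents, provided that all products between the images vanish. -/
def hatFourLift {η : F} (f : HatThreeC η →ₙₐ[F] M) (s t : M) (hs : s * s = s) (ht : t * t = t)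
    (hst : s * t = 0) (hfs : ∀ x, f x * s = 0) (hft : ∀ x, f x * t = 0) :
    HatFour η →ₙₐ[F] M where
  toFun x := f x.1 + x.2.1 • s + x.2.2 • t
  map_smul' c x := by
    change f (c • x.1) + (c * x.2.1) • s + (c * x.2.2) • t = c • (f x.1 + x.2.1 • s + x.2.2 • t)
    rw [map_smul]; module
  map_zero' := by
    change f 0 + (0 : F) • s + (0 : F) • t = 0
    rw [map_zero, zero_smul, zero_smul, add_zero, add_zero]
  map_add' x y := by
    change f (x.1 + y.1) + (x.2.1 + y.2.1) • s + (x.2.2 + y.2.2) • t = _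
    rw [map_add]; module
  map_mul' x y := by
    change f (x.1 * y.1) + (x.2.1 * y.2.1) • s + (x.2.2 * y.2.2) • t = _
    rw [map_mul]
    simp only [mul_add, add_mul, smul_mul_assoc, mul_smul_comm, hfs, hft, hs, ht, hst,
      mul_comm s (f _), mul_comm t (f _), mul_comm t s]
    module

/-- A pair of axes with the multiplication table of `4̂(η)` generates a quotient of `4̂(η)`. -/
theorem IsHatFourTable.exists_hom {η : F} (h2 : (2 : F) ≠ 0) (h0 : η ≠ 0) {a b q s t r : M}
    (H : IsHatFourTable η a b q s t r) : ∃ π : HatFour η →ₙₐ[F] M,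
      π (HatFour.axis₀ η) = a ∧ π (HatFour.axis₁ η) = b := by
  have haq : a * q = (1 / 2 : F) • ((-(η * (η + 1))) • a + (η - 1) • (η • s + r)) := by
    rw [← H.a_q, smul_smul, one_div, inv_mul_cancel₀ h2, one_smul]
  have hbq : b * q = (1 / 2 : F) • ((-(η * (η + 1))) • b + (η - 1) • (η • t + r)) := by
    rw [← H.b_q, smul_smul, one_div, inv_mul_cancel₀ h2, one_smul]
  have hqq : q * q = (1 / 2 : F) • ((-(η * (η + 1))) • q
      - (η - 1) • (η ^ 2 • (s + t) + (2 * η - 1) • r)) := by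
    rw [← H.q_q, smul_smul, one_div, inv_mul_cancel₀ h2, one_smul]
  -- The images of `â₀` and `â₁` are forced by `a = â₀ + s₀` and `b = â₁ + s₁`. Those of `â₋₁` and
  -- `q̂` result from solving the formula for `â₀â₁` together with `r = q̂ - (â₀ + â₁ + â₋₁)`; this
  -- is where division by `η` occurs.
  let e : Option (ZMod 3) → M := fun i => Option.casesOn i
    (r - (2 / η) • q - (1 / η) • r - (2 : F) • s - (2 : F) • t)
    (![a - s, b - t, -((2 / η) • q) - (1 / η) • r - a - b - s - t])
  have e0 : e (some 0) = a - s := rfl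
  have e1 : e (some 1) = b - t := rfl
  have e2 : e (some 2) = -((2 / η) • q) - (1 / η) • r - a - b - s - t := rfl
  have en : e none = r - (2 / η) • q - (1 / η) • r - (2 : F) • s - (2 : F) • t := rfl
  have hcond : ∀ i j, Fintype.linearCombination F e ((hatThreeCTable η).prod i j) = e i * e j := by
    refine hatThreeC_lift_condition ?_ (fun i => ?_) (fun i => ?_) ?_ ?_ ?_
    on_goal 2 => rcases zmod_three_cases i with rfl | rfl | rfl
    on_goal 5 => rcases zmod_three_cases i with rfl | rfl | rfl
    all_goals
      simp only [e0, e1, e2, en, mul_add, mul_sub, sub_mul, mul_smul_comm, smul_mul_assoc,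
        neg_mul, mul_neg, H.a_a, H.b_b, H.a_b, mul_comm b a, haq, hbq, hqq, mul_comm q a,
        mul_comm q b, H.a_s, H.a_t, H.a_r, H.b_s, H.b_t, H.b_r, H.q_s, H.q_t, H.q_r, H.s_s, H.s_t,
        H.t_t, H.r_s, H.r_t, H.r_r, mul_comm s a, mul_comm s b, mul_comm t a, mul_comm t b,
        mul_comm r a, mul_comm r b, mul_comm s q, mul_comm t q, mul_comm r q, mul_comm t s,
        mul_comm s r, mul_comm t r, smul_zero]
      match_scalars <;> first | ring1 | (field_simp <;> ring1)
  have hes : ∀ i, e i * s = 0 := by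
    rintro (_ | i)
    · simp only [en, sub_mul, smul_mul_assoc, H.r_s, H.q_s, H.s_s, mul_comm t s, H.s_t]
      match_scalars; field_simp; ring
    · rcases zmod_three_cases i with rfl | rfl | rfl
      · rw [e0, sub_mul, H.a_s, H.s_s, sub_self]
      · rw [e1, sub_mul, H.b_s, mul_comm t s, H.s_t, sub_self]
      · simp only [e2, sub_mul, neg_mul, smul_mul_assoc, H.r_s, H.q_s, H.s_s, mul_comm t s, H.s_t,
          H.a_s, H.b_s]
        match_scalars; field_simp; ring
  have het : ∀ i, e i * t = 0 := by
    rintro (_ | i)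
    · simp only [en, sub_mul, smul_mul_assoc, H.r_t, H.q_t, H.t_t, H.s_t]
      match_scalars; field_simp; ring
    · rcases zmod_three_cases i with rfl | rfl | rfl
      · rw [e0, sub_mul, H.a_t, H.s_t, sub_self]
      · rw [e1, sub_mul, H.b_t, H.t_t, sub_self]
      · simp only [e2, sub_mul, neg_mul, smul_mul_assoc, H.r_t, H.q_t, H.t_t, H.s_t, H.a_t, H.b_t]
        match_scalars; field_simp; ring
  have hf : ∀ i, (hatThreeCTable η).lift e hcond (HatThreeC.a η i) = e (some i) := by
    intro i
    change Fintype.linearCombination F e (Pi.single (some i) 1) = e (some i)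
    rw [Fintype.linearCombination_apply_single, one_smul]
  refine ⟨hatFourLift ((hatThreeCTable η).lift e hcond) s t H.s_s H.t_t H.s_t ?_ ?_, ?_, ?_⟩
  · intro x
    rw [MulTable.lift_apply, Finset.sum_mul]
    exact Finset.sum_eq_zero fun i _ => by rw [smul_mul_assoc, hes, smul_zero]
  · intro x
    rw [MulTable.lift_apply, Finset.sum_mul]
    exact Finset.sum_eq_zero fun i _ => by rw [smul_mul_assoc, het, smul_zero]
  · change (hatThreeCTable η).lift e hcond (HatThreeC.a η 0 + 0) + (0 + 1 : F) • s
      + (0 + 0 : F) • t = a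
    rw [add_zero, hf, e0]
    module
  · change (hatThreeCTable η).lift e hcond (HatThreeC.a η 1 + 0) + (0 + 0 : F) • s
      + (0 + 1 : F) • t = b
    rw [add_zero, hf, e1]
    module

theorem surjective_of_generates {η : F} {a b : M} (hgen : NonUnitalAlgebra.adjoin F {a, b} = ⊤)
    (π : HatFour η →ₙₐ[F] M) (ha : π (HatFour.axis₀ η) = a) (hb : π (HatFour.axis₁ η) = b) :
    Function.Surjective π := by
  intro x
  have hle : NonUnitalAlgebra.adjoin F {a, b} ≤ NonUnitalAlgHom.range π := by
    rw [NonUnitalAlgebra.adjoin_le_iff]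
    rintro y (rfl | hy)
    · exact ⟨_, ha⟩
    · rw [Set.mem_singleton_iff.1 hy]
      exact ⟨_, hb⟩
  have := hle (hgen ▸ (NonUnitalAlgebra.mem_top : x ∈ (⊤ : NonUnitalSubalgebra F M)))
  exact this

end Homs

/-! ### The ideals of `3Ĉ(η)` -/

namespace HatThreeC

variable {F : Type u} [Field F] {η : F}

theorem eq_sum_basis (x : HatThreeC η) :
    x = x none • q η + (x (some 0) • a η 0 + x (some 1) • a η 1 + x (some 2) • a η 2) := by
  funext i
  change x i = x none * (Pi.single none 1 : Option (ZMod 3) → F) i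
    + (x (some 0) * (Pi.single (some 0) 1 : Option (ZMod 3) → F) i
      + x (some 1) * (Pi.single (some 1) 1 : Option (ZMod 3) → F) i
      + x (some 2) * (Pi.single (some 2) 1 : Option (ZMod 3) → F) i)
  rcases i with _ | i
  · simp
  · rcases zmod_three_cases i with rfl | rfl | rfl <;> simp [Option.some.injEq,
      show (0 : ZMod 3) ≠ 1 by decide, show (0 : ZMod 3) ≠ 2 by decide,
      show (1 : ZMod 3) ≠ 0 by decide, show (1 : ZMod 3) ≠ 2 by decide,
      show (2 : ZMod 3) ≠ 0 by decide, show (2 : ZMod 3) ≠ 1 by decide]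

theorem basis_mul_basis (i j : Option (ZMod 3)) :
    (hatThreeCTable η).basis i * (hatThreeCTable η).basis j = (hatThreeCTable η).prod i j := by
  change (∑ k, ∑ l, ((Pi.single i 1 : Option (ZMod 3) → F) k
    * (Pi.single j 1 : Option (ZMod 3) → F) l) • (hatThreeCTable η).prod k l) = _
  rw [Finset.sum_eq_single i, Finset.sum_eq_single j]
  · simp
  · intro l _ hl
    rw [Pi.single_eq_of_ne hl, mul_zero, zero_smul]
  · simp
  · intro k _ hk
    refine Finset.sum_eq_zero fun l _ => ?_
    rw [Pi.single_eq_of_ne hk, zero_mul, zero_smul]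
  · simp

theorem a_mul_self (i : ZMod 3) : a η i * a η i = a η i := by
  refine (basis_mul_basis (some i) (some i)).trans ?_
  exact if_pos rfl

theorem a_mul_a {i j k : ZMod 3} (hij : i ≠ j) (hk : k = -i - j) :
    a η i * a η j = (-(1 / 2) : F) • q η + ((η + 1) / 2) • (a η i + a η j)
      + ((1 - η) / 2) • a η k := by
  subst hk
  refine (basis_mul_basis (some i) (some j)).trans ?_
  exact if_neg hij

theorem q_mul_a (i : ZMod 3) : q η * a η i = (η + 1) • a η i :=
  basis_mul_basis none (some i)

theorem q_mul_q : q η * q η = (η + 1) • q η := basis_mul_basis none none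

theorem a_apply_none (i : ZMod 3) : a η i none = 0 := rfl

theorem a_apply_some (i j : ZMod 3) : a η i (some j) = if j = i then 1 else 0 := by
  change (Pi.single (some i) 1 : Option (ZMod 3) → F) (some j) = _
  simp [Pi.single_apply]

theorem q_apply_none : q η none = 1 := rfl

theorem q_apply_some (i : ZMod 3) : q η (some i) = 0 := rfl

theorem add_apply (x y : HatThreeC η) (i) : (x + y) i = x i + y i := rfl

theorem sub_apply (x y : HatThreeC η) (i) : (x - y) i = x i - y i := rfl

theorem smul_apply (c : F) (x : HatThreeC η) (i) : (c • x) i = c * x i := rfl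

/-- The element `q̂ - (â₀ + â₁ + â₋₁)`. -/
def r (η : F) : HatThreeC η := q η - (a η (-1) + a η 1 + a η 0)

theorem ext_iff' {x y : HatThreeC η} : x = y ↔ x none = y none ∧ x (some 0) = y (some 0)
    ∧ x (some 1) = y (some 1) ∧ x (some 2) = y (some 2) := by
  constructor
  · rintro rfl
    exact ⟨rfl, rfl, rfl, rfl⟩
  · rintro ⟨h, h0, h1, h2⟩
    rw [eq_sum_basis x, eq_sum_basis y, h, h0, h1, h2]

/-- The linear form that gives the homomorphism from `3Ĉ(η)` onto `1A`. -/
def augment (η : F) : HatThreeC η →ₗ[F] F where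
  toFun x := (η + 1) * x none + (x (some 0) + x (some 1) + x (some 2))
  map_add' x y := by simp only [add_apply]; ring
  map_smul' c x := by simp only [smul_apply, RingHom.id_apply, smul_eq_mul]; ring

theorem augment_apply (x : HatThreeC η) :
    augment η x = (η + 1) * x none + (x (some 0) + x (some 1) + x (some 2)) := rfl

theorem r_mem_iff_span {x : HatThreeC η} :
    x ∈ Submodule.span F {r η} ↔ ∀ i, x (some i) = -x none := by
  rw [Submodule.mem_span_singleton]
  constructor
  · rintro ⟨c, rfl⟩ i
    rcases zmod_three_cases i with rfl | rfl | rfl <;>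
    simp [r, smul_apply, sub_apply, add_apply, q_apply_none, q_apply_some, a_apply_none,
      a_apply_some, zmod_three_neg_one, show (0 : ZMod 3) ≠ 2 by decide,
      show (1 : ZMod 3) ≠ 2 by decide, show (2 : ZMod 3) ≠ 0 by decide,
      show (2 : ZMod 3) ≠ 1 by decide]
  · intro h
    refine ⟨x none, Eq.trans ?_ (eq_sum_basis x).symm⟩
    rw [h, h, h]
    simp only [r, zmod_three_neg_one]
    module

/-- An ideal of `3Ĉ(η)`. -/
def IsIdeal (K : Submodule F (HatThreeC η)) : Prop := ∀ x, ∀ y ∈ K, x * y ∈ K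

variable {K : Submodule F (HatThreeC η)}

/-- The operator `âₖ(âₖ - 1)` kills everything but the `η`-eigenvector, a multiple of `âᵢ - âⱼ`, on
which it is the nonzero scalar `η(η - 1)`. The component of the given element along that vector is
`(β₁ - β₂)/2`. -/
theorem IsIdeal.a_sub_a_mem (hK : IsIdeal K) (h2 : (2 : F) ≠ 0) (h0 : η ≠ 0) (h1 : η ≠ 1)
    {i j k : ZMod 3} (hki : k ≠ i) (hkj : k ≠ j) (hi : i = -k - j) (hj : j = -k - i) {α β β₁ β₂ : F}
    (hy : α • q η + (β • a η k + β₁ • a η i + β₂ • a η j) ∈ K) (hne : β₁ ≠ β₂) :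
    a η i - a η j ∈ K := by
  have hz := hK (a η k) _ hy
  have hz' := K.sub_mem (hK (a η k) _ hz) hz
  have hc : η * (η - 1) * (β₁ - β₂) / 2 ≠ 0 :=
    div_ne_zero (mul_ne_zero (mul_ne_zero h0 (sub_ne_zero.2 h1)) (sub_ne_zero.2 hne)) h2
  rw [← K.smul_mem_iff hc]
  convert hz' using 1
  simp only [mul_add, mul_smul_comm, mul_comm (a η k) (q η), q_mul_a, a_mul_self,
    a_mul_a hki hj, a_mul_a hkj hi]
  match_scalars <;> field_simp <;> ring

/-- Multiplying `âᵢ - âⱼ` by `âᵢ` gives an element that involves `q̂`; multiplying that one by `âₖ`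
gives a second, and together they yield `2η(1 - η)(âₖ - âᵢ)`. -/
theorem IsIdeal.a_sub_a_mem' (hK : IsIdeal K) (h2 : (2 : F) ≠ 0) (h0 : η ≠ 0) (h1 : η ≠ 1)
    {i j k : ZMod 3} (hij : i ≠ j) (hki : k ≠ i) (hk : k = -i - j) (hj : j = -k - i) (hd : a η i - a η j ∈ K) :
    a η k - a η i ∈ K ∧ q η - (η + 1) • a η i ∈ K := by
  have hz := hK (a η i) _ hd
  have hu : q η - (2 * η) • a η i - (1 - η) • a η k ∈ K := by
    convert K.sub_mem (K.smul_mem 2 hz) (K.smul_mem (η + 1) hd) using 1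
    simp only [mul_sub, a_mul_self, a_mul_a hij hk]
    match_scalars <;> field_simp <;> ring
  have hv := hK (a η k) _ hu
  have hc : 2 * η * (1 - η) ≠ 0 := mul_ne_zero (mul_ne_zero h2 h0) (sub_ne_zero.2 h1.symm)
  have hki' : a η k - a η i ∈ K := by
    rw [← K.smul_mem_iff hc]
    convert K.add_mem (K.sub_mem hv (K.smul_mem η hu)) (K.smul_mem (-(η * (1 - η))) hd) using 1
    simp only [mul_sub, mul_smul_comm, mul_comm (a η k) (q η), q_mul_a, a_mul_self,
      a_mul_a hki hj]
    match_scalars <;> field_simp <;> ring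
  refine ⟨hki', ?_⟩
  convert K.add_mem hu (K.smul_mem (1 - η) hki') using 1
  module

/-- Two unequal coordinates put one difference of the `âᵢ` into the ideal. From it come all the
differences and `q̂ - (η + 1)â₀`, which span the kernel. -/
theorem IsIdeal.ker_augment_le (hK : IsIdeal K) (h2 : (2 : F) ≠ 0) (h0 : η ≠ 0) (h1 : η ≠ 1)
    {y : HatThreeC η} (hy : y ∈ K) (hne : ¬(y (some 0) = y (some 1) ∧ y (some 1) = y (some 2))) :
    LinearMap.ker (augment η) ≤ K := by
  have key : a η 1 - a η 0 ∈ K ∧ a η 2 - a η 0 ∈ K ∧ q η - (η + 1) • a η 0 ∈ K := by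
    rw [eq_sum_basis y] at hy
    by_cases h : y (some 0) = y (some 1)
    · have h12 := hK.a_sub_a_mem h2 h0 h1 (i := 1) (j := 2) (k := 0) (by decide) (by decide)
        (by decide) (by decide) hy fun h' => hne ⟨h, h'⟩
      obtain ⟨h01, hq⟩ := hK.a_sub_a_mem' h2 h0 h1 (i := 1) (j := 2) (k := 0) (by decide)
        (by decide) (by decide) (by decide) h12
      refine ⟨?_, ?_, ?_⟩
      · convert K.neg_mem h01 using 1
        module
      · convert K.neg_mem (K.add_mem h12 h01) using 1
        module
      · convert K.sub_mem hq (K.smul_mem (η + 1) h01) using 1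
        module
    · have h01 := hK.a_sub_a_mem h2 h0 h1 (i := 0) (j := 1) (k := 2) (by decide) (by decide)
        (by decide) (by decide) (α := y none) (β := y (some 2))
        (by convert hy using 1; module) h
      obtain ⟨h20, hq⟩ := hK.a_sub_a_mem' h2 h0 h1 (i := 0) (j := 1) (k := 2) (by decide)
        (by decide) (by decide) (by decide) h01
      refine ⟨?_, h20, hq⟩
      convert K.neg_mem h01 using 1
      module
  intro x hx
  rw [LinearMap.mem_ker, augment_apply] at hx
  have hx' : x = x none • (q η - (η + 1) • a η 0) + (x (some 1) • (a η 1 - a η 0)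
      + x (some 2) • (a η 2 - a η 0)) := by
    refine (eq_sum_basis x).trans ?_
    have h := congrArg (fun c => c • a η 0) hx
    linear_combination (norm := module) h
  rw [hx']
  exact K.add_mem (K.smul_mem _ key.2.2)
    (K.add_mem (K.smul_mem _ key.1) (K.smul_mem _ key.2.1))

/-- The kernel of a linear form has codimension at most one. -/
theorem eq_ker_augment_or_eq_top (h : LinearMap.ker (augment η) ≤ K) :
    K = LinearMap.ker (augment η) ∨ K = ⊤ := by
  by_cases hK : K ≤ LinearMap.ker (augment η)
  · exact Or.inl (le_antisymm hK h)
  · obtain ⟨y, hyK, hy⟩ := Set.not_subset.1 hK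
    refine Or.inr (eq_top_iff.2 fun x _ => ?_)
    have hy' : augment η y ≠ 0 := hy
    have : x - (augment η x / augment η y) • y ∈ K := h (by
      rw [LinearMap.mem_ker, map_sub, map_smul, smul_eq_mul, div_mul_cancel₀ _ hy', sub_self])
    convert K.add_mem this (K.smul_mem (augment η x / augment η y) hyK) using 1
    module

/-- The ideals of `3Ĉ(η)`. -/
theorem IsIdeal.classification (hK : IsIdeal K) (h2 : (2 : F) ≠ 0) (h0 : η ≠ 0) (h1 : η ≠ 1) :
    K = ⊥ ∨ K = Submodule.span F {r η} ∨ K = LinearMap.ker (augment η) ∨ K = ⊤ ∨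
      (η = -1 ∧ (K = Submodule.span F {q η} ∨ K = Submodule.span F {r η, q η})) := by
  by_cases hne : ∃ y ∈ K, ¬(y (some 0) = y (some 1) ∧ y (some 1) = y (some 2))
  · obtain ⟨y, hy, hne⟩ := hne
    rcases eq_ker_augment_or_eq_top (hK.ker_augment_le h2 h0 h1 hy hne) with h | h
    · exact Or.inr (Or.inr (Or.inl h))
    · exact Or.inr (Or.inr (Or.inr (Or.inl h)))
  push Not at hne
  -- In the remaining case all elements of `K` have three equal coordinates, so `K` lies in the
  -- plane spanned by `r` and `q̂`.
  have hdec : ∀ y ∈ K, y = (y (some 0) + y none) • q η - y (some 0) • r η := by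
    intro y hy
    refine (eq_sum_basis y).trans ?_
    rw [← (hne y hy).2, ← (hne y hy).1]
    simp only [r, zmod_three_neg_one]
    module
  -- The product `â₀y` lies in `K` and so has equal coordinates as well. This kills its `â₀`-term,
  -- and a multiple of `r` is left. Hence the `r`- and `q̂`-components of `y` lie in `K` separately.
  have hmul : ∀ y ∈ K, (η + 1) * (y none + y (some 0)) = 0 ∧ y (some 0) • r η ∈ K := by
    intro y hy
    have hz := hK (a η 0) y hy
    have hz' : a η 0 * y = ((η + 1) * (y none + y (some 0))) • a η 0 - y (some 0) • r η := by
      nth_rw 1 [eq_sum_basis y]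
      rw [← (hne y hy).2, ← (hne y hy).1]
      simp only [mul_add, mul_smul_comm, mul_comm (a η 0) (q η), q_mul_a, a_mul_self, r,
        zmod_three_neg_one, a_mul_a (show (0 : ZMod 3) ≠ 1 by decide) (show 2 = -0 - 1 by decide),
        a_mul_a (show (0 : ZMod 3) ≠ 2 by decide) (show 1 = -0 - 2 by decide)]
      match_scalars <;> field_simp <;> ring
    have h01 := (hne _ hz).1
    have hc : (η + 1) * (y none + y (some 0)) = 0 := by
      rw [hz'] at h01
      simpa [r, smul_apply, sub_apply, add_apply, q_apply_some, a_apply_some, zmod_three_neg_one,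
        show (0 : ZMod 3) ≠ 2 by decide, show (1 : ZMod 3) ≠ 2 by decide] using h01
    refine ⟨hc, ?_⟩
    rw [hz', hc, zero_smul, zero_sub] at hz
    simpa using K.neg_mem hz
  have hmul' : ∀ y ∈ K, (y (some 0) + y none) • q η ∈ K := by
    intro y hy
    convert K.add_mem hy (hmul y hy).2 using 1
    nth_rw 3 [hdec y hy]
    module
  have hle : ∀ {v : HatThreeC η}, v ∈ K → Submodule.span F {v} ≤ K := fun hv =>
    (Submodule.span_singleton_le_iff_mem _ _).2 hv
  have hr : r η ∉ K → ∀ y ∈ K, y (some 0) = 0 := fun h y hy => by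
    by_contra hy0
    exact h ((K.smul_mem_iff hy0).1 (hmul y hy).2)
  have hq : q η ∉ K → ∀ y ∈ K, y (some 0) + y none = 0 := fun h y hy => by
    by_contra hy0
    exact h ((K.smul_mem_iff hy0).1 (hmul' y hy))
  by_cases hqK : q η ∈ K
  · have hη : η = -1 := by
      have := (hmul _ hqK).1
      rw [q_apply_none, q_apply_some, add_zero, mul_one] at this
      exact eq_neg_of_add_eq_zero_left this
    refine Or.inr (Or.inr (Or.inr (Or.inr ⟨hη, ?_⟩)))
    by_cases hrK : r η ∈ K
    · refine Or.inr (le_antisymm (fun y hy => ?_) ?_)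
      · rw [hdec y hy]
        exact Submodule.sub_mem _
          (Submodule.smul_mem _ _ (Submodule.subset_span (Or.inr rfl)))
          (Submodule.smul_mem _ _ (Submodule.subset_span (Or.inl rfl)))
      · rw [Submodule.span_le]
        rintro y (rfl | rfl)
        · exact hrK
        · exact hqK
    · refine Or.inl (le_antisymm (fun y hy => ?_) (hle hqK))
      rw [hdec y hy, hr hrK y hy, zero_smul, sub_zero]
      exact Submodule.smul_mem _ _ (Submodule.mem_span_singleton_self _)
  · by_cases hrK : r η ∈ K
    · refine Or.inr (Or.inl (le_antisymm (fun y hy => ?_) (hle hrK)))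
      rw [hdec y hy, hq hqK y hy, zero_smul, zero_sub]
      exact Submodule.neg_mem _ (Submodule.smul_mem _ _ (Submodule.mem_span_singleton_self _))
    · refine Or.inl (eq_bot_iff.2 fun y hy => ?_)
      rw [hdec y hy, hq hqK y hy, hr hrK y hy, zero_smul, zero_smul, sub_zero]
      exact Submodule.zero_mem _

end HatThreeC

/-! ### The listed ideals of `4̂(η)` as products, and kernels as products -/

section SpansOfIdeals

variable {F : Type u} [Field F] {η : F}

theorem HatThreeC.span_a_eq_top : Submodule.span F {a η 0, a η 1, a η (-1), q η - (η + 1) • a η 0}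
    = ⊤ := by
  refine eq_top_iff.2 fun x _ => ?_
  have hx : x = x none • (q η - (η + 1) • a η 0) + ((x (some 0) + (η + 1) * x none) • a η 0
      + x (some 1) • a η 1 + x (some 2) • a η (-1)) := by
    refine (eq_sum_basis x).trans ?_
    rw [zmod_three_neg_one]
    module
  rw [hx]
  refine Submodule.add_mem _ (Submodule.smul_mem _ _ (Submodule.subset_span ?_))
    (Submodule.add_mem _ (Submodule.add_mem _ (Submodule.smul_mem _ _ (Submodule.subset_span ?_))
      (Submodule.smul_mem _ _ (Submodule.subset_span ?_)))
      (Submodule.smul_mem _ _ (Submodule.subset_span ?_))) <;>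
  simp only [Set.mem_insert_iff, Set.mem_singleton_iff, true_or, or_true]

theorem HatThreeC.span_sub_eq_ker_augment :
    Submodule.span F {a η 0 - a η (-1), a η 1 - a η 0, q η - (η + 1) • a η 0}
      = LinearMap.ker (augment η) := by
  refine le_antisymm ?_ fun x hx => ?_
  · rw [Submodule.span_le]
    rintro x (rfl | rfl | rfl) <;>
    simp [augment_apply, smul_apply, sub_apply, q_apply_none, q_apply_some, a_apply_none,
      a_apply_some, zmod_three_neg_one, show (0 : ZMod 3) ≠ 2 by decide,
      show (1 : ZMod 3) ≠ 2 by decide, show (2 : ZMod 3) ≠ 0 by decide,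
      show (2 : ZMod 3) ≠ 1 by decide]
  · rw [LinearMap.mem_ker, augment_apply] at hx
    have h := congrArg (fun c => c • a η 0) hx
    have hx' : x = x none • (q η - (η + 1) • a η 0) + (x (some 1) • (a η 1 - a η 0)
        + (-x (some 2)) • (a η 0 - a η (-1))) := by
      refine (eq_sum_basis x).trans ?_
      rw [zmod_three_neg_one]
      linear_combination (norm := module) h
    rw [hx']
    refine Submodule.add_mem _ (Submodule.smul_mem _ _ (Submodule.subset_span ?_))
      (Submodule.add_mem _ (Submodule.smul_mem _ _ (Submodule.subset_span ?_))
        (Submodule.smul_mem _ _ (Submodule.subset_span ?_))) <;>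
    simp only [Set.mem_insert_iff, Set.mem_singleton_iff, true_or, or_true]

theorem HatThreeC.span_sum_q :
    Submodule.span F {a η (-1) + a η 1 + a η 0, q η} = Submodule.span F {r η, q η} := by
  refine le_antisymm (Submodule.span_le.2 ?_) (Submodule.span_le.2 ?_)
  · rintro x (rfl | rfl)
    · have : a η (-1) + a η 1 + a η 0 = q η - r η := by rw [r]; module
      rw [this]
      exact Submodule.sub_mem _ (Submodule.subset_span (Or.inr rfl))
        (Submodule.subset_span (Or.inl rfl))
    · exact Submodule.subset_span (Or.inr rfl)
  · rintro x (rfl | rfl)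
    · exact Submodule.sub_mem _ (Submodule.subset_span (Or.inr rfl))
        (Submodule.subset_span (Or.inl rfl))
    · exact Submodule.subset_span (Or.inr rfl)

theorem HatThreeC.mem_span_r_q {x : HatThreeC η} : x ∈ Submodule.span F {r η, q η} ↔
    x (some 0) = x (some 1) ∧ x (some 1) = x (some 2) := by
  rw [Submodule.mem_span_pair]
  constructor
  · rintro ⟨b, c, rfl⟩
    simp [r, smul_apply, sub_apply, add_apply, q_apply_some,
      a_apply_some, zmod_three_neg_one, show (0 : ZMod 3) ≠ 2 by decide,
      show (1 : ZMod 3) ≠ 2 by decide, show (2 : ZMod 3) ≠ 0 by decide,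
      show (2 : ZMod 3) ≠ 1 by decide]
  · rintro ⟨h, h'⟩
    refine ⟨-x (some 0), x none + x (some 0), Eq.trans ?_ (eq_sum_basis x).symm⟩
    rw [← h', ← h]
    simp only [r, zmod_three_neg_one]
    module

theorem HatThreeC.mem_span_q {x : HatThreeC η} : x ∈ Submodule.span F {q η} ↔
    ∀ i, x (some i) = 0 := by
  rw [Submodule.mem_span_singleton]
  constructor
  · rintro ⟨c, rfl⟩ i
    simp [smul_apply, q_apply_some]
  · intro h
    refine ⟨x none, Eq.trans ?_ (eq_sum_basis x).symm⟩
    rw [h, h, h]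
    module

namespace HatFour

theorem span_image_inl (L : Set (HatThreeC η)) :
    Submodule.span F ((fun y => (y, 0)) '' L : Set (HatFour η))
      = (Submodule.span F L).prod (Submodule.prod ⊥ ⊥) := by
  rw [Submodule.prod_bot, ← Submodule.map_inl, Submodule.map_span]
  rfl

theorem span_insert_s₀ {L : Set (HatFour η)} {K : Submodule F (HatThreeC η)} {B : Submodule F F}
    (h : Submodule.span F L = K.prod (Submodule.prod ⊥ B)) :
    Submodule.span F (insert (s₀ η) L) = K.prod (Submodule.prod ⊤ B) := by
  ext x
  rw [Submodule.mem_span_insert', h]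
  simp only [Submodule.mem_prod, Submodule.mem_bot, Submodule.mem_top, true_and]
  constructor
  · rintro ⟨c, h1, -, h2⟩
    exact ⟨by simpa [s₀] using h1, by simpa [s₀] using h2⟩
  · rintro ⟨h1, h2⟩
    exact ⟨-x.2.1, by simpa [s₀] using h1, by simp [s₀], by simpa [s₀] using h2⟩

theorem span_insert_s₁ {L : Set (HatFour η)} {K : Submodule F (HatThreeC η)} {A : Submodule F F}
    (h : Submodule.span F L = K.prod (Submodule.prod A ⊥)) :
    Submodule.span F (insert (s₁ η) L) = K.prod (Submodule.prod A ⊤) := by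
  ext x
  rw [Submodule.mem_span_insert', h]
  simp only [Submodule.mem_prod, Submodule.mem_bot, Submodule.mem_top, and_true]
  constructor
  · rintro ⟨c, h1, h2, -⟩
    exact ⟨by simpa [s₁] using h1, by simpa [s₁] using h2⟩
  · rintro ⟨h1, h2⟩
    exact ⟨-x.2.2, by simpa [s₁] using h1, by simpa [s₁] using h2, by simp [s₁]⟩

theorem span_a : Submodule.span F {a η 0, a η 1, a η (-1), q η - (η + 1) • a η 0}
    = Submodule.prod ⊤ (Submodule.prod ⊥ ⊥) := by
  rw [← HatThreeC.span_a_eq_top, ← span_image_inl]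
  congr 1
  simp only [Set.image_insert_eq, Set.image_singleton, a, q, Prod.smul_mk, Prod.mk_sub_mk,
    smul_zero, sub_zero]

theorem span_sub : Submodule.span F {a η 0 - a η (-1), a η 1 - a η 0, q η - (η + 1) • a η 0}
    = (LinearMap.ker (HatThreeC.augment η)).prod (Submodule.prod ⊥ ⊥) := by
  rw [← HatThreeC.span_sub_eq_ker_augment, ← span_image_inl]
  congr 1
  simp only [Set.image_insert_eq, Set.image_singleton, a, q, Prod.smul_mk, Prod.mk_sub_mk,
    smul_zero, sub_zero]

theorem span_r : Submodule.span F {q η - (a η (-1) + a η 1 + a η 0)}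
    = (Submodule.span F {HatThreeC.r η}).prod (Submodule.prod ⊥ ⊥) := by
  rw [← span_image_inl]
  congr 1
  simp only [Set.image_singleton, a, q, Prod.mk_sub_mk, Prod.mk_add_mk,
    add_zero, sub_zero, HatThreeC.r]

theorem span_q : Submodule.span F {q η}
    = (Submodule.span F {HatThreeC.q η}).prod (Submodule.prod ⊥ ⊥) := by
  rw [← span_image_inl]
  congr 1
  simp only [Set.image_singleton, q]

theorem span_sum_q : Submodule.span F {a η (-1) + a η 1 + a η 0, q η}
    = (Submodule.span F {HatThreeC.r η, HatThreeC.q η}).prod (Submodule.prod ⊥ ⊥) := by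
  rw [← HatThreeC.span_sum_q, ← span_image_inl]
  congr 1
  simp only [Set.image_insert_eq, Set.image_singleton, a, q, Prod.mk_add_mk, add_zero]

/-- The kernel of a homomorphism from `4̂(η)` is a product of ideals of the summands. -/
theorem exists_ker_eq_prod {M : Type v} [NonUnitalNonAssocCommRing M] [Module F M]
    (π : HatFour η →ₙₐ[F] M) : ∃ (K : Submodule F (HatThreeC η)) (A B : Submodule F F),
      HatThreeC.IsIdeal K ∧ ∀ x, π x = 0 ↔ x ∈ K.prod (A.prod B) := by
  let R : Submodule F (HatFour η) := LinearMap.ker (π : HatFour η →ₗ[F] M)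
  have hR : ∀ x, x ∈ R ↔ π x = 0 := fun x => Iff.rfl
  have hmul : ∀ x, ∀ y ∈ R, x * y ∈ R := fun x y hy => by
    rw [hR] at hy ⊢
    rw [map_mul, hy, mul_zero]
  refine ⟨R.comap (LinearMap.inl F (HatThreeC η) (F × F)),
    R.comap ((LinearMap.inr F (HatThreeC η) (F × F)).comp (LinearMap.inl F F F)),
    R.comap ((LinearMap.inr F (HatThreeC η) (F × F)).comp (LinearMap.inr F F F)), ?_, ?_⟩
  · intro x y hy
    have := hmul (x, 0) _ hy
    rw [Submodule.mem_comap]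
    convert this using 1
    exact Prod.ext rfl (mul_zero _).symm
  · intro x
    rw [← hR]
    have hsum : x = ((x.1, 0) : HatFour η) + ((0, (x.2.1, 0)) + (0, (0, x.2.2))) := by
      obtain ⟨y, s, t⟩ := x
      simp
    constructor
    -- Multiplication by `s₀` and by `s₁` projects to the two coordinates of `2A`, so an ideal
    -- contains these components of each of its elements.
    · intro hx
      have h0 : ((0, (x.2.1, 0)) : HatFour η) ∈ R := by
        convert hmul (s₀ η) x hx using 1
        exact Prod.ext (zero_mul x.1).symm (Prod.ext (one_mul x.2.1).symm (zero_mul x.2.2).symm)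
      have h1 : ((0, (0, x.2.2)) : HatFour η) ∈ R := by
        convert hmul (s₁ η) x hx using 1
        exact Prod.ext (zero_mul x.1).symm (Prod.ext (zero_mul x.2.1).symm (one_mul x.2.2).symm)
      refine ⟨?_, h0, h1⟩
      change ((x.1, 0) : HatFour η) ∈ R
      rw [eq_sub_of_add_eq hsum.symm]
      exact R.sub_mem hx (R.add_mem h0 h1)
    · rintro ⟨h, h0, h1⟩
      rw [hsum]
      exact R.add_mem h (R.add_mem h0 h1)

end HatFour

end SpansOfIdeals

/-! ### Quotient maps onto the explicit algebras, and the exchange of `â₀` and `â₁` -/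

section Isomorphisms

variable {F : Type u} [Field F]

/-- Both targets are the quotient of `H` by the common kernel; the isomorphism is `ρ` after an
arbitrary section of `π`, and equality of the kernels makes the choice irrelevant. -/
theorem axialIso_of_ker_eq {H : Type u} {M : Type v} {N : Type w} [NonUnitalNonAssocCommRing H]
    [Module F H] [NonUnitalNonAssocCommRing M] [Module F M] [NonUnitalNonAssocCommRing N]
    [Module F N] {π : H →ₙₐ[F] M} (hπ : Function.Surjective π) {ρ : H →ₙₐ[F] N}
    (hρ : Function.Surjective ρ) (h : ∀ x, π x = 0 ↔ ρ x = 0) (A : Set H) :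
    AxialIso F (π '' A) (ρ '' A) := by
  have hker : ∀ x y, π x = π y ↔ ρ x = ρ y := fun x y => by
    rw [← sub_eq_zero, ← map_sub, h, map_sub, sub_eq_zero]
  choose σ hσ using hπ
  have hφ : ∀ x, ρ (σ (π x)) = ρ x := fun x => (hker _ _).1 (hσ _)
  let φ : M →ₙₐ[F] N :=
    { toFun := fun m => ρ (σ m)
      map_smul' := fun c m => by
        rw [← hσ m, ← map_smul π, hφ, hφ, map_smul]; rfl
      map_zero' := by rw [← map_zero π, hφ, map_zero]
      map_add' := fun m n => by
        rw [← hσ m, ← hσ n, ← map_add π, hφ, hφ, hφ, map_add]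
      map_mul' := fun m n => by
        rw [← hσ m, ← hσ n, ← map_mul π, hφ, hφ, hφ, map_mul] }
  refine ⟨φ, ⟨fun m n hmn => ?_, fun n => ?_⟩, ?_⟩
  · rw [← hσ m, ← hσ n]
    exact (hker _ _).2 hmn
  · obtain ⟨x, rfl⟩ := hρ n
    exact ⟨π x, hφ x⟩
  · rw [Set.image_image]
    exact Set.image_congr fun x _ => hφ x

/-- The product of two homomorphisms. -/
def prodMapHom {A B C D : Type u} [NonUnitalNonAssocCommRing A] [NonUnitalNonAssocCommRing B]
    [NonUnitalNonAssocCommRing C] [NonUnitalNonAssocCommRing D] [Module F A] [Module F B]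
    [Module F C] [Module F D] (f : A →ₙₐ[F] C) (g : B →ₙₐ[F] D) : A × B →ₙₐ[F] C × D where
  toFun x := (f x.1, g x.2)
  map_smul' c x := Prod.ext (map_smul f c x.1) (map_smul g c x.2)
  map_zero' := Prod.ext (map_zero f) (map_zero g)
  map_add' x y := Prod.ext (map_add f x.1 y.1) (map_add g x.2 y.2)
  map_mul' x y := Prod.ext (map_mul f x.1 y.1) (map_mul g x.2 y.2)

/-- The projection of a direct sum to the first summand. -/
def fstHom (A B : Type u) [NonUnitalNonAssocCommRing A] [NonUnitalNonAssocCommRing B]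
    [Module F A] [Module F B] : A × B →ₙₐ[F] A where
  toFun x := x.1
  map_smul' _ _ := rfl
  map_zero' := rfl
  map_add' _ _ := rfl
  map_mul' _ _ := rfl

/-- The projection of a direct sum to the second summand. -/
def sndHom (A B : Type u) [NonUnitalNonAssocCommRing A] [NonUnitalNonAssocCommRing B]
    [Module F A] [Module F B] : A × B →ₙₐ[F] B where
  toFun x := x.2
  map_smul' _ _ := rfl
  map_zero' := rfl
  map_add' _ _ := rfl
  map_mul' _ _ := rfl

/-- The projection to a quotient algebra. -/
def AlgIdeal.projHom {A : Type u} [NonUnitalNonAssocCommRing A] [Module F A] (I : AlgIdeal F A) :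
    A →ₙₐ[F] I.Quot where
  toFun := I.proj
  map_smul' := I.proj_smul
  map_zero' := I.proj_zero
  map_add' := I.proj_add
  map_mul' := I.proj_mul

theorem AlgIdeal.projHom_eq_zero_iff {A : Type u} [NonUnitalNonAssocCommRing A] [Module F A]
    (I : AlgIdeal F A) (x : A) : I.projHom x = 0 ↔ x ∈ I.carrier := by
  change I.proj x = I.proj 0 ↔ _
  rw [I.proj_eq_iff, sub_zero]

variable {η : F}

/-- The automorphism of `3Ĉ(η)` that interchanges `â₀` and `â₁`. -/
def HatThreeC.swap (η : F) : HatThreeC η →ₙₐ[F] HatThreeC η :=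
  (hatThreeCTable η).lift (fun i => Option.casesOn i (q η) fun i => a η (1 - i)) (by
    refine hatThreeC_lift_condition q_mul_q (fun i => q_mul_a (1 - i))
      (fun i => a_mul_self (1 - i)) ?_ ?_ ?_
    · exact a_mul_a (i := 1) (j := 0) (k := 2) (by decide) (by decide)
    · exact a_mul_a (i := 1) (j := 2) (k := 0) (by decide) (by decide)
    · exact a_mul_a (i := 0) (j := 2) (k := 1) (by decide) (by decide))

theorem HatThreeC.swap_apply (x : HatThreeC η) : HatThreeC.swap η x
    = x none • q η + (x (some 1) • a η 0 + x (some 0) • a η 1 + x (some 2) • a η 2) := by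
  rw [swap, MulTable.lift_apply, Fintype.sum_option, zmod_three_sum,
    add_comm (x (some 1) • a η 0)]
  rfl

theorem HatThreeC.swap_swap (x : HatThreeC η) :
    HatThreeC.swap η (HatThreeC.swap η x) = x := by
  rw [ext_iff']
  simp [swap_apply, smul_apply, add_apply, q_apply_none, q_apply_some, a_apply_none,
      a_apply_some, show (0 : ZMod 3) ≠ 2 by decide,
      show (1 : ZMod 3) ≠ 2 by decide, show (2 : ZMod 3) ≠ 0 by decide,
      show (2 : ZMod 3) ≠ 1 by decide]

theorem ThreeC.basis_mul_basis (i j : ZMod 3) :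
    a η i * a η j = (threeCTable η).prod i j := by
  change (∑ k, ∑ l, ((Pi.single i 1 : ZMod 3 → F) k
    * (Pi.single j 1 : ZMod 3 → F) l) • (threeCTable η).prod k l) = _
  rw [Finset.sum_eq_single i, Finset.sum_eq_single j]
  · simp
  · intro l _ hl
    rw [Pi.single_eq_of_ne hl, mul_zero, zero_smul]
  · simp
  · intro k _ hk
    refine Finset.sum_eq_zero fun l _ => ?_
    rw [Pi.single_eq_of_ne hk, zero_mul, zero_smul]
  · simp

theorem ThreeC.a_mul_self (i : ZMod 3) : a η i * a η i = a η i :=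
  (basis_mul_basis i i).trans (if_pos rfl)

theorem ThreeC.a_mul_a {i j k : ZMod 3} (hij : i ≠ j) (hk : k = -i - j) :
    a η i * a η j = (η / 2) • (a η i + a η j - a η k) := by
  subst hk
  exact (basis_mul_basis i j).trans (if_neg hij)

theorem ThreeC.eq_sum_basis (x : ThreeC η) :
    x = x 0 • a η 0 + x 1 • a η 1 + x 2 • a η 2 := by
  funext i
  change x i = x 0 * (Pi.single 0 1 : ZMod 3 → F) i + x 1 * (Pi.single 1 1 : ZMod 3 → F) i
      + x 2 * (Pi.single 2 1 : ZMod 3 → F) i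
  rcases zmod_three_cases i with rfl | rfl | rfl <;> simp [
      show (0 : ZMod 3) ≠ 1 by decide, show (0 : ZMod 3) ≠ 2 by decide,
      show (1 : ZMod 3) ≠ 0 by decide, show (1 : ZMod 3) ≠ 2 by decide,
      show (2 : ZMod 3) ≠ 0 by decide, show (2 : ZMod 3) ≠ 1 by decide]

theorem ThreeC.a_apply (i j : ZMod 3) : a η i j = if j = i then 1 else 0 := by
  change (Pi.single i 1 : ZMod 3 → F) j = _
  rw [Pi.single_apply]

/-- The homomorphism from `3Ĉ(η)` onto `3C(η)`. -/
def HatThreeC.toThreeC (h2 : (2 : F) ≠ 0) (η : F) : HatThreeC η →ₙₐ[F] ThreeC η :=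
  (hatThreeCTable η).lift (fun i => Option.casesOn i (ThreeC.a η 0 + ThreeC.a η 1 + ThreeC.a η 2)
      fun i => ThreeC.a η i) (by
    have h01 : ThreeC.a η 0 * ThreeC.a η 1 = _ := ThreeC.a_mul_a (k := 2) (by decide) (by decide)
    have h02 : ThreeC.a η 0 * ThreeC.a η 2 = _ := ThreeC.a_mul_a (k := 1) (by decide) (by decide)
    have h12 : ThreeC.a η 1 * ThreeC.a η 2 = _ := ThreeC.a_mul_a (k := 0) (by decide) (by decide)
    have h : ∀ i, (ThreeC.a η 0 + ThreeC.a η 1 + ThreeC.a η 2) * ThreeC.a η i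
        = (η + 1) • ThreeC.a η i := by
      intro i
      rcases zmod_three_cases i with rfl | rfl | rfl
      all_goals
        simp only [add_mul, ThreeC.a_mul_self, h01, h02, h12,
          mul_comm (ThreeC.a η 1) (ThreeC.a η 0), mul_comm (ThreeC.a η 2) (ThreeC.a η 0),
          mul_comm (ThreeC.a η 2) (ThreeC.a η 1)]
        match_scalars <;> field_simp <;> ring
    refine hatThreeC_lift_condition ?_ h ThreeC.a_mul_self ?_ ?_ ?_
    · dsimp only
      rw [mul_add, mul_add, h, h, h, smul_add, smul_add]
    all_goals
      dsimp only
      simp only [h01, h02, h12]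
      match_scalars <;> field_simp <;> ring)

theorem HatThreeC.toThreeC_apply (h2 : (2 : F) ≠ 0) (x : HatThreeC η) :
    HatThreeC.toThreeC h2 η x = (x none + x (some 0)) • ThreeC.a η 0
      + (x none + x (some 1)) • ThreeC.a η 1 + (x none + x (some 2)) • ThreeC.a η 2 := by
  rw [toThreeC, MulTable.lift_apply, Fintype.sum_option, zmod_three_sum]
  change x none • (ThreeC.a η 0 + ThreeC.a η 1 + ThreeC.a η 2) + (x (some 0) • ThreeC.a η 0
    + x (some 1) • ThreeC.a η 1 + x (some 2) • ThreeC.a η 2) = _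
  module

/-- The homomorphism from `3Ĉ(η)` onto `1A`. -/
def HatThreeC.augmentHom (h2 : (2 : F) ≠ 0) (η : F) : HatThreeC η →ₙₐ[F] F :=
  (hatThreeCTable η).lift (fun i => Option.casesOn i (η + 1) fun _ => 1) (by
    refine hatThreeC_lift_condition rfl (fun _ => rfl) (fun _ => mul_one 1) ?_ ?_ ?_ <;>
    · simp only [smul_eq_mul]
      field_simp
      ring)

theorem HatThreeC.augmentHom_apply (h2 : (2 : F) ≠ 0) (x : HatThreeC η) :
    HatThreeC.augmentHom h2 η x = augment η x := by
  rw [augmentHom, MulTable.lift_apply, Fintype.sum_option, zmod_three_sum, augment_apply]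
  simp only [smul_eq_mul, mul_one]
  ring

end Isomorphisms

/-! ### Identifying the quotient from the shape of the kernel -/

section Recognition

variable {F : Type u} [Field F] {η : F} {M : Type v} [NonUnitalNonAssocCommRing M] [Module F M]

theorem HatFour.map_axis {X B : Type u} [NonUnitalNonAssocCommRing X] [Module F X]
    [NonUnitalNonAssocCommRing B] [Module F B] (g : HatThreeC η →ₙₐ[F] X) (β : F × F →ₙₐ[F] B) :
    prodMapHom g β '' {axis₀ η, axis₁ η}
      = {(g (HatThreeC.a η 0), β (1, 0)), (g (HatThreeC.a η 1), β (0, 1))} := by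
  rw [Set.image_pair]
  congr 1
  · change (g (HatThreeC.a η 0 + 0), β (0 + (1, 0))) = _
    rw [add_zero, zero_add]
  · change {(g (HatThreeC.a η 1 + 0), β (0 + (0, 1)))} = _
    rw [add_zero, zero_add]

theorem HatThreeC.swap_a_zero : HatThreeC.swap η (a η 0) = a η 1 := by
  rw [swap_apply, a_apply_none, a_apply_some, a_apply_some, a_apply_some, if_pos rfl,
    if_neg (by decide), if_neg (by decide)]
  module

theorem HatThreeC.swap_a_one : HatThreeC.swap η (a η 1) = a η 0 := by
  rw [← swap_a_zero, swap_swap]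

variable {π : HatFour η →ₙₐ[F] M} {K : Submodule F (HatThreeC η)}
  {X N : Type u} [NonUnitalNonAssocCommRing X] [Module F X] [NonUnitalNonAssocCommRing N]
  [Module F N] {g : HatThreeC η →ₙₐ[F] X} {Z : Submodule F X}

/-- The target is reached in two stages: `g` maps `3Ĉ(η)` onto `X`, and `p` divides out `Z`. For the
generic algebras `Z` is zero and `p` the identity; for the six special ones `Z` is the line that is
divided out. -/
theorem axialIso_of_ker_prod_bot_bot (hπ : Function.Surjective π)
    (hg : Function.Surjective g) (hZ : ∀ y, g y ∈ Z ↔ y ∈ K)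
    {p : X × (F × F) →ₙₐ[F] N} (hp : Function.Surjective p)
    (hpZ : ∀ w, p w = 0 ↔ w.1 ∈ Z ∧ w.2 = 0)
    (hker : ∀ x, π x = 0 ↔ x ∈ K.prod (Submodule.prod ⊥ ⊥)) :
    AxialIso F {π (HatFour.axis₀ η), π (HatFour.axis₁ η)}
      (p '' {(g (HatThreeC.a η 0), (1, 0)), (g (HatThreeC.a η 1), (0, 1))}) := by
  have h := axialIso_of_ker_eq hπ (ρ := p.comp (prodMapHom g (NonUnitalAlgHom.id F (F × F))))
    (hp.comp (hg.prodMap Function.surjective_id)) (fun x => by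
      rw [hker]
      refine Iff.trans ?_ (hpZ (g x.1, x.2)).symm
      rw [hZ, Prod.ext_iff]
      rfl) {HatFour.axis₀ η, HatFour.axis₁ η}
  rw [Set.image_pair, NonUnitalAlgHom.coe_comp, Set.image_comp, HatFour.map_axis] at h
  exact h

theorem axialIso_of_ker_prod_top_bot (hπ : Function.Surjective π)
    (hg : Function.Surjective g) (hZ : ∀ y, g y ∈ Z ↔ y ∈ K)
    {p : X × F →ₙₐ[F] N} (hp : Function.Surjective p)
    (hpZ : ∀ w, p w = 0 ↔ w.1 ∈ Z ∧ w.2 = 0)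
    (hker : ∀ x, π x = 0 ↔ x ∈ K.prod (Submodule.prod ⊤ ⊥)) :
    AxialIso F {π (HatFour.axis₀ η), π (HatFour.axis₁ η)}
      (p '' {(g (HatThreeC.a η 0), 0), (g (HatThreeC.a η 1), 1)}) := by
  have h := axialIso_of_ker_eq hπ (ρ := p.comp (prodMapHom g (sndHom F F)))
    (hp.comp (hg.prodMap Prod.snd_surjective)) (fun x => by
      rw [hker]
      refine Iff.trans ?_ (hpZ (g x.1, x.2.2)).symm
      rw [hZ]
      exact and_congr_right fun _ => and_iff_right trivial) {HatFour.axis₀ η, HatFour.axis₁ η}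
  rw [Set.image_pair, NonUnitalAlgHom.coe_comp, Set.image_comp, HatFour.map_axis] at h
  exact h

/-- If `s₁` is divided out, the summand `1A` is attached to the first axis, whereas the listed
algebra has it at the second. Composition with `swap` corrects this, at the cost of exchanging the
two generating axes, and requires `K` to be invariant. -/
theorem axialIso_of_ker_prod_bot_top (hπ : Function.Surjective π)
    (hg : Function.Surjective g) (hZ : ∀ y, g y ∈ Z ↔ y ∈ K)
    (hK : ∀ y, HatThreeC.swap η y ∈ K ↔ y ∈ K)
    {p : X × F →ₙₐ[F] N} (hp : Function.Surjective p)
    (hpZ : ∀ w, p w = 0 ↔ w.1 ∈ Z ∧ w.2 = 0)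
    (hker : ∀ x, π x = 0 ↔ x ∈ K.prod (Submodule.prod ⊥ ⊤)) :
    AxialIso F {π (HatFour.axis₀ η), π (HatFour.axis₁ η)}
      (p '' {(g (HatThreeC.a η 0), 0), (g (HatThreeC.a η 1), 1)}) := by
  have h := axialIso_of_ker_eq hπ
    (ρ := p.comp (prodMapHom (g.comp (HatThreeC.swap η)) (fstHom F F)))
    (hp.comp ((hg.comp (Function.RightInverse.surjective HatThreeC.swap_swap)).prodMap Prod.fst_surjective))
    (fun x => by
      rw [hker]
      refine Iff.trans ?_ (hpZ (g (HatThreeC.swap η x.1), x.2.1)).symm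
      rw [hZ, hK]
      exact and_congr_right fun _ => and_iff_left trivial) {HatFour.axis₀ η, HatFour.axis₁ η}
  rw [Set.image_pair, NonUnitalAlgHom.coe_comp, Set.image_comp, HatFour.map_axis,
    NonUnitalAlgHom.comp_apply, NonUnitalAlgHom.comp_apply, HatThreeC.swap_a_zero,
    HatThreeC.swap_a_one, Set.pair_comm (g (HatThreeC.a η 1), _)] at h
  exact h

theorem axialIso_of_ker_prod_top_top (hπ : Function.Surjective π)
    (hg : Function.Surjective g) (hZ : ∀ y, g y ∈ Z ↔ y ∈ K)
    {p : X →ₙₐ[F] N} (hp : Function.Surjective p)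
    (hpZ : ∀ w, p w = 0 ↔ w ∈ Z)
    (hker : ∀ x, π x = 0 ↔ x ∈ K.prod (Submodule.prod ⊤ ⊤)) :
    AxialIso F {π (HatFour.axis₀ η), π (HatFour.axis₁ η)}
      (p '' {g (HatThreeC.a η 0), g (HatThreeC.a η 1)}) := by
  have h := axialIso_of_ker_eq hπ (ρ := p.comp (g.comp (fstHom (HatThreeC η) (F × F))))
    (hp.comp (hg.comp Prod.fst_surjective)) (fun x => by
      rw [hker]
      refine Iff.trans ?_ (hpZ (g x.1)).symm
      rw [hZ]
      exact and_iff_left ⟨trivial, trivial⟩) {HatFour.axis₀ η, HatFour.axis₁ η}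
  rw [Set.image_pair, NonUnitalAlgHom.coe_comp, Set.image_comp, NonUnitalAlgHom.coe_comp,
    Set.image_comp, Set.image_pair, Set.image_pair] at h
  change AxialIso F {π (HatFour.axis₀ η), π (HatFour.axis₁ η)} (p '' {g (HatThreeC.a η 0 + 0), g (HatThreeC.a η 1 + 0)}) at h
  rwa [add_zero, add_zero] at h

end Recognition

/-! ### Matching the kernels with the listed algebras -/

section Conclusion

variable {F : Type u} [Field F] {η : F}

namespace HatThreeC

theorem toThreeC_apply_apply (h2 : (2 : F) ≠ 0) (x : HatThreeC η) (i : ZMod 3) :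
    toThreeC h2 η x i = x none + x (some i) := by
  rw [toThreeC_apply]
  change (x none + x (some 0)) * ThreeC.a η 0 i + (x none + x (some 1)) * ThreeC.a η 1 i
    + (x none + x (some 2)) * ThreeC.a η 2 i = _
  rcases zmod_three_cases i with rfl | rfl | rfl <;>
  simp [ThreeC.a_apply, show (0 : ZMod 3) ≠ 2 by decide,
    show (1 : ZMod 3) ≠ 2 by decide, show (2 : ZMod 3) ≠ 0 by decide,
    show (2 : ZMod 3) ≠ 1 by decide]

theorem toThreeC_a (h2 : (2 : F) ≠ 0) (i : ZMod 3) : toThreeC h2 η (a η i) = ThreeC.a η i := by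
  funext j
  rw [toThreeC_apply_apply, a_apply_none, a_apply_some, ThreeC.a_apply, zero_add]

theorem toThreeC_surjective (h2 : (2 : F) ≠ 0) : Function.Surjective (toThreeC h2 η) := by
  intro x
  refine ⟨x 0 • a η 0 + x 1 • a η 1 + x 2 • a η 2, ?_⟩
  simp only [map_add, map_smul, toThreeC_a]
  exact (ThreeC.eq_sum_basis x).symm

/-- A vector of `3Ĉ(η)` is sent to zero when its coordinate at each `âᵢ` cancels that at `q̂`, since
`q̂` goes to the sum of the three axes. -/
theorem toThreeC_mem_bot_iff (h2 : (2 : F) ≠ 0) (x : HatThreeC η) :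
    toThreeC h2 η x ∈ (⊥ : Submodule F (ThreeC η)) ↔ x ∈ Submodule.span F {r η} := by
  rw [Submodule.mem_bot, r_mem_iff_span]
  constructor
  · intro h i
    have := toThreeC_apply_apply h2 x i
    rw [h] at this
    exact eq_neg_of_add_eq_zero_right this.symm
  · intro h
    funext i
    rw [toThreeC_apply_apply, h, add_neg_cancel]
    rfl

theorem _root_.ThreeC.sum_apply (i : ZMod 3) : ThreeC.sum η i = 1 := by
  change ThreeC.a η 0 i + ThreeC.a η 1 i + ThreeC.a η 2 i = 1
  rcases zmod_three_cases i with rfl | rfl | rfl <;>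
  simp [ThreeC.a_apply, show (0 : ZMod 3) ≠ 2 by decide,
    show (1 : ZMod 3) ≠ 2 by decide, show (2 : ZMod 3) ≠ 0 by decide,
    show (2 : ZMod 3) ≠ 1 by decide]

/-- Both conditions say that the three coordinates at the `âᵢ` agree. -/
theorem toThreeC_mem_span_sum_iff (h2 : (2 : F) ≠ 0) (x : HatThreeC η) :
    toThreeC h2 η x ∈ Submodule.span F {ThreeC.sum η} ↔ x ∈ Submodule.span F {r η, q η} := by
  rw [mem_span_r_q, Submodule.mem_span_singleton]
  have happ : ∀ (c : F) (i : ZMod 3), (c • ThreeC.sum η) i = c := fun c i => by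
    change c * ThreeC.sum η i = c
    rw [ThreeC.sum_apply, mul_one]
  constructor
  · rintro ⟨c, hc⟩
    have h : ∀ i, x (some i) = c - x none := fun i => by
      rw [← happ c i, hc, toThreeC_apply_apply, add_sub_cancel_left]
    rw [h, h, h]
    exact ⟨rfl, rfl⟩
  · rintro ⟨h, h'⟩
    refine ⟨x none + x (some 0), ?_⟩
    funext i
    rw [happ, toThreeC_apply_apply]
    rcases zmod_three_cases i with rfl | rfl | rfl
    · rfl
    · rw [h]
    · rw [h, h']

theorem augmentHom_a (h2 : (2 : F) ≠ 0) (i : ZMod 3) : augmentHom h2 η (a η i) = 1 := by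
  rw [augmentHom_apply, augment_apply, a_apply_none, a_apply_some, a_apply_some, a_apply_some]
  rcases zmod_three_cases i with rfl | rfl | rfl <;>
  simp [show (0 : ZMod 3) ≠ 2 by decide,
    show (1 : ZMod 3) ≠ 2 by decide, show (2 : ZMod 3) ≠ 0 by decide,
    show (2 : ZMod 3) ≠ 1 by decide]

theorem augmentHom_surjective (h2 : (2 : F) ≠ 0) : Function.Surjective (augmentHom h2 η) :=
  fun c => ⟨c • a η 0, by rw [map_smul, augmentHom_a, smul_eq_mul, mul_one]⟩

theorem augmentHom_mem_bot_iff (h2 : (2 : F) ≠ 0) (x : HatThreeC η) :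
    augmentHom h2 η x ∈ (⊥ : Submodule F F) ↔ x ∈ LinearMap.ker (augment η) := by
  rw [augmentHom_apply, Submodule.mem_bot, LinearMap.mem_ker]

theorem swap_apply_apply (x : HatThreeC η) : swap η x none = x none ∧
    swap η x (some 0) = x (some 1) ∧ swap η x (some 1) = x (some 0) ∧
    swap η x (some 2) = x (some 2) := by
  rw [swap_apply]
  simp [smul_apply, add_apply, q_apply_none, q_apply_some, a_apply_none,
    a_apply_some, show (0 : ZMod 3) ≠ 2 by decide, show (1 : ZMod 3) ≠ 2 by decide,
    show (2 : ZMod 3) ≠ 0 by decide, show (2 : ZMod 3) ≠ 1 by decide]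

theorem forall_zmod_three {p : ZMod 3 → Prop} : (∀ i, p i) ↔ p 0 ∧ p 1 ∧ p 2 :=
  ⟨fun h => ⟨h 0, h 1, h 2⟩, fun ⟨h0, h1, h2⟩ i => by
    rcases zmod_three_cases i with rfl | rfl | rfl <;> assumption⟩

theorem swap_mem_span_r_iff (x : HatThreeC η) :
    swap η x ∈ Submodule.span F {r η} ↔ x ∈ Submodule.span F {r η} := by
  obtain ⟨hn, h0, h1, h2⟩ := swap_apply_apply x
  rw [r_mem_iff_span, r_mem_iff_span, forall_zmod_three, forall_zmod_three, hn, h0, h1, h2]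
  tauto

theorem swap_mem_span_q_iff (x : HatThreeC η) :
    swap η x ∈ Submodule.span F {q η} ↔ x ∈ Submodule.span F {q η} := by
  obtain ⟨hn, h0, h1, h2⟩ := swap_apply_apply x
  rw [mem_span_q, mem_span_q, forall_zmod_three, forall_zmod_three, h0, h1, h2]
  tauto

theorem swap_mem_span_r_q_iff (x : HatThreeC η) :
    swap η x ∈ Submodule.span F {r η, q η} ↔ x ∈ Submodule.span F {r η, q η} := by
  obtain ⟨hn, h0, h1, h2⟩ := swap_apply_apply x
  rw [mem_span_r_q, mem_span_r_q, h0, h1, h2]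
  constructor <;> rintro ⟨h, h'⟩
  · exact ⟨h.symm, h.trans h'⟩
  · exact ⟨h.symm, h.trans h'⟩

theorem swap_mem_ker_augment_iff (x : HatThreeC η) :
    swap η x ∈ LinearMap.ker (augment η) ↔ x ∈ LinearMap.ker (augment η) := by
  obtain ⟨hn, h0, h1, h2⟩ := swap_apply_apply x
  rw [LinearMap.mem_ker, LinearMap.mem_ker, augment_apply, augment_apply, hn, h0, h1, h2,
    add_comm (x (some 1))]

theorem swap_mem_bot_iff (x : HatThreeC η) :
    swap η x ∈ (⊥ : Submodule F (HatThreeC η)) ↔ x ∈ (⊥ : Submodule F (HatThreeC η)) := by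
  rw [Submodule.mem_bot, Submodule.mem_bot]
  refine ⟨fun h => ?_, fun h => by rw [h, map_zero]⟩
  rw [← swap_swap x, h, map_zero]

end HatThreeC

variable {M : Type v} [NonUnitalNonAssocCommRing M] [Module F M] {π : HatFour η →ₙₐ[F] M}
  {A B : Submodule F F}

theorem AlgIdeal.projHom_surjective {A : Type u} [NonUnitalNonAssocCommRing A] [Module F A]
    (I : AlgIdeal F A) : Function.Surjective I.projHom := I.proj_surjective

theorem mem_span_singleton_prod_zero {X B : Type u} [AddCommGroup X] [Module F X]
    [AddCommGroup B] [Module F B] (z : X) (w : X × B) :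
    w ∈ Submodule.span F {((z, 0) : X × B)} ↔ w.1 ∈ Submodule.span F {z} ∧ w.2 = 0 := by
  have h : Submodule.span F {((z, 0) : X × B)} = (Submodule.span F {z}).prod ⊥ := by
    rw [← Submodule.map_inl, Submodule.map_span, Set.image_singleton]
    rfl
  rw [h]
  rfl

theorem HatFour.axis₀_eq : axis₀ η = (HatThreeC.a η 0, (1, 0)) :=
  Prod.ext (add_zero _) (zero_add _)

theorem HatFour.axis₁_eq : axis₁ η = (HatThreeC.a η 1, (0, 1)) :=
  Prod.ext (add_zero _) (zero_add _)

open HatFour in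
theorem exists_name_of_ker_bot (hπ : Function.Surjective π)
    (hker : ∀ x, π x = 0 ↔ x ∈ Submodule.prod (⊥) (A.prod B)) :
    ∃ t : GenericName, t.Iso η {π (axis₀ η), π (axis₁ η)} ∧ ∃ R ∈ t.ideals η,
      IsQuotientOfHatFour η (π (axis₀ η)) (π (axis₁ η)) R := by
  have hbase : (⊥ : Submodule F (HatFour η)) = Submodule.prod ⊥ (Submodule.prod ⊥ ⊥) := by
    rw [Submodule.prod_bot, Submodule.prod_bot]
  have h₀ := span_insert_s₀ (Submodule.span_empty.trans hbase)
  have h₁ := span_insert_s₁ (Submodule.span_empty.trans hbase)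
  have h₀₁ := span_insert_s₀ h₁
  rw [insert_empty_eq] at h₀ h₁ h₀₁
  have hZ := fun y : HatThreeC η => Iff.refl
    (NonUnitalAlgHom.id F (HatThreeC η) y ∈ (⊥ : Submodule F (HatThreeC η)))
  rcases eq_bot_or_eq_top A with rfl | rfl <;> rcases eq_bot_or_eq_top B with rfl | rfl
  · refine ⟨.hatFour, ?_, _, rfl, π, hπ, rfl, rfl, fun x => ?_⟩
    · have h := axialIso_of_ker_prod_bot_bot hπ Function.surjective_id hZ
        (p := NonUnitalAlgHom.id F _) Function.surjective_id (fun w => Prod.ext_iff) hker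
      rw [NonUnitalAlgHom.coe_id, Set.image_id] at h
      change AxialIso F _ {axis₀ η, axis₁ η}
      rwa [axis₀_eq (η := η), axis₁_eq (η := η)] at h ⊢
    · rw [hker, hbase]
  · refine ⟨.hatThreeC_oneA, ?_, _, Or.inr rfl, π, hπ, rfl, rfl, fun x => ?_⟩
    · have h := axialIso_of_ker_prod_bot_top hπ Function.surjective_id hZ HatThreeC.swap_mem_bot_iff
        (p := NonUnitalAlgHom.id F _) Function.surjective_id (fun w => Prod.ext_iff) hker
      rwa [NonUnitalAlgHom.coe_id, Set.image_id] at h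
    · rw [hker, h₁]
  · refine ⟨.hatThreeC_oneA, ?_, _, Or.inl rfl, π, hπ, rfl, rfl, fun x => ?_⟩
    · have h := axialIso_of_ker_prod_top_bot hπ Function.surjective_id hZ
        (p := NonUnitalAlgHom.id F _) Function.surjective_id (fun w => Prod.ext_iff) hker
      rwa [NonUnitalAlgHom.coe_id, Set.image_id] at h
    · rw [hker, h₀]
  · refine ⟨.hatThreeC, ?_, _, rfl, π, hπ, rfl, rfl, fun x => ?_⟩
    · have h := axialIso_of_ker_prod_top_top hπ Function.surjective_id hZ
        (p := NonUnitalAlgHom.id F _) Function.surjective_id (fun w => Iff.rfl) hker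
      rwa [NonUnitalAlgHom.coe_id, Set.image_id] at h
    · rw [hker, h₀₁]

open HatFour in
theorem exists_name_of_ker_span_r (h2 : (2 : F) ≠ 0) (hπ : Function.Surjective π)
    (hker : ∀ x, π x = 0 ↔ x ∈ Submodule.prod (Submodule.span F {HatThreeC.r η}) (A.prod B)) :
    ∃ t : GenericName, t.Iso η {π (axis₀ η), π (axis₁ η)} ∧ ∃ R ∈ t.ideals η,
      IsQuotientOfHatFour η (π (axis₀ η)) (π (axis₁ η)) R := by
  have hbase := span_r (η := η)
  have h₀ := span_insert_s₀ hbase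
  have h₁ := span_insert_s₁ hbase
  have h₀₁ := span_insert_s₀ h₁
  have hZ := HatThreeC.toThreeC_mem_bot_iff (η := η) h2
  rcases eq_bot_or_eq_top A with rfl | rfl <;> rcases eq_bot_or_eq_top B with rfl | rfl
  · refine ⟨.threeC_twoA, ?_, _, rfl, π, hπ, rfl, rfl, fun x => ?_⟩
    · have h := axialIso_of_ker_prod_bot_bot hπ (HatThreeC.toThreeC_surjective h2) hZ
        (p := NonUnitalAlgHom.id F _) Function.surjective_id (fun w => Prod.ext_iff) hker
      rwa [HatThreeC.toThreeC_a, HatThreeC.toThreeC_a, NonUnitalAlgHom.coe_id, Set.image_id] at h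
    · rw [hker, hbase]
  · refine ⟨.threeC_oneA, ?_, _, Or.inr rfl, π, hπ, rfl, rfl, fun x => ?_⟩
    · have h := axialIso_of_ker_prod_bot_top hπ (HatThreeC.toThreeC_surjective h2) hZ HatThreeC.swap_mem_span_r_iff
        (p := NonUnitalAlgHom.id F _) Function.surjective_id (fun w => Prod.ext_iff) hker
      rwa [HatThreeC.toThreeC_a, HatThreeC.toThreeC_a, NonUnitalAlgHom.coe_id, Set.image_id] at h
    · rw [hker, h₁]
  · refine ⟨.threeC_oneA, ?_, _, Or.inl rfl, π, hπ, rfl, rfl, fun x => ?_⟩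
    · have h := axialIso_of_ker_prod_top_bot hπ (HatThreeC.toThreeC_surjective h2) hZ
        (p := NonUnitalAlgHom.id F _) Function.surjective_id (fun w => Prod.ext_iff) hker
      rwa [HatThreeC.toThreeC_a, HatThreeC.toThreeC_a, NonUnitalAlgHom.coe_id, Set.image_id] at h
    · rw [hker, h₀]
  · refine ⟨.threeC, ?_, _, rfl, π, hπ, rfl, rfl, fun x => ?_⟩
    · have h := axialIso_of_ker_prod_top_top hπ (HatThreeC.toThreeC_surjective h2) hZ
        (p := NonUnitalAlgHom.id F _) Function.surjective_id (fun w => Iff.rfl) hker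
      rwa [HatThreeC.toThreeC_a, HatThreeC.toThreeC_a, NonUnitalAlgHom.coe_id, Set.image_id] at h
    · rw [hker, h₀₁]

open HatFour in
theorem exists_name_of_ker_augment (h2 : (2 : F) ≠ 0) (hπ : Function.Surjective π)
    (hker : ∀ x, π x = 0 ↔ x ∈ Submodule.prod (LinearMap.ker (HatThreeC.augment η)) (A.prod B)) :
    ∃ t : GenericName, t.Iso η {π (axis₀ η), π (axis₁ η)} ∧ ∃ R ∈ t.ideals η,
      IsQuotientOfHatFour η (π (axis₀ η)) (π (axis₁ η)) R := by
  have hbase := span_sub (η := η)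
  have h₀ := span_insert_s₀ hbase
  have h₁ := span_insert_s₁ hbase
  have h₀₁ := span_insert_s₀ h₁
  -- The lists of generators in `GenericName.ideals` have `s₀`, `s₁` at the end, while the spans
  -- were built by inserting them in front.
  have hr : ∀ x y z s : HatFour η, ({x, y, z, s} : Set (HatFour η)) = {s, x, y, z} := by
    intro x y z s
    ext
    simp only [Set.mem_insert_iff, Set.mem_singleton_iff]
    tauto
  have hr' : ∀ x y z s t : HatFour η, ({x, y, z, s, t} : Set (HatFour η)) = {s, t, x, y, z} := by
    intro x y z s t
    ext
    simp only [Set.mem_insert_iff, Set.mem_singleton_iff]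
    tauto
  rw [← hr] at h₀ h₁
  rw [← hr'] at h₀₁
  have hZ := HatThreeC.augmentHom_mem_bot_iff (η := η) h2
  rcases eq_bot_or_eq_top A with rfl | rfl <;> rcases eq_bot_or_eq_top B with rfl | rfl
  · refine ⟨.hatTwoA, ?_, _, rfl, π, hπ, rfl, rfl, fun x => ?_⟩
    · have h := axialIso_of_ker_prod_bot_bot hπ (HatThreeC.augmentHom_surjective h2) hZ
        (p := NonUnitalAlgHom.id F _) Function.surjective_id (fun w => Prod.ext_iff) hker
      rwa [HatThreeC.augmentHom_a, HatThreeC.augmentHom_a, NonUnitalAlgHom.coe_id,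
        Set.image_id] at h
    · rw [hker, hbase]
  · refine ⟨.hatOneA, ?_, _, Or.inr rfl, π, hπ, rfl, rfl, fun x => ?_⟩
    · have h := axialIso_of_ker_prod_bot_top hπ (HatThreeC.augmentHom_surjective h2) hZ HatThreeC.swap_mem_ker_augment_iff
        (p := NonUnitalAlgHom.id F _) Function.surjective_id (fun w => Prod.ext_iff) hker
      rwa [HatThreeC.augmentHom_a, HatThreeC.augmentHom_a, NonUnitalAlgHom.coe_id,
        Set.image_id] at h
    · rw [hker, h₁]
  · refine ⟨.hatOneA, ?_, _, Or.inl rfl, π, hπ, rfl, rfl, fun x => ?_⟩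
    · have h := axialIso_of_ker_prod_top_bot hπ (HatThreeC.augmentHom_surjective h2) hZ
        (p := NonUnitalAlgHom.id F _) Function.surjective_id (fun w => Prod.ext_iff) hker
      rwa [HatThreeC.augmentHom_a, HatThreeC.augmentHom_a, NonUnitalAlgHom.coe_id,
        Set.image_id] at h
    · rw [hker, h₀]
  -- Both axes are sent to `1`, so the set of axes is a singleton.
  · refine ⟨.oneA, ?_, _, Or.inr (Or.inr rfl), π, hπ, rfl, rfl, fun x => ?_⟩
    · have h := axialIso_of_ker_prod_top_top hπ (HatThreeC.augmentHom_surjective h2) hZ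
        (p := NonUnitalAlgHom.id F _) Function.surjective_id (fun w => Iff.rfl) hker
      rw [HatThreeC.augmentHom_a, HatThreeC.augmentHom_a, NonUnitalAlgHom.coe_id, Set.image_id,
        Set.pair_eq_singleton] at h
      exact Or.inl h
    · rw [hker, h₀₁]

open HatFour in
-- The summand `3Ĉ(η)` disappears. If one of `s₀`, `s₁` is also divided out, the corresponding axis
-- becomes zero, which is why `1A` is admitted with the pair `{1, 0}`.
theorem exists_name_of_ker_top [Nontrivial M] (hπ : Function.Surjective π)
    (hker : ∀ x, π x = 0 ↔ x ∈ Submodule.prod ⊤ (A.prod B)) :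
    ∃ t : GenericName, t.Iso η {π (axis₀ η), π (axis₁ η)} ∧ ∃ R ∈ t.ideals η,
      IsQuotientOfHatFour η (π (axis₀ η)) (π (axis₁ η)) R := by
  have hbase := span_a (η := η)
  have h₀ := span_insert_s₀ hbase
  have h₁ := span_insert_s₁ hbase
  have hr : ∀ x y z t s : HatFour η, ({x, y, z, t, s} : Set (HatFour η)) = {s, x, y, z, t} := by
    intro x y z t s
    ext
    simp only [Set.mem_insert_iff, Set.mem_singleton_iff]
    tauto
  rw [← hr] at h₀ h₁
  rcases eq_bot_or_eq_top A with rfl | rfl <;> rcases eq_bot_or_eq_top B with rfl | rfl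
  · refine ⟨.twoA, ?_, _, rfl, π, hπ, rfl, rfl, fun x => ?_⟩
    · have h := axialIso_of_ker_eq hπ (ρ := sndHom (HatThreeC η) (F × F)) Prod.snd_surjective
        (fun x => by
          rw [hker]
          exact (and_iff_right trivial).trans
            ⟨fun h => Prod.ext h.1 h.2, fun h => ⟨congrArg Prod.fst h, congrArg Prod.snd h⟩⟩) {axis₀ η, axis₁ η}
      rw [Set.image_pair, Set.image_pair, axis₀_eq, axis₁_eq] at h
      rw [axis₀_eq, axis₁_eq]
      exact h
    · rw [hker, hbase]
  · refine ⟨.oneA, Or.inr ?_, _, Or.inr (Or.inl rfl), π, hπ, rfl, rfl, fun x => ?_⟩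
    · have h := axialIso_of_ker_eq hπ
        (ρ := (fstHom F F).comp (sndHom (HatThreeC η) (F × F)))
        (Prod.fst_surjective.comp Prod.snd_surjective)
        (fun x => by
          rw [hker]
          exact (and_iff_right trivial).trans (and_iff_left trivial)) {axis₀ η, axis₁ η}
      rw [Set.image_pair, Set.image_pair, axis₀_eq, axis₁_eq] at h
      rw [axis₀_eq, axis₁_eq]
      exact h
    · rw [hker, h₁]
  · refine ⟨.oneA, Or.inr ?_, _, Or.inl rfl, π, hπ, rfl, rfl, fun x => ?_⟩
    · have h := axialIso_of_ker_eq hπ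
        (ρ := (sndHom F F).comp (sndHom (HatThreeC η) (F × F)))
        (Prod.snd_surjective.comp Prod.snd_surjective)
        (fun x => by
          rw [hker]
          exact (and_iff_right trivial).trans (and_iff_right trivial)) {axis₀ η, axis₁ η}
      rw [Set.image_pair, Set.image_pair, axis₀_eq, axis₁_eq] at h
      rw [axis₀_eq, axis₁_eq, Set.pair_comm (1 : F)]
      exact h
    · rw [hker, h₀]
  -- The kernel is all of `4̂(η)`, which contradicts the nontriviality of `M`.
  · obtain ⟨m, hm⟩ := exists_ne (0 : M)
    obtain ⟨x, rfl⟩ := hπ m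
    exact absurd ((hker x).2 ⟨trivial, trivial, trivial⟩) hm

section Special

variable {π : HatFour (-1 : F) →ₙₐ[F] M}

open HatFour in
theorem exists_specialName_of_ker_span_q (h2 : (2 : F) ≠ 0) (hπ : Function.Surjective π)
    (hker : ∀ x, π x = 0 ↔ x ∈ Submodule.prod (Submodule.span F {HatThreeC.q (-1 : F)}) (A.prod B)) :
    ∃ t : SpecialName, t.Iso h2 {π (axis₀ (-1)), π (axis₁ (-1))} ∧ ∃ R ∈ t.ideals F,
      IsQuotientOfHatFour (-1) (π (axis₀ (-1))) (π (axis₁ (-1))) R := by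
  have hbase := span_q (η := (-1 : F))
  have h₀ := span_insert_s₀ hbase
  have h₁ := span_insert_s₁ hbase
  have h₀₁ := span_insert_s₀ h₁
  have hZ := fun y : HatThreeC (-1 : F) => Iff.refl
    (NonUnitalAlgHom.id F (HatThreeC (-1 : F)) y ∈ Submodule.span F {HatThreeC.q (-1 : F)})
  rcases eq_bot_or_eq_top A with rfl | rfl <;> rcases eq_bot_or_eq_top B with rfl | rfl
  · refine ⟨.hatFour, ?_, _, rfl, π, hπ, rfl, rfl, fun x => ?_⟩
    · have h := axialIso_of_ker_prod_bot_bot hπ Function.surjective_id hZ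
        (p := (hatThreeCProdIdeal (F := F) (F × F)).projHom) (AlgIdeal.projHom_surjective _) (fun w =>
          (AlgIdeal.projHom_eq_zero_iff _ w).trans (mem_span_singleton_prod_zero _ w)) hker
      rw [SpecialName.Iso]
      rw [axis₀_eq, axis₁_eq] at h ⊢
      exact h
    · rw [hker, hbase]
  · refine ⟨.hatThreeC_oneA, ?_, _, Or.inr rfl, π, hπ, rfl, rfl, fun x => ?_⟩
    · have h := axialIso_of_ker_prod_bot_top hπ Function.surjective_id hZ HatThreeC.swap_mem_span_q_iff
        (p := (hatThreeCProdIdeal (F := F) F).projHom) (AlgIdeal.projHom_surjective _) (fun w =>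
          (AlgIdeal.projHom_eq_zero_iff _ w).trans (mem_span_singleton_prod_zero _ w)) hker
      exact h
    · rw [hker, h₁]
  · refine ⟨.hatThreeC_oneA, ?_, _, Or.inl rfl, π, hπ, rfl, rfl, fun x => ?_⟩
    · have h := axialIso_of_ker_prod_top_bot hπ Function.surjective_id hZ
        (p := (hatThreeCProdIdeal (F := F) F).projHom) (AlgIdeal.projHom_surjective _) (fun w =>
          (AlgIdeal.projHom_eq_zero_iff _ w).trans (mem_span_singleton_prod_zero _ w)) hker
      exact h
    · rw [hker, h₀]
  · refine ⟨.hatThreeC, ?_, _, rfl, π, hπ, rfl, rfl, fun x => ?_⟩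
    · have h := axialIso_of_ker_prod_top_top hπ Function.surjective_id hZ
        (p := (hatThreeCIdeal (F := F)).projHom) (AlgIdeal.projHom_surjective _) (AlgIdeal.projHom_eq_zero_iff _) hker
      exact h
    · rw [hker, h₀₁]

open HatFour in
theorem exists_specialName_of_ker_span_r_q (h2 : (2 : F) ≠ 0) (hπ : Function.Surjective π)
    (hker : ∀ x, π x = 0 ↔ x ∈ Submodule.prod (Submodule.span F {HatThreeC.r (-1 : F), HatThreeC.q (-1)}) (A.prod B)) :
    ∃ t : SpecialName, t.Iso h2 {π (axis₀ (-1)), π (axis₁ (-1))} ∧ ∃ R ∈ t.ideals F,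
      IsQuotientOfHatFour (-1) (π (axis₀ (-1))) (π (axis₁ (-1))) R := by
  have hbase := span_sum_q (η := (-1 : F))
  have h₀ := span_insert_s₀ hbase
  have h₁ := span_insert_s₁ hbase
  have h₀₁ := span_insert_s₀ h₁
  have hZ := HatThreeC.toThreeC_mem_span_sum_iff (η := (-1 : F)) h2
  rcases eq_bot_or_eq_top A with rfl | rfl <;> rcases eq_bot_or_eq_top B with rfl | rfl
  · refine ⟨.threeC_twoA, ?_, _, rfl, π, hπ, rfl, rfl, fun x => ?_⟩
    · have h := axialIso_of_ker_prod_bot_bot hπ (HatThreeC.toThreeC_surjective h2) hZ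
        (p := (threeCProdIdeal h2 (F × F)).projHom) (AlgIdeal.projHom_surjective _) (fun w =>
          (AlgIdeal.projHom_eq_zero_iff _ w).trans (mem_span_singleton_prod_zero _ w)) hker
      rwa [HatThreeC.toThreeC_a, HatThreeC.toThreeC_a] at h
    · rw [hker, hbase]
  · refine ⟨.threeC_oneA, ?_, _, Or.inr rfl, π, hπ, rfl, rfl, fun x => ?_⟩
    · have h := axialIso_of_ker_prod_bot_top hπ (HatThreeC.toThreeC_surjective h2) hZ HatThreeC.swap_mem_span_r_q_iff
        (p := (threeCProdIdeal h2 F).projHom) (AlgIdeal.projHom_surjective _) (fun w =>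
          (AlgIdeal.projHom_eq_zero_iff _ w).trans (mem_span_singleton_prod_zero _ w)) hker
      rwa [HatThreeC.toThreeC_a, HatThreeC.toThreeC_a] at h
    · rw [hker, h₁]
  · refine ⟨.threeC_oneA, ?_, _, Or.inl rfl, π, hπ, rfl, rfl, fun x => ?_⟩
    · have h := axialIso_of_ker_prod_top_bot hπ (HatThreeC.toThreeC_surjective h2) hZ
        (p := (threeCProdIdeal h2 F).projHom) (AlgIdeal.projHom_surjective _) (fun w =>
          (AlgIdeal.projHom_eq_zero_iff _ w).trans (mem_span_singleton_prod_zero _ w)) hker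
      rwa [HatThreeC.toThreeC_a, HatThreeC.toThreeC_a] at h
    · rw [hker, h₀]
  · refine ⟨.threeC, ?_, _, rfl, π, hπ, rfl, rfl, fun x => ?_⟩
    · have h := axialIso_of_ker_prod_top_top hπ (HatThreeC.toThreeC_surjective h2) hZ
        (p := (threeCIdeal h2).projHom) (AlgIdeal.projHom_surjective _) (AlgIdeal.projHom_eq_zero_iff _) hker
      rwa [HatThreeC.toThreeC_a, HatThreeC.toThreeC_a] at h
    · rw [hker, h₀₁]

end Special

variable [IsScalarTower F M M] [SMulCommClass F M M]

/-- The multiplication table of the axial algebra and the classification of the ideals of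
`3Ĉ(η)`. -/
theorem IsJordanAxialAlgebra.exists_ker_eq_prod (h2 : (2 : F) ≠ 0)
    {Φ : Set JordanLabel} (hΦ : Φ ⊆ {JordanLabel.zero, JordanLabel.one})
    (hΦ' : Φ ≠ {JordanLabel.zero, JordanLabel.one}) {a b : M} (h0 : η ≠ 0) (h1 : η ≠ 1)
    (hh : η ≠ 1 / 2) (H : IsJordanAxialAlgebra Φ η ({a, b} : Set M)) :
    ∃ π : HatFour η →ₙₐ[F] M, Function.Surjective π ∧ π (HatFour.axis₀ η) = a ∧
      π (HatFour.axis₁ η) = b ∧ ∃ (K : Submodule F (HatThreeC η)) (A B : Submodule F F),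
      HatThreeC.IsIdeal K ∧ ∀ x, π x = 0 ↔ x ∈ K.prod (A.prod B) := by
  obtain ⟨q, s, t, r, hT⟩ := H.exists_table h2 hΦ hΦ' h0 h1 hh
  obtain ⟨π, ha, hb⟩ := hT.exists_hom h2 h0
  exact ⟨π, surjective_of_generates H.generates π ha hb, ha, hb, HatFour.exists_ker_eq_prod π⟩

end Conclusion

theorem theorem3 {F : Type u} [Field F] (h2 : (2 : F) ≠ 0)
    {M : Type v} [NonUnitalNonAssocCommRing M] [Module F M] [IsScalarTower F M M]
    [SMulCommClass F M M] [Nontrivial M]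
    (Φ : Set JordanLabel) (hΦ : Φ ⊆ {JordanLabel.zero, JordanLabel.one})
    (hΦ' : Φ ≠ {JordanLabel.zero, JordanLabel.one}) (a₀ a₁ : M) :
    (∀ η : F, η ≠ 0 → η ≠ 1 → η ≠ 1 / 2 → η ≠ -1 →
      IsJordanAxialAlgebra Φ η ({a₀, a₁} : Set M) →
        ∃ t : GenericName, t.Iso η ({a₀, a₁} : Set M) ∧
          ∃ R ∈ t.ideals η, IsQuotientOfHatFour η a₀ a₁ R) ∧
    ((-1 : F) ≠ 1 / 2 →
      IsJordanAxialAlgebra Φ (-1 : F) ({a₀, a₁} : Set M) →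
        (∃ t : GenericName, t.Iso (-1 : F) ({a₀, a₁} : Set M) ∧
          ∃ R ∈ t.ideals (-1 : F), IsQuotientOfHatFour (-1) a₀ a₁ R) ∨
        (∃ t : SpecialName, t.Iso h2 ({a₀, a₁} : Set M) ∧
          ∃ R ∈ t.ideals F, IsQuotientOfHatFour (-1) a₀ a₁ R)) := by
  refine ⟨fun η h0 h1 hh hne H => ?_, fun hh H => ?_⟩
  · obtain ⟨π, hπ, rfl, rfl, K, A, B, hK, hker⟩ := H.exists_ker_eq_prod h2 hΦ hΦ' h0 h1 hh
    rcases hK.classification h2 h0 h1 with rfl | rfl | rfl | rfl | ⟨hη, -⟩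
    · exact exists_name_of_ker_bot hπ hker
    · exact exists_name_of_ker_span_r h2 hπ hker
    · exact exists_name_of_ker_augment h2 hπ hker
    · exact exists_name_of_ker_top hπ hker
    · exact absurd hη hne
  · have h0 : (-1 : F) ≠ 0 := neg_ne_zero.2 one_ne_zero
    have h1 : (-1 : F) ≠ 1 := fun h => h2 (by linear_combination -h)
    obtain ⟨π, hπ, rfl, rfl, K, A, B, hK, hker⟩ := H.exists_ker_eq_prod h2 hΦ hΦ' h0 h1 hh
    rcases hK.classification h2 h0 h1 with rfl | rfl | rfl | rfl | ⟨-, rfl | rfl⟩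
    · exact Or.inl (exists_name_of_ker_bot hπ hker)
    · exact Or.inl (exists_name_of_ker_span_r h2 hπ hker)
    · exact Or.inl (exists_name_of_ker_augment h2 hπ hker)
    · exact Or.inl (exists_name_of_ker_top hπ hker)
    · exact Or.inr (exists_specialName_of_ker_span_q h2 hπ hker)
    · exact Or.inr (exists_specialName_of_ker_span_r_q h2 hπ hker)
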